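/- **Setting.** Let $M$ be a smooth real 3-manifold with a flag structure, that is, two complex line sub-bundles $T^1,T^2\subset TM\otimes\mathbb C$ with $T^1\cap T^2=0$ such that $T^1\oplus T^2$ is a contact distribution. Fix a global contact form $\theta$ ($\ker\theta=T^1\oplus T^2$) and smooth complex 1-forms $Z^1,Z^2$ on $M$ with $\ker Z^1\supset T^2$, $Z^1(T^1)\neq0$, $\ker Z^2\supset T^1$, $Z^2(T^2)\ne0$ and $d\theta=Z^1\wedge Z^2$. *The bundle $Y$ and its connection.* $E$ is the $\mathbb C^*$-bundle of contact forms $\lambda\theta$, and $Y\to E\to M$ is the bundle of coframes $$\omega=\lambda\theta,\quad \omega^1=a^1Z^1+v^1\lambda\theta,\quad \omega^2=a^2Z^2+v^2\lambda\theta,\quad \varphi=-\tfrac{d\lambda}{\lambda}+a^1v^2Z^1-a^2v^1Z^2+t\,\theta,$$ with $a^1,a^2\in\mathbb C^*$, $a^1a^2=\lambda$, $v^1,v^2,t\in\mathbb C$; the same letters denote the tautological forms on $Y$. The canonical connection is the form $$\pi=\begin{pmatrix}-\frac12\varphi-\frac13\omega^1_1&-\varphi^2&-\frac14\psi\\ \omega^1&\frac23\omega_1^1&\frac12\varphi^1\\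 2\omega&2\omega^2&\frac12\varphi-\frac13\omega_1^1\end{pmatrix}$$ on $Y$, where $\omega_1^1,\varphi^1,\varphi^2,\psi$ are the unique smooth 1-forms on $Y$ such that $$\Pi:=d\pi+\pi\wedge\pi=\begin{pmatrix}0&-\Phi^2&-\frac14\Psi\\0&0&\frac12\Phi^1\\0&0&0\end{pmatrix}$$ with $\Phi^1=Q^1\omega\wedge\omega^2$, $\Phi^2=Q^2\omega\wedge\omega^1$, $\Psi=(U_1\omega^1+U_2\omega^2)\wedge\omega$ for some functions $Q^1,Q^2,U_1,U_2$. Put $$TC_2(\pi)=\frac1{8\pi^2}\Big(\mathrm{tr}(\pi\wedge\Pi)+\tfrac13\mathrm{tr}(\pi\wedge\pi\wedge\pi)\Big).$$ *The reduced bundle $X$.* $X\to M$ is the $\mathbb C^*$-bundle of coframes $(\theta,\theta^1,\theta^2)=(\theta,aZ^1,a^{-1}Z^2)$, $a\in\mathbb C^*$, and $\theta_1^1,\tau^1,\tau^2$ are the unique smooth 1-forms on $X$ with $$d\theta^1=\theta^1\wedge\theta_1^1+\theta\wedge\tau^1,\quad d\theta^2=-\theta^2\wedge\theta_1^1+\theta\wedge\tau^2,\quad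 \tau^1\wedge\theta^2=\tau^2\wedge\theta^1=0 .$$ $X$ is embedded in $Y$ by $a^1=a$, $a^2=a^{-1}$, $v^1=v^2=t=0$ (so $\lambda=1$). *Local data.* Let $\sigma:M\to X$ be a smooth section, and write $\theta,\theta^1,\theta^2,\theta_1^1,\tau^1,\tau^2$ also for the pullbacks by $\sigma$ to $M$. Functions on $M$ are defined by $$\tau^1=\tau^1_2\theta^2,\quad \tau^2=\tau^2_1\theta^1,\quad d\theta_1^1=R\,\theta^1\wedge\theta^2+W^1\theta^1\wedge\theta+W^2\theta^2\wedge\theta,\quad dR=R_0\theta+R_1\theta^1+R_2\theta^2,$$ $$dR_2+R_2\theta_1^1+R_1\tau_2^1\theta+\tfrac12R_0\theta^1=R_{02}\theta+R_{12}\theta^1+R_{22}\theta^2,\qquad dW^2+W^2\theta_1^1=W^2_0\theta+W^2_1\theta^1+W^2_2\theta^2,$$ $$E^1=\tfrac23\big(W^2-\tfrac14R_2\big),\quad E^2=\tfrac23\big(W^1-\tfrac14R_1\big),\quad \tau_2^1\tau_1^2-\tfrac13R_0+\tfrac1{16}R^2+\tfrac12G-\tfrac23W_1^2+\tfrac16R_{12}=0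 .$$ **Proposition 7.2.** Let $s:M\to Y$ be the composition of a smooth section $\sigma$ of $X$ with the embedding $X\to Y$. Then $s^*\omega=\theta$, $s^*\omega^1=\theta^1$, $s^*\omega^2=\theta^2$, $s^*\varphi=0$; the functions $E^1,E^2,G$ are the components of the pulled back connection, $$s^*\omega_1^1=\theta_1^1-\tfrac R4\theta,\quad s^*\varphi^1=-\tfrac R4\theta^1+E^1\theta+\tau^1,\quad s^*\varphi^2=\tfrac R4\theta^2+E^2\theta+\tau^2,\quad s^*\psi=E^2\theta^1-E^1\theta^2+G\theta;$$ and $$s^*TC_2(\pi)=\frac{1}{8\pi^2}\left[\theta\wedge\theta^1\wedge\theta^2\Big(\tfrac12G+\tfrac1{16}R^2-\tau_2^1\tau_1^2\Big)+\theta_1^1\wedge\Big(E^2\,\theta\wedge\theta^1+E^1\,\theta\wedge\theta^2-\tfrac R2\,\theta^1\wedge\theta^2\Big)\right].$$ -/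

import Mathlib

open scoped Manifold Topology TensorProduct

noncomputable section

namespace FlagGeometry

section Forms

variable {E : Type*} [NormedAddCommGroup E] [NormedSpace ℝ E] {H : Type*} [TopologicalSpace H]
  (I : ModelWithCorners ℝ E H) {N : Type*} [TopologicalSpace N] [ChartedSpace H N]

variable (N) in
/-- Complex valued 1-forms on `N`: sections (not necessarily smooth) of `T*N ⊗ ℂ`. -/
abbrev Form1 := ∀ x : N, TangentSpace I x →L[ℝ] ℂ

variable (N) in
/-- Complex valued 2-forms on `N`, written as functions of two tangent vectors. -/
abbrev Form2 := ∀ x : N, TangentSpace I x → TangentSpace I x → ℂ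

variable (N) in
/-- Complex valued 3-forms on `N`, written as functions of three tangent vectors. -/
abbrev Form3 := ∀ x : N, TangentSpace I x → TangentSpace I x → TangentSpace I x → ℂ

variable {I}

/-- The wedge product of two 1-forms. -/
def wedge (α β : Form1 I N) : Form2 I N := fun x u v => α x u * β x v - α x v * β x u

/-- The wedge product of a 1-form and a 2-form. -/
def wedge12 (α : Form1 I N) (β : Form2 I N) : Form3 I N := fun x u v w =>
  α x u * β x v w - α x v * β x u w + α x w * β x u v

variable (I) in
/-- The differential of a complex valued function. -/
def dFun (f : N → ℂ) : Form1 I N := fun x => mfderiv I 𝓘(ℝ, ℂ) f x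

/-- The 1-form `α` read in the preferred chart at `x₀`: its pullback to the model vector space
by the inverse of the chart (meaningful on the target of the chart). -/
def localRep (α : Form1 I N) (x₀ : N) : E → (E →L[ℝ] ℂ) := fun y =>
  (α ((extChartAt I x₀).symm y)).comp (mfderiv 𝓘(ℝ, E) I (extChartAt I x₀).symm y)

/-- The 1-form `α` is smooth at `x`. -/
def SmoothFormAt (α : Form1 I N) (x : N) : Prop :=
  ContDiffAt ℝ ((⊤ : ℕ∞) : WithTop ℕ∞) (localRep α x) (extChartAt I x x)

/-- The 1-form `α` is smooth. -/
def SmoothForm (α : Form1 I N) : Prop := ∀ x, SmoothFormAt α x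

/-- The exterior derivative of a 1-form, computed in the preferred chart at each point and
normalized by `dα(u, v) = u(α(v)) - v(α(u)) - α([u, v])`. -/
def extD (α : Form1 I N) : Form2 I N := fun x u v =>
  let D : E →L[ℝ] E →L[ℝ] ℂ := fderiv ℝ (localRep α x) (extChartAt I x x)
  let T : TangentSpace I x →L[ℝ] E := mfderiv I 𝓘(ℝ, E) (extChartAt I x) x
  D (T u) (T v) - D (T v) (T u)

variable {E' : Type*} [NormedAddCommGroup E'] [NormedSpace ℝ E'] {H' : Type*}
  [TopologicalSpace H'] {I' : ModelWithCorners ℝ E' H'} {N' : Type*} [TopologicalSpace N']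
  [ChartedSpace H' N']

/-- Pullback of a 1-form. -/
def pull1 (f : N → N') (α : Form1 I' N') : Form1 I N := fun x =>
  (α (f x)).comp (mfderiv I I' f x)

/-- Pullback of a 3-form. -/
def pull3 (f : N → N') (α : Form3 I' N') : Form3 I N := fun x u v w =>
  α (f x) (mfderiv I I' f x u) (mfderiv I I' f x v) (mfderiv I I' f x w)

/-- The curvature `dπ + π ∧ π` of a matrix of 1-forms. -/
def curvature (π : Matrix (Fin 3) (Fin 3) (Form1 I N)) : Matrix (Fin 3) (Fin 3) (Form2 I N) :=
  fun i j => extD (π i j) + ∑ k, wedge (π i k) (π k j)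

/-- The secondary form
`TC₂(π) = (1 / 8π²) (tr (π ∧ Π) + (1/3) tr (π ∧ π ∧ π))`, with `Π = dπ + π ∧ π`. -/
def TC2 (π : Matrix (Fin 3) (Fin 3) (Form1 I N)) : Form3 I N :=
  (1 / (8 * (Real.pi : ℂ) ^ 2)) •
    ((∑ i, ∑ j, wedge12 (π i j) (curvature π j i)) +
      (1 / 3 : ℂ) • ∑ i, ∑ j, ∑ k, wedge12 (π i j) (wedge (π j k) (π k i)))

end Forms

section Flag

variable {M : Type*} [TopologicalSpace M] [ChartedSpace (EuclideanSpace ℝ (Fin 3)) M]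

/-- The `ℂ`-linear extension of a covector to the complexified tangent space. -/
def complexify {x : M} (α : TangentSpace (𝓡 3) x →L[ℝ] ℂ) :
    ℂ ⊗[ℝ] TangentSpace (𝓡 3) x →ₗ[ℂ] ℂ :=
  LinearMap.liftBaseChange ℂ (α : TangentSpace (𝓡 3) x →ₗ[ℝ] ℂ)

/-- The kernel of a covector in the complexified tangent space. -/
def cker {x : M} (α : TangentSpace (𝓡 3) x →L[ℝ] ℂ) :
    Submodule ℂ (ℂ ⊗[ℝ] TangentSpace (𝓡 3) x) :=
  LinearMap.ker (complexify α)

/-- A family of lines in the complexified tangent spaces is a smooth line sub-bundle: near every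
point it is the common kernel of two smooth 1-forms. -/
structure IsLineSubbundle (T : ∀ x : M, Submodule ℂ (ℂ ⊗[ℝ] TangentSpace (𝓡 3) x)) : Prop where
  finrank_eq : ∀ x, Module.finrank ℂ (T x) = 1
  smooth : ∀ x₀ : M, ∃ η η' : Form1 (𝓡 3) M, ∀ᶠ x in 𝓝 x₀,
    SmoothFormAt η x ∧ SmoothFormAt η' x ∧ T x = cker (η x) ⊓ cker (η' x)

variable (M) in
/-- A flag structure: two line sub-bundles `T¹`, `T²` of the complexified tangent bundle with
trivial intersection whose sum is a contact distribution. -/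
structure FlagStructure where
  T1 : ∀ x : M, Submodule ℂ (ℂ ⊗[ℝ] TangentSpace (𝓡 3) x)
  T2 : ∀ x : M, Submodule ℂ (ℂ ⊗[ℝ] TangentSpace (𝓡 3) x)
  line1 : IsLineSubbundle T1
  line2 : IsLineSubbundle T2
  disjoint : ∀ x, T1 x ⊓ T2 x = ⊥
  contact : ∀ x₀ : M, ∃ θ : Form1 (𝓡 3) M, ∀ᶠ x in 𝓝 x₀,
    SmoothFormAt θ x ∧ cker (θ x) = T1 x ⊔ T2 x ∧ wedge12 θ (extD θ) x ≠ 0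

/-- A contact form `θ` of the flag structure together with forms `Z¹`, `Z²` such that
`ker Z¹ ⊃ T²`, `Z¹(T¹) ≠ 0`, `ker Z² ⊃ T¹`, `Z²(T²) ≠ 0` and `dθ = Z¹ ∧ Z²`. -/
structure AdaptedCoframe (F : FlagStructure M) where
  θ : Form1 (𝓡 3) M
  Z1 : Form1 (𝓡 3) M
  Z2 : Form1 (𝓡 3) M
  smooth_θ : SmoothForm θ
  smooth_Z1 : SmoothForm Z1
  smooth_Z2 : SmoothForm Z2
  ker_θ : ∀ x, cker (θ x) = F.T1 x ⊔ F.T2 x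
  ker_Z1 : ∀ x, F.T2 x ≤ cker (Z1 x)
  Z1_ne : ∀ x, ¬ F.T1 x ≤ cker (Z1 x)
  ker_Z2 : ∀ x, F.T1 x ≤ cker (Z2 x)
  Z2_ne : ∀ x, ¬ F.T2 x ≤ cker (Z2 x)
  d_θ : extD θ = wedge Z1 Z2

/-! ### The coframe bundle `Y` and its canonical connection -/

variable (M) in
/-- The total space of the coframe bundle `Y → M` in the trivialization given by an adapted
coframe `(θ, Z¹, Z²)`: the point `(x, a¹, a², v¹, v², t)` is the coframe
`ω = λθ`, `ω¹ = a¹Z¹ + v¹λθ`, `ω² = a²Z² + v²λθ`,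
`φ = -dλ/λ + a¹v²Z¹ - a²v¹Z² + tθ`, with `λ = a¹a²`,
at the point `λθ` of the bundle `E` of contact forms.
The last five coordinates parametrize the structure group. -/
abbrev YBundle := M × ℂˣ × ℂˣ × ℂ × ℂ × ℂ

/-- The model with corners of `Y`. -/
abbrev IY := (𝓡 3).prod (𝓘(ℝ, ℂ).prod (𝓘(ℝ, ℂ).prod (𝓘(ℝ, ℂ).prod
  (𝓘(ℝ, ℂ).prod 𝓘(ℝ, ℂ)))))

namespace YBundle

/-- The coordinate `a¹` on `Y`. -/
def a1 (y : YBundle M) : ℂ := (y.2.1 : ℂ)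
/-- The coordinate `a²` on `Y`. -/
def a2 (y : YBundle M) : ℂ := (y.2.2.1 : ℂ)
/-- The coordinate `v¹` on `Y`. -/
def v1 (y : YBundle M) : ℂ := y.2.2.2.1
/-- The coordinate `v²` on `Y`. -/
def v2 (y : YBundle M) : ℂ := y.2.2.2.2.1
/-- The coordinate on `Y` that multiplies `θ` in `φ`. -/
def t (y : YBundle M) : ℂ := y.2.2.2.2.2
/-- The function `λ = a¹a²` on `Y`. -/
def lam (y : YBundle M) : ℂ := a1 y * a2 y
/-- The projection `Y → M`. -/
def proj (y : YBundle M) : M := y.1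

end YBundle

/-- The pullback to `Y` of a 1-form on `M`. -/
def liftY (α : Form1 (𝓡 3) M) : Form1 IY (YBundle M) := pull1 YBundle.proj α

namespace AdaptedCoframe

open YBundle

variable {F : FlagStructure M} (c : AdaptedCoframe F)

/-- The tautological form `ω` on `Y`. -/
def ω : Form1 IY (YBundle M) := fun y => lam y • liftY c.θ y

/-- The tautological form `ω¹` on `Y`. -/
def ω1 : Form1 IY (YBundle M) := fun y =>
  a1 y • liftY c.Z1 y + (v1 y * lam y) • liftY c.θ y

/-- The tautological form `ω²` on `Y`. -/
def ω2 : Form1 IY (YBundle M) := fun y =>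
  a2 y • liftY c.Z2 y + (v2 y * lam y) • liftY c.θ y

/-- The tautological form `φ` on `Y`. -/
def φ : Form1 IY (YBundle M) := fun y =>
  -((lam y)⁻¹ • dFun IY lam y) + (a1 y * v2 y) • liftY c.Z1 y - (a2 y * v1 y) • liftY c.Z2 y
    + t y • liftY c.θ y

end AdaptedCoframe

variable (M) in
/-- Candidates for the remaining connection forms `ω₁¹`, `φ¹`, `φ²`, `ψ` on `Y`. -/
structure ConnectionForms where
  ω11 : Form1 IY (YBundle M)
  φ1 : Form1 IY (YBundle M)
  φ2 : Form1 IY (YBundle M)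
  ψ : Form1 IY (YBundle M)

instance : Nonempty (ConnectionForms M) := ⟨⟨0, 0, 0, 0⟩⟩

namespace AdaptedCoframe

variable {F : FlagStructure M} (c : AdaptedCoframe F)

/-- The `𝔰𝔩(3, ℂ)`-valued form assembled from the tautological forms and `ω₁¹, φ¹, φ², ψ`. -/
def connectionMatrix (κ : ConnectionForms M) :
    Matrix (Fin 3) (Fin 3) (Form1 IY (YBundle M)) :=
  !![-((1 / 2 : ℂ) • c.φ) - (1 / 3 : ℂ) • κ.ω11, -κ.φ2, -((1 / 4 : ℂ) • κ.ψ);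
     c.ω1, (2 / 3 : ℂ) • κ.ω11, (1 / 2 : ℂ) • κ.φ1;
     (2 : ℂ) • c.ω, (2 : ℂ) • c.ω2, (1 / 2 : ℂ) • c.φ - (1 / 3 : ℂ) • κ.ω11]

/-- The conditions that single out the canonical connection on `Y`: the forms are smooth, and the
curvature `dπ + π ∧ π` is strictly upper triangular with entries given by
`Φ¹ = Q¹ ω ∧ ω²`, `Φ² = Q² ω ∧ ω¹` and `Ψ = (U₁ω¹ + U₂ω²) ∧ ω`. -/
structure IsCanonical (κ : ConnectionForms M) : Prop where
  smooth_ω11 : SmoothForm κ.ω11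
  smooth_φ1 : SmoothForm κ.φ1
  smooth_φ2 : SmoothForm κ.φ2
  smooth_ψ : SmoothForm κ.ψ
  structure_eq : ∃ Q1 Q2 U1 U2 : YBundle M → ℂ,
    curvature (c.connectionMatrix κ) =
      !![0, -(Q2 • wedge c.ω c.ω1), -((1 / 4 : ℂ) • wedge (U1 • c.ω1 + U2 • c.ω2) c.ω);
         0, 0, (1 / 2 : ℂ) • (Q1 • wedge c.ω c.ω2);
         0, 0, 0]

/-- The canonical forms `ω₁¹, φ¹, φ², ψ` on `Y` (the conditions `IsCanonical` have exactly one
solution). -/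
def canonicalForms : ConnectionForms M := Classical.epsilon c.IsCanonical

/-- The canonical `𝔰𝔩(3, ℂ)`-valued connection form `π` on `Y`. -/
def connection : Matrix (Fin 3) (Fin 3) (Form1 IY (YBundle M)) :=
  c.connectionMatrix c.canonicalForms

end AdaptedCoframe

/-! ### The reduced coframe bundle `X` of a fixed contact form -/

variable (M) in
/-- The total space of the `ℂ*`-bundle `X → M` of the coframes `(θ, aZ¹, a⁻¹Z²)`, where `θ` is a
fixed contact form: the point `(x, a)` is the coframe `(θ, aZ¹, a⁻¹Z²)` at `x`. -/
abbrev XBundle := M × ℂˣ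

/-- The model with corners of `X`. -/
abbrev IX := (𝓡 3).prod 𝓘(ℝ, ℂ)

namespace XBundle

/-- The coordinate `a` on `X`. -/
def a (p : XBundle M) : ℂ := (p.2 : ℂ)
/-- The projection `X → M`. -/
def proj (p : XBundle M) : M := p.1

/-- The embedding of `X` into `Y`: the coframe `(θ, θ¹, θ²)` goes to the coframe of `Y` at the
point `θ` of `E` for which `ω, ω¹, ω²` are the lifts of `θ, θ¹, θ²` and `φ` vanishes along the
section `θ` of `E`. -/
def toY (p : XBundle M) : YBundle M := (p.1, p.2, p.2⁻¹, 0, 0, 0)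

/-- A smooth section of `X → M`. -/
structure IsSection (σ : M → XBundle M) : Prop where
  proj_eq : ∀ x, proj (σ x) = x
  smooth : ContMDiff (𝓡 3) IX ((⊤ : ℕ∞) : WithTop ℕ∞) σ

end XBundle

/-- The pullback to `X` of a 1-form on `M`. -/
def liftX (α : Form1 (𝓡 3) M) : Form1 IX (XBundle M) := pull1 XBundle.proj α

namespace AdaptedCoframe

open XBundle

variable {F : FlagStructure M} (c : AdaptedCoframe F)

/-- The tautological form `θ` on `X`. -/
def Xθ : Form1 IX (XBundle M) := liftX c.θ

/-- The tautological form `θ¹` on `X`. -/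
def Xθ1 : Form1 IX (XBundle M) := fun p => a p • liftX c.Z1 p

/-- The tautological form `θ²` on `X`. -/
def Xθ2 : Form1 IX (XBundle M) := fun p => (a p)⁻¹ • liftX c.Z2 p

end AdaptedCoframe

variable (M) in
/-- Candidates for the forms `θ₁¹`, `τ¹`, `τ²` on `X`. -/
structure PseudoForms where
  θ11 : Form1 IX (XBundle M)
  τ1 : Form1 IX (XBundle M)
  τ2 : Form1 IX (XBundle M)

instance : Nonempty (PseudoForms M) := ⟨⟨0, 0, 0⟩⟩

namespace AdaptedCoframe

variable {F : FlagStructure M} (c : AdaptedCoframe F)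

/-- The conditions that single out the connection form `θ₁¹` and the torsion forms `τ¹, τ²` of the
pseudo-flag structure. -/
structure IsPseudoCanonical (κ : PseudoForms M) : Prop where
  smooth_θ11 : SmoothForm κ.θ11
  smooth_τ1 : SmoothForm κ.τ1
  smooth_τ2 : SmoothForm κ.τ2
  d_θ1 : extD c.Xθ1 = wedge c.Xθ1 κ.θ11 + wedge c.Xθ κ.τ1
  d_θ2 : extD c.Xθ2 = -wedge c.Xθ2 κ.θ11 + wedge c.Xθ κ.τ2
  τ1_θ2 : wedge κ.τ1 c.Xθ2 = 0
  τ2_θ1 : wedge κ.τ2 c.Xθ1 = 0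

/-- The forms `θ₁¹, τ¹, τ²` on `X` (the conditions `IsPseudoCanonical` have exactly one
solution). -/
def pseudoForms : PseudoForms M := Classical.epsilon c.IsPseudoCanonical

end AdaptedCoframe

/-! ### Local data of a section of `X` -/

variable (M) in
/-- Six 1-forms on `M`, for instance the pullbacks of `θ, θ¹, θ², θ₁¹, τ¹, τ²` by a section of `X`. -/
structure BaseForms where
  θ : Form1 (𝓡 3) M
  θ1 : Form1 (𝓡 3) M
  θ2 : Form1 (𝓡 3) M
  θ11 : Form1 (𝓡 3) M
  τ1 : Form1 (𝓡 3) M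
  τ2 : Form1 (𝓡 3) M

/-- The pullbacks of `θ, θ¹, θ², θ₁¹, τ¹, τ²` by a map `σ : M → X`. -/
def AdaptedCoframe.baseForms {F : FlagStructure M} (c : AdaptedCoframe F) (σ : M → XBundle M) :
    BaseForms M where
  θ := pull1 σ c.Xθ
  θ1 := pull1 σ c.Xθ1
  θ2 := pull1 σ c.Xθ2
  θ11 := pull1 σ c.pseudoForms.θ11
  τ1 := pull1 σ c.pseudoForms.τ1
  τ2 := pull1 σ c.pseudoForms.τ2

variable (M) in
/-- Coefficient functions on `M`. Upper indices come before lower ones in the names, except that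
`R0, R1, R2, R02, R12, R22` have lower indices only: `τ1_2` is `τ¹₂`, `W2_1` is `W²₁`. -/
structure LocalData where
  τ1_2 : M → ℂ
  τ2_1 : M → ℂ
  R : M → ℂ
  W1 : M → ℂ
  W2 : M → ℂ
  R0 : M → ℂ
  R1 : M → ℂ
  R2 : M → ℂ
  R02 : M → ℂ
  R12 : M → ℂ
  R22 : M → ℂ
  W2_0 : M → ℂ
  W2_1 : M → ℂ
  W2_2 : M → ℂ
  E1 : M → ℂ
  E2 : M → ℂ
  G : M → ℂ

/-- `D` is the local data of the pseudo-flag structure along a section of `X`: the components of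
the torsion, the curvature `R, W¹, W²` of `θ₁¹`, the covariant derivatives of `R`, `R₂` and `W²`,
and the functions `E¹, E², G` built from them. Since `θ, θ¹, θ²` is a coframe, these equations
determine `D`. -/
structure LocalData.IsDataOf (D : LocalData M) (B : BaseForms M) : Prop where
  τ1_eq : B.τ1 = D.τ1_2 • B.θ2
  τ2_eq : B.τ2 = D.τ2_1 • B.θ1
  d_θ11 : extD B.θ11 =
    D.R • wedge B.θ1 B.θ2 + D.W1 • wedge B.θ1 B.θ + D.W2 • wedge B.θ2 B.θ
  d_R : dFun (𝓡 3) D.R = D.R0 • B.θ + D.R1 • B.θ1 + D.R2 • B.θ2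
  d_R2 : dFun (𝓡 3) D.R2 + D.R2 • B.θ11 + (D.R1 * D.τ1_2) • B.θ + (1 / 2 : ℂ) • D.R0 • B.θ1 =
    D.R02 • B.θ + D.R12 • B.θ1 + D.R22 • B.θ2
  d_W2 : dFun (𝓡 3) D.W2 + D.W2 • B.θ11 = D.W2_0 • B.θ + D.W2_1 • B.θ1 + D.W2_2 • B.θ2
  E1_eq : ∀ x, D.E1 x = 2 / 3 * (D.W2 x - 1 / 4 * D.R2 x)
  E2_eq : ∀ x, D.E2 x = 2 / 3 * (D.W1 x - 1 / 4 * D.R1 x)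
  G_eq : ∀ x, D.τ1_2 x * D.τ2_1 x - 1 / 3 * D.R0 x + 1 / 16 * D.R x ^ 2 + 1 / 2 * D.G x
    - 2 / 3 * D.W2_1 x + 1 / 6 * D.R12 x = 0

end Flag

end FlagGeometry

end

set_option linter.unusedSimpArgs false
set_option linter.unusedSectionVars false

/-! The forms on `X` and the connection on `Y` are given only through `Classical.epsilon`, so a
solution of the defining conditions has to be constructed in both cases. For `Y` the pullback of the
chosen solution must moreover be identified.

The identification is a uniqueness argument on `M`. Since the exterior derivative commutes with
pullbacks (`extD_pull1`), the pulled back connection matrix has tautological entries `θ, θ¹, θ²`,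
has `φ = 0`, and its curvature is still of normal type. Two such matrices coincide: comparing
curvatures entry by entry removes the components of their difference one after another
(`formMatrix_unique`). Hence any explicit normal matrix on `M` is the pullback.

The explicit one is `LocalData.matrix`. The entries (1,0), (2,0), (2,1) of its curvature vanish by
the structure equations of the pseudo-flag structure. The coefficients `R/4`, `E¹`, `E²` make the
diagonal entries vanish. The equation for `G` says that entry (1,2) has no `θ ∧ θ¹` component. The
remaining unwanted components disappear by Bianchi identities (`LocalData.isNormalCurvature`), so no
derivative of `E²`, `G` or the torsion is ever needed.

Existence on `Y` uses the same matrix for the coframe `(θ, Z¹, Z²)` itself: it is lifted to `Y` and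
gauge transformed by an upper triangular matrix function of the fibre coordinates. This conjugates
the curvature (`curvature_gaugeTransform`) and preserves its normal type. Existence on `X` is the
Leibniz rule for the factors `a` and `a⁻¹`.

For the secondary form, `tr(π ∧ Π)` vanishes because every product in it repeats a 1-form. What is
left is the cubic trace, a polynomial in the components of the connection (`trace_cube`). -/

namespace FlagGeometry

open scoped ContDiff

/-! ### Naturality of the exterior derivative, in charts. -/

section Calculus

variable {E : Type*} [NormedAddCommGroup E] [NormedSpace ℝ E] {H : Type*} [TopologicalSpace H]
  {I : ModelWithCorners ℝ E H} {N : Type*} [TopologicalSpace N] [ChartedSpace H N]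
  {E' : Type*} [NormedAddCommGroup E'] [NormedSpace ℝ E'] {H' : Type*}
  [TopologicalSpace H'] {I' : ModelWithCorners ℝ E' H'} {N' : Type*} [TopologicalSpace N']
  [ChartedSpace H' N']

/-- Evaluation of a covector of a 1-form only depends on the base point. -/
theorem form_apply_congr (α : Form1 I N) {z w : N} (h : z = w) (v : E) :
    α z (show TangentSpace I z from v) = α w (show TangentSpace I w from v) := by
  subst h; rfl

variable (I) in
/-- A tangent vector at `x` read in the preferred chart at `x`. -/
noncomputable def chartVec (x : N) (u : TangentSpace I x) : E :=
  mfderiv I 𝓘(ℝ, E) (extChartAt I x) x u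

variable (I) in
/-- The tangent vector with constant coordinates `e` in the preferred chart at `x`, at the point
with coordinates `y`. -/
noncomputable def coordVec (x : N) (y : E) (e : E) : TangentSpace I ((extChartAt I x).symm y) :=
  mfderiv 𝓘(ℝ, E) I (extChartAt I x).symm y (show TangentSpace 𝓘(ℝ, E) y from e)

theorem extD_eq (α : Form1 I N) (x : N) (u v : TangentSpace I x) :
    extD α x u v = fderiv ℝ (localRep α x) (extChartAt I x x) (chartVec I x u) (chartVec I x v) -
      fderiv ℝ (localRep α x) (extChartAt I x x) (chartVec I x v) (chartVec I x u) := rfl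

theorem chartVec_model (x u : E) : chartVec 𝓘(ℝ, E) x u = u := by
  unfold chartVec
  change mfderiv 𝓘(ℝ, E) 𝓘(ℝ, E) id x u = u
  rw [mfderiv_id]
  rfl

theorem localRep_model (β : Form1 𝓘(ℝ, E) E) (x : E) : localRep β x = fun y => β y := by
  funext y
  ext v
  simp only [localRep, extChartAt_model_space_eq_id, PartialEquiv.refl_symm, PartialEquiv.refl_coe,
    mfderiv_eq_fderiv]
  change β y (fderiv ℝ id y v) = β y v
  rw [fderiv_id]; rfl

theorem extD_model (β : E → E →L[ℝ] ℂ) (x u v : E) :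
    extD (I := 𝓘(ℝ, E)) (N := E) β x u v = fderiv ℝ β x u v - fderiv ℝ β x v u := by
  refine (extD_eq (I := 𝓘(ℝ, E)) (N := E) β x u v).trans ?_
  rw [chartVec_model, chartVec_model,
    show localRep (I := 𝓘(ℝ, E)) (N := E) β x = β from localRep_model β x]
  simp only [extChartAt_model_space_eq_id, PartialEquiv.refl_coe, id]

theorem contMDiffAt_chart_symm [I.Boundaryless] {n : WithTop ℕ∞} [IsManifold I n N] (x : N) {y : E}
    (hy : y ∈ (extChartAt I x).target) :
    ContMDiffAt 𝓘(ℝ, E) I n (extChartAt I x).symm y :=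
  (contMDiffOn_extChartAt_symm x).contMDiffAt (extChartAt_target_mem_nhds' hy)

theorem mdifferentiableAt_chart_symm [I.Boundaryless] [IsManifold I ∞ N] (x : N) {y : E}
    (hy : y ∈ (extChartAt I x).target) :
    MDifferentiableAt 𝓘(ℝ, E) I (extChartAt I x).symm y :=
  (contMDiffAt_chart_symm (n := ∞) x hy).mdifferentiableAt (by simp)

theorem eventually_symm_extChartAt {P : N → Prop} {x : N} (h : ∀ᶠ z in 𝓝 x, P z) :
    ∀ᶠ y in 𝓝 (extChartAt I x x), P ((extChartAt I x).symm y) := by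
  have hc : Filter.Tendsto (extChartAt I x).symm (𝓝 (extChartAt I x x)) (𝓝 x) := by
    simpa [extChartAt_to_inv] using (continuousAt_extChartAt_symm (I := I) x).tendsto
  exact hc.eventually h

theorem contDiffAt_written [I.Boundaryless] {n : WithTop ℕ∞} [IsManifold I n N] [IsManifold I' n N']
    {f : N → N'}
    {x : N} (hf : ContMDiffAt I I' n f x) :
    ContDiffAt ℝ n (writtenInExtChartAt I I' x f) (extChartAt I x x) := by
  have := (contMDiffAt_iff.1 hf).2
  rw [I.range_eq_univ, contDiffWithinAt_univ] at this
  exact this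

theorem written_apply_self (f : N → N') (x : N) :
    writtenInExtChartAt I I' x f (extChartAt I x x) = extChartAt I' (f x) (f x) := by
  simp [writtenInExtChartAt]

variable [I.Boundaryless] [IsManifold I ∞ N]
variable [I'.Boundaryless] [IsManifold I' ∞ N']

/-- Near the image of `x`, the map `f` composed with the inverse chart equals the inverse chart of
the target composed with the coordinate expression of `f`; the chain rule on both sides gives the
formula. Regularity of finite order at a point persists on a neighbourhood, so `C¹` at `x` suffices.
-/
theorem localRep_pull1 {f : N → N'} {x : N} (hf : ContMDiffAt I I' 1 f x) (α : Form1 I' N') :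
    localRep (pull1 (I := I) f α) x =ᶠ[𝓝 (extChartAt I x x)] fun y =>
      (localRep α (f x) (writtenInExtChartAt I I' x f y)).comp
        (fderiv ℝ (writtenInExtChartAt I I' x f) y) := by
  have : IsManifold I 1 N := IsManifold.of_le (n := ∞) (by simp)
  have : IsManifold I' 1 N' := IsManifold.of_le (n := ∞) (by simp)
  have h1 : ∀ᶠ z in 𝓝 x, ContMDiffAt I I' 1 f z := (contMDiffAt_iff_contMDiffAt_nhds (by simp)).1 hf
  have h2 : ∀ᶠ z in 𝓝 x, f z ∈ (extChartAt I' (f x)).source :=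
    hf.continuousAt.eventually (extChartAt_source_mem_nhds (I := I') (f x))
  filter_upwards [eventually_symm_extChartAt (I := I) h1, eventually_symm_extChartAt (I := I) h2,
    extChartAt_target_mem_nhds (I := I) x] with y hy1 hy2 hy
  have hs := mdifferentiableAt_chart_symm (I := I) x hy
  have hf1 : MDifferentiableAt I I' f ((extChartAt I x).symm y) :=
    hy1.mdifferentiableAt (by simp)
  have hg : MDifferentiableAt 𝓘(ℝ, E) 𝓘(ℝ, E') (writtenInExtChartAt I I' x f) y :=
    ((mdifferentiableAt_extChartAt (I := I') (by simpa using hy2)).comp y (hf1.comp y hs))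
  have hgt : writtenInExtChartAt I I' x f y ∈ (extChartAt I' (f x)).target :=
    (extChartAt I' (f x)).map_source hy2
  have hback : (extChartAt I' (f x)).symm (writtenInExtChartAt I I' x f y)
      = f ((extChartAt I x).symm y) := (extChartAt I' (f x)).left_inv hy2
  have hs' := mdifferentiableAt_chart_symm (I := I') (f x) hgt
  have key : mfderiv 𝓘(ℝ, E) I' (f ∘ (extChartAt I x).symm) y =
      mfderiv 𝓘(ℝ, E) I' ((extChartAt I' (f x)).symm ∘ writtenInExtChartAt I I' x f) y := by
    apply Filter.EventuallyEq.mfderiv_eq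
    have hcs : ContinuousAt (f ∘ (extChartAt I x).symm) y := (hf1.comp y hs).continuousAt
    filter_upwards [hcs.eventually ((isOpen_extChartAt_source (I := I') (f x)).mem_nhds hy2)]
      with z hz
    exact ((extChartAt I' (f x)).left_inv hz).symm
  have e1 := mfderiv_comp y hf1 hs
  have e2 := mfderiv_comp y hs' hg
  ext v
  have e3 : mfderiv I I' f ((extChartAt I x).symm y) (mfderiv 𝓘(ℝ, E) I (extChartAt I x).symm y v)
      = mfderiv 𝓘(ℝ, E') I' (extChartAt I' (f x)).symm (writtenInExtChartAt I I' x f y)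
        (mfderiv 𝓘(ℝ, E) 𝓘(ℝ, E') (writtenInExtChartAt I I' x f) y v) := by
    have := DFunLike.congr_fun (e1.symm.trans (key.trans e2)) v
    exact this
  change α (f ((extChartAt I x).symm y)) (mfderiv I I' f ((extChartAt I x).symm y)
    (mfderiv 𝓘(ℝ, E) I (extChartAt I x).symm y v)) = _
  -- The two chain rules produce covectors at base points that are equal only by `hback`, so the
  -- evaluation is transported along this equality.
  refine Eq.trans ?_ (form_apply_congr α hback
    (mfderiv 𝓘(ℝ, E') I' (extChartAt I' (f x)).symm (writtenInExtChartAt I I' x f y)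
      (mfderiv 𝓘(ℝ, E) 𝓘(ℝ, E') (writtenInExtChartAt I I' x f) y v))).symm |>.trans ?_
  · exact congrArg (α (f ((extChartAt I x).symm y))) e3
  · rw [mfderiv_eq_fderiv]; rfl

/-- Pullbacks of smooth forms are smooth. -/
theorem SmoothFormAt.pull1 {f : N → N'} {x : N} (hf : ContMDiffAt I I' ∞ f x) {α : Form1 I' N'}
    (hα : SmoothFormAt α (f x)) : SmoothFormAt (pull1 (I := I) f α) x := by
  unfold SmoothFormAt
  have hf1 : ContMDiffAt I I' 1 f x := hf.of_le (by simp)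
  refine ContDiffAt.congr_of_eventuallyEq ?_ (localRep_pull1 hf1 α)
  have hg : ContDiffAt ℝ ∞ (writtenInExtChartAt I I' x f) (extChartAt I x x) :=
    contDiffAt_written hf
  have hα' : ContDiffAt ℝ ∞ (localRep α (f x))
      (writtenInExtChartAt I I' x f (extChartAt I x x)) := by
    rw [written_apply_self]; exact hα
  exact (hα'.comp _ hg).clm_comp (hg.fderiv_right (m := ∞) (by simp))

theorem chartVec_mfderiv {f : N → N'} {x : N} (hf : MDifferentiableAt I I' f x)
    (u : TangentSpace I x) :
    chartVec I' (f x) (mfderiv I I' f x u) =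
      fderiv ℝ (writtenInExtChartAt I I' x f) (extChartAt I x x) (chartVec I x u) := by
  have hs := mdifferentiableAt_chart_symm (I := I) x (mem_extChartAt_target x)
  have hx : MDifferentiableAt I 𝓘(ℝ, E) (extChartAt I x) x :=
    mdifferentiableAt_extChartAt (mem_chart_source H x)
  have hy : MDifferentiableAt I' 𝓘(ℝ, E') (extChartAt I' (f x)) (f x) :=
    mdifferentiableAt_extChartAt (mem_chart_source H' (f x))
  have hback := extChartAt_to_inv (I := I) x
  have hfs : MDifferentiableAt 𝓘(ℝ, E) I' (f ∘ (extChartAt I x).symm) (extChartAt I x x) :=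
    MDifferentiableAt.comp _ (by rwa [hback]) hs
  have hg : MDifferentiableAt 𝓘(ℝ, E) 𝓘(ℝ, E') (writtenInExtChartAt I I' x f)
      (extChartAt I x x) :=
    MDifferentiableAt.comp _ (by simpa [hback] using hy) hfs
  have e1 := mfderiv_comp x hy hf
  have e2 := mfderiv_comp x hg hx
  have key : mfderiv I 𝓘(ℝ, E') (extChartAt I' (f x) ∘ f) x =
      mfderiv I 𝓘(ℝ, E') (writtenInExtChartAt I I' x f ∘ extChartAt I x) x := by
    apply Filter.EventuallyEq.mfderiv_eq
    filter_upwards [extChartAt_source_mem_nhds (I := I) x] with z hz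
    simp only [writtenInExtChartAt, Function.comp_apply, (extChartAt I x).left_inv hz]
  have := DFunLike.congr_fun (e1.symm.trans (key.trans e2)) u
  rw [mfderiv_eq_fderiv] at this
  exact this

/-- The exterior derivative commutes with pullbacks. -/
theorem extD_pull1 {f : N → N'} {x : N} (hf : ContMDiffAt I I' ∞ f x) {α : Form1 I' N'}
    (hα : SmoothFormAt α (f x)) (u v : TangentSpace I x) :
    extD (pull1 (I := I) f α) x u v = extD α (f x) (mfderiv I I' f x u) (mfderiv I I' f x v) := by
  have hf1 : ContMDiffAt I I' 1 f x := hf.of_le (by simp)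
  have hg : ContDiffAt ℝ ∞ (writtenInExtChartAt I I' x f) (extChartAt I x x) :=
    contDiffAt_written hf
  have hα' : DifferentiableAt ℝ (localRep α (f x))
      (writtenInExtChartAt I I' x f (extChartAt I x x)) := by
    rw [written_apply_self]; exact ContDiffAt.differentiableAt hα (by simp)
  have hd : DifferentiableAt ℝ (writtenInExtChartAt I I' x f) (extChartAt I x x) :=
    hg.differentiableAt (by simp)
  have hdd : DifferentiableAt ℝ (fderiv ℝ (writtenInExtChartAt I I' x f)) (extChartAt I x x) :=
    (hg.fderiv_right (m := 1) (by norm_cast)).differentiableAt (by simp)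
  have hsymm := hg.isSymmSndFDerivAt (by simp; norm_cast)
  rw [extD_eq, extD_eq]
  rw [chartVec_mfderiv (hf1.mdifferentiableAt (by simp)),
    chartVec_mfderiv (hf1.mdifferentiableAt (by simp)), (localRep_pull1 hf1 α).fderiv_eq]
  have hc : HasFDerivAt (fun y => (localRep α (f x) (writtenInExtChartAt I I' x f y)).comp
        (fderiv ℝ (writtenInExtChartAt I I' x f) y)) _ (extChartAt I x x) :=
    (hα'.hasFDerivAt.comp _ hd.hasFDerivAt).clm_comp hdd.hasFDerivAt
  rw [hc.fderiv]
  simp only [add_apply, ContinuousLinearMap.comp_apply,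
    ContinuousLinearMap.compL_apply, ContinuousLinearMap.flip_apply, written_apply_self]
  -- The second derivative of the coordinate expression of `f` is symmetric, so its contribution
  -- cancels after antisymmetrization.
  rw [hsymm (chartVec I x u) (chartVec I x v)]
  ring

end Calculus

/-! ### Rules for the exterior derivative, and smoothness of forms and coefficients. -/

section Calculus

variable {E : Type*} [NormedAddCommGroup E] [NormedSpace ℝ E] {H : Type*} [TopologicalSpace H]
  {I : ModelWithCorners ℝ E H} {N : Type*} [TopologicalSpace N] [ChartedSpace H N]

/-! ### Algebra of smooth 1-forms -/

theorem localRep_add (α β : Form1 I N) (x : N) :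
    localRep (α + β) x = fun y => localRep α x y + localRep β x y := rfl

theorem localRep_sub (α β : Form1 I N) (x : N) :
    localRep (α - β) x = fun y => localRep α x y - localRep β x y := rfl

theorem localRep_neg (α : Form1 I N) (x : N) :
    localRep (-α) x = fun y => -localRep α x y := rfl

theorem localRep_const_smul (k : ℂ) (α : Form1 I N) (x : N) :
    localRep (k • α) x = fun y => k • localRep α x y := rfl

theorem localRep_smul (f : N → ℂ) (α : Form1 I N) (x : N) :
    localRep (f • α) x = fun y => f ((extChartAt I x).symm y) • localRep α x y := rfl

theorem SmoothForm.add {α β : Form1 I N} (hα : SmoothForm α) (hβ : SmoothForm β) :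
    SmoothForm (α + β) := fun x => ContDiffAt.add (hα x) (hβ x)

theorem SmoothForm.sub {α β : Form1 I N} (hα : SmoothForm α) (hβ : SmoothForm β) :
    SmoothForm (α - β) := fun x => ContDiffAt.sub (hα x) (hβ x)

theorem SmoothForm.neg {α : Form1 I N} (hα : SmoothForm α) : SmoothForm (-α) :=
  fun x => ContDiffAt.neg (hα x)

theorem SmoothForm.const_smul (k : ℂ) {α : Form1 I N} (hα : SmoothForm α) :
    SmoothForm (k • α) := fun x => ContDiffAt.const_smul k (hα x)

theorem SmoothForm.zero : SmoothForm (0 : Form1 I N) := by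
  intro x
  have : localRep (0 : Form1 I N) x = fun _ => 0 := by
    funext y; ext v; rfl
  unfold SmoothFormAt
  rw [this]
  exact contDiffAt_const

theorem SmoothForm.differentiableAt {α : Form1 I N} (hα : SmoothForm α) (x : N) :
    DifferentiableAt ℝ (localRep α x) (extChartAt I x x) :=
  ContDiffAt.differentiableAt (hα x) (by simp)

theorem extD_add {α β : Form1 I N} (hα : SmoothForm α) (hβ : SmoothForm β) :
    extD (α + β) = extD α + extD β := by
  funext x u v
  simp only [Pi.add_apply, extD_eq, localRep_add]
  rw [fderiv_fun_add (hα.differentiableAt x) (hβ.differentiableAt x)]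
  simp only [add_apply]
  ring

theorem extD_neg (α : Form1 I N) : extD (-α) = -extD α := by
  funext x u v
  simp only [Pi.neg_apply, extD_eq, localRep_neg]
  rw [fderiv_fun_neg]
  simp only [neg_apply]
  ring

theorem extD_sub {α β : Form1 I N} (hα : SmoothForm α) (hβ : SmoothForm β) :
    extD (α - β) = extD α - extD β := by
  rw [sub_eq_add_neg, extD_add hα hβ.neg, extD_neg, sub_eq_add_neg]

theorem extD_const_smul (k : ℂ) {α : Form1 I N} (hα : SmoothForm α) :
    extD (k • α) = k • extD α := by
  funext x u v
  simp only [Pi.smul_apply, extD_eq, localRep_const_smul]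
  rw [fderiv_fun_const_smul (hα.differentiableAt x)]
  simp only [smul_apply, smul_eq_mul]
  ring

theorem extD_zero : extD (0 : Form1 I N) = 0 := by
  have h := extD_sub (I := I) (N := N) SmoothForm.zero SmoothForm.zero
  rwa [sub_self, sub_self] at h

theorem SmoothForm.sum {ι : Type*} (s : Finset ι) {α : ι → Form1 I N}
    (hα : ∀ i, SmoothForm (α i)) : SmoothForm (∑ i ∈ s, α i) := by
  classical
  induction s using Finset.induction_on with
  | empty => simpa using SmoothForm.zero
  | insert i s hi ih => rw [Finset.sum_insert hi]; exact (hα i).add ih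

theorem extD_sum {ι : Type*} (s : Finset ι) {α : ι → Form1 I N} (hα : ∀ i, SmoothForm (α i)) :
    extD (∑ i ∈ s, α i) = ∑ i ∈ s, extD (α i) := by
  classical
  induction s using Finset.induction_on with
  | empty => simpa using extD_zero
  | insert i s hi ih =>
    rw [Finset.sum_insert hi, Finset.sum_insert hi, extD_add (hα i) (SmoothForm.sum s hα), ih]

variable [I.Boundaryless] [IsManifold I ∞ N]

theorem contDiffAt_comp_symm {f : N → ℂ} (hf : ContMDiff I 𝓘(ℝ, ℂ) ∞ f) (x : N) :
    ContDiffAt ℝ ∞ (fun y => f ((extChartAt I x).symm y)) (extChartAt I x x) :=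
  contDiffAt_written (hf x)

theorem contMDiff_of_contDiffAt {f : N → ℂ}
    (h : ∀ x, ContDiffAt ℝ ∞ (fun y => f ((extChartAt I x).symm y)) (extChartAt I x x)) :
    ContMDiff I 𝓘(ℝ, ℂ) ∞ f := by
  intro x
  have h2 : ContMDiffAt I 𝓘(ℝ, ℂ) ∞ ((fun y => f ((extChartAt I x).symm y)) ∘ extChartAt I x) x :=
    ContMDiffAt.comp x (h x).contMDiffAt contMDiffAt_extChartAt
  refine h2.congr_of_eventuallyEq ?_
  filter_upwards [extChartAt_source_mem_nhds (I := I) x] with z hz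
  simp only [Function.comp_apply, (extChartAt I x).left_inv hz]

theorem SmoothForm.smul {f : N → ℂ} (hf : ContMDiff I 𝓘(ℝ, ℂ) ∞ f) {α : Form1 I N}
    (hα : SmoothForm α) : SmoothForm (f • α) := by
  intro x
  have h1 := contDiffAt_comp_symm hf x
  have h2 : ContDiffAt ℝ ∞ (localRep α x) (extChartAt I x x) := hα x
  unfold SmoothFormAt
  rw [localRep_smul]
  exact h1.smul h2

theorem dFun_apply_eq_fderiv {f : N → ℂ} (hf : ContMDiff I 𝓘(ℝ, ℂ) ∞ f) (x : N)
    (u : TangentSpace I x) :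
    dFun I f x u =
      fderiv ℝ (fun y => f ((extChartAt I x).symm y)) (extChartAt I x x) (chartVec I x u) := by
  have h := chartVec_mfderiv (I := I) (I' := 𝓘(ℝ, ℂ)) (hf.mdifferentiable (by simp) x) u
  have h2 := chartVec_model (E := ℂ) (f x) (mfderiv I 𝓘(ℝ, ℂ) f x u)
  exact h2.symm.trans h

theorem localRep_self (α : Form1 I N) (x : N) (u : TangentSpace I x) :
    localRep α x (extChartAt I x x) (chartVec I x u) = α x u := by
  have hs := mdifferentiableAt_chart_symm (I := I) x (mem_extChartAt_target x)
  have hx : MDifferentiableAt I 𝓘(ℝ, E) (extChartAt I x) x :=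
    mdifferentiableAt_extChartAt (mem_chart_source H x)
  have e1 := mfderiv_comp x hs hx
  have key : mfderiv I I ((extChartAt I x).symm ∘ extChartAt I x) x = mfderiv I I id x := by
    apply Filter.EventuallyEq.mfderiv_eq
    filter_upwards [extChartAt_source_mem_nhds (I := I) x] with z hz
    simp only [Function.comp_apply, (extChartAt I x).left_inv hz, id]
  rw [mfderiv_id] at key
  have e2 := DFunLike.congr_fun (e1.symm.trans key) u
  refine (form_apply_congr α (extChartAt_to_inv (I := I) x) _).trans ?_
  exact congrArg (α x) e2

/-- The Leibniz rule for a function and a 1-form. -/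
theorem extD_smul {f : N → ℂ} (hf : ContMDiff I 𝓘(ℝ, ℂ) ∞ f) {α : Form1 I N}
    (hα : SmoothForm α) : extD (f • α) = wedge (dFun I f) α + f • extD α := by
  funext x u v
  simp only [Pi.add_apply, Pi.smul_apply', Pi.smul_apply, wedge, extD_eq, localRep_smul,
    dFun_apply_eq_fderiv hf]
  rw [fderiv_fun_smul ((contDiffAt_comp_symm hf x).differentiableAt (by simp))
    (hα.differentiableAt x)]
  simp only [add_apply, smul_apply, smul_eq_mul, ContinuousLinearMap.smulRight_apply,
    localRep_self, extChartAt_to_inv]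
  ring

/-- The exterior derivative computed in a fixed chart. -/
theorem extD_coordVec {α : Form1 I N} (hα : SmoothForm α) (x : N) {y : E}
    (hy : y ∈ (extChartAt I x).target) (u v : E) :
    extD α ((extChartAt I x).symm y) (coordVec I x y u) (coordVec I x y v) =
      fderiv ℝ (localRep α x) y u v - fderiv ℝ (localRep α x) y v u := by
  -- The local representative is the pullback by the inverse chart, so naturality applies. This
  -- frees `extD` from its definition, in which the chart moves with the point.
  have h := extD_pull1 (I := 𝓘(ℝ, E)) (I' := I) (contMDiffAt_chart_symm (n := ∞) x hy)
    (hα _) u v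
  refine h.symm.trans ?_
  exact extD_model (localRep α x) y u v

theorem SmoothForm.pull1 {E' : Type*} [NormedAddCommGroup E'] [NormedSpace ℝ E'] {H' : Type*}
    [TopologicalSpace H'] {I' : ModelWithCorners ℝ E' H'} {N' : Type*} [TopologicalSpace N']
    [ChartedSpace H' N'] [I'.Boundaryless] [IsManifold I' ∞ N'] {f : N → N'}
    (hf : ContMDiff I I' ∞ f) {α : Form1 I' N'} (hα : SmoothForm α) :
    SmoothForm (pull1 (I := I) f α) := fun x => (hα (f x)).pull1 (hf x)

/-- The identity as a 1-form on `ℂ`. -/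
noncomputable def idForm : Form1 𝓘(ℝ, ℂ) ℂ := fun _ => ContinuousLinearMap.id ℝ ℂ

theorem smoothForm_idForm : SmoothForm idForm := by
  intro x
  unfold SmoothFormAt
  rw [localRep_model]
  exact contDiffAt_const

theorem dFun_eq_pull1 (f : N → ℂ) : dFun I f = pull1 f idForm := rfl

theorem SmoothForm.dFun {f : N → ℂ} (hf : ContMDiff I 𝓘(ℝ, ℂ) ∞ f) : SmoothForm (dFun I f) := by
  rw [dFun_eq_pull1]
  exact smoothForm_idForm.pull1 hf

theorem extD_dFun {f : N → ℂ} (hf : ContMDiff I 𝓘(ℝ, ℂ) ∞ f) : extD (dFun I f) = 0 := by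
  funext x u v
  rw [dFun_eq_pull1, extD_pull1 (hf x) (smoothForm_idForm _)]
  refine (extD_model (E := ℂ) (fun _ => ContinuousLinearMap.id ℝ ℂ) _ _ _).trans ?_
  rw [fderiv_fun_const]
  exact sub_self (0 : ℂ)

/-! ### `d² = 0` for products of 1-forms -/

/-- This is `d² = 0` in a vector space. The hypothesis is differentiated in one direction, with the
other two vectors fixed; in the cyclic sum the second derivatives of `A` cancel in pairs by
symmetry. -/
theorem cyclic_sum_fderiv_mul {ι : Type*} [Fintype ι] {A : E → E →L[ℝ] ℂ} {B C : ι → E → E →L[ℝ] ℂ}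
    {y : E} (hA : ContDiffAt ℝ ∞ A y) (hB : ∀ i, DifferentiableAt ℝ (B i) y)
    (hC : ∀ i, DifferentiableAt ℝ (C i) y)
    (h : ∀ᶠ z in 𝓝 y, ∀ u v, fderiv ℝ A z u v - fderiv ℝ A z v u =
      ∑ i, (B i z u * C i z v - B i z v * C i z u)) (u v w : E) :
    ∑ i, ((fderiv ℝ (B i) y w u * C i y v + B i y u * fderiv ℝ (C i) y w v -
        fderiv ℝ (B i) y w v * C i y u - B i y v * fderiv ℝ (C i) y w u) +
      (fderiv ℝ (B i) y u v * C i y w + B i y v * fderiv ℝ (C i) y u w -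
        fderiv ℝ (B i) y u w * C i y v - B i y w * fderiv ℝ (C i) y u v) +
      (fderiv ℝ (B i) y v w * C i y u + B i y w * fderiv ℝ (C i) y v u -
        fderiv ℝ (B i) y v u * C i y w - B i y u * fderiv ℝ (C i) y v w)) = 0 := by
  have hDA : DifferentiableAt ℝ (fderiv ℝ A) y :=
    (hA.fderiv_right (m := 1) (by norm_cast)).differentiableAt (by simp)
  have hsymm := hA.isSymmSndFDerivAt (by simp; norm_cast)
  have key : ∀ a b c : E, fderiv ℝ (fderiv ℝ A) y a b c - fderiv ℝ (fderiv ℝ A) y a c b =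
      ∑ i, (fderiv ℝ (B i) y a b * C i y c + B i y b * fderiv ℝ (C i) y a c -
        fderiv ℝ (B i) y a c * C i y b - B i y c * fderiv ℝ (C i) y a b) := by
    intro a b c
    have e1 : HasFDerivAt (fun z => fderiv ℝ A z b c - fderiv ℝ A z c b) _ y :=
      ((hDA.hasFDerivAt.clm_apply (hasFDerivAt_const b y)).clm_apply (hasFDerivAt_const c y)).sub
      ((hDA.hasFDerivAt.clm_apply (hasFDerivAt_const c y)).clm_apply (hasFDerivAt_const b y))
    have e2 : HasFDerivAt (fun z => ∑ i, (B i z b * C i z c - B i z c * C i z b)) _ y :=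
      HasFDerivAt.fun_sum fun i _ =>
      ((((hB i).hasFDerivAt.clm_apply (hasFDerivAt_const b y))).mul
        ((hC i).hasFDerivAt.clm_apply (hasFDerivAt_const c y))).sub
      ((((hB i).hasFDerivAt.clm_apply (hasFDerivAt_const c y))).mul
        ((hC i).hasFDerivAt.clm_apply (hasFDerivAt_const b y)))
    have e3 := e1.unique (e2.congr_of_eventuallyEq (h.mono fun z hz => hz b c))
    have e4 := DFunLike.congr_fun e3 a
    simp only [sub_apply, add_apply, ContinuousLinearMap.comp_apply,
      ContinuousLinearMap.flip_apply, zero_apply, map_zero, zero_add, sum_apply, smul_apply,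
      smul_eq_mul] at e4
    rw [e4]
    refine Finset.sum_congr rfl fun i _ => ?_
    ring
  rw [Finset.sum_add_distrib, Finset.sum_add_distrib, ← key, ← key, ← key, hsymm w u, hsymm v w,
    hsymm u v]
  ring

/-- If `dα = ∑ βᵢ ∧ γᵢ`, then `∑ (dβᵢ ∧ γᵢ - βᵢ ∧ dγᵢ) = 0`. -/
theorem sum_extD_wedge {ι : Type*} [Fintype ι] {α : Form1 I N} {β γ : ι → Form1 I N}
    (hα : SmoothForm α) (hβ : ∀ i, SmoothForm (β i)) (hγ : ∀ i, SmoothForm (γ i))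
    (h : extD α = ∑ i, wedge (β i) (γ i)) :
    ∑ i, (wedge12 (γ i) (extD (β i)) - wedge12 (β i) (extD (γ i))) = 0 := by
  funext x u v w
  have key := cyclic_sum_fderiv_mul (A := localRep α x) (B := fun i => localRep (β i) x)
    (C := fun i => localRep (γ i) x) (hα x) (fun i => (hβ i).differentiableAt x)
    (fun i => (hγ i).differentiableAt x) (by
      filter_upwards [extChartAt_target_mem_nhds (I := I) x] with y hy a b
      rw [← extD_coordVec hα x hy, h]
      simp only [Finset.sum_apply]
      rfl) (chartVec I x u) (chartVec I x v) (chartVec I x w)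
  simp only [localRep_self] at key
  simp only [Finset.sum_apply, Pi.zero_apply, Pi.sub_apply, wedge12, extD_eq]
  rw [← key]
  refine Finset.sum_congr rfl fun i _ => ?_
  ring

/-! ### Smooth 2-forms and 3-forms -/

/-- The 2-form `β` is smooth. -/
def SmoothForm2 (β : Form2 I N) : Prop := ∀ (x : N) (e₁ e₂ : E), ContDiffAt ℝ ∞
  (fun y => β ((extChartAt I x).symm y) (coordVec I x y e₁) (coordVec I x y e₂)) (extChartAt I x x)

/-- The 3-form `β` is smooth. -/
def SmoothForm3 (β : Form3 I N) : Prop := ∀ (x : N) (e₁ e₂ e₃ : E), ContDiffAt ℝ ∞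
  (fun y => β ((extChartAt I x).symm y) (coordVec I x y e₁) (coordVec I x y e₂)
    (coordVec I x y e₃)) (extChartAt I x x)

theorem SmoothForm.contDiffAt_apply {α : Form1 I N} (hα : SmoothForm α) (x : N) (e : E) :
    ContDiffAt ℝ ∞ (fun y => α ((extChartAt I x).symm y) (coordVec I x y e)) (extChartAt I x x) :=
  ContDiffAt.clm_apply (f := localRep α x) (hα x) contDiffAt_const

theorem SmoothForm.wedge {α β : Form1 I N} (hα : SmoothForm α) (hβ : SmoothForm β) :
    SmoothForm2 (wedge α β) := fun x e₁ e₂ =>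
  ((hα.contDiffAt_apply x e₁).mul (hβ.contDiffAt_apply x e₂)).sub
    ((hα.contDiffAt_apply x e₂).mul (hβ.contDiffAt_apply x e₁))

theorem SmoothForm.wedge12 {α : Form1 I N} {β : Form2 I N} (hα : SmoothForm α)
    (hβ : SmoothForm2 β) : SmoothForm3 (wedge12 α β) := fun x e₁ e₂ e₃ =>
  (((hα.contDiffAt_apply x e₁).mul (hβ x e₂ e₃)).sub
    ((hα.contDiffAt_apply x e₂).mul (hβ x e₁ e₃))).add
    ((hα.contDiffAt_apply x e₃).mul (hβ x e₁ e₂))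

theorem SmoothForm.extD {α : Form1 I N} (hα : SmoothForm α) : SmoothForm2 (extD α) := by
  intro x e₁ e₂
  have h1 : ContDiffAt ℝ ∞ (fderiv ℝ (localRep α x)) (extChartAt I x x) :=
    ContDiffAt.fderiv_right (n := ∞) (hα x) (by simp)
  have h2 : ∀ a b : E, ContDiffAt ℝ ∞ (fun y => fderiv ℝ (localRep α x) y a b)
      (extChartAt I x x) := fun a b =>
    (h1.clm_apply contDiffAt_const).clm_apply contDiffAt_const
  refine ((h2 e₁ e₂).sub (h2 e₂ e₁)).congr_of_eventuallyEq ?_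
  filter_upwards [extChartAt_target_mem_nhds (I := I) x] with y hy
  exact extD_coordVec hα x hy e₁ e₂

theorem coordVec_chartVec (x : N) (u : TangentSpace I x) :
    (coordVec I x (extChartAt I x x) (chartVec I x u) : E) = u := by
  have hs := mdifferentiableAt_chart_symm (I := I) x (mem_extChartAt_target x)
  have hx : MDifferentiableAt I 𝓘(ℝ, E) (extChartAt I x) x :=
    mdifferentiableAt_extChartAt (mem_chart_source H x)
  have e1 := mfderiv_comp x hs hx
  have key : mfderiv I I ((extChartAt I x).symm ∘ extChartAt I x) x = mfderiv I I id x := by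
    apply Filter.EventuallyEq.mfderiv_eq
    filter_upwards [extChartAt_source_mem_nhds (I := I) x] with z hz
    simp only [Function.comp_apply, (extChartAt I x).left_inv hz, id]
  rw [mfderiv_id] at key
  exact DFunLike.congr_fun (e1.symm.trans key) u

theorem form3_apply_congr (β : Form3 I N) {z w : N} (h : z = w) (a b c : E) :
    β z (show TangentSpace I z from a) (show TangentSpace I z from b)
      (show TangentSpace I z from c) =
    β w (show TangentSpace I w from a) (show TangentSpace I w from b)
      (show TangentSpace I w from c) := by
  subst h; rfl

theorem form3_apply_coordVec (β : Form3 I N) (x : N) (u v w : TangentSpace I x) :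
    β ((extChartAt I x).symm (extChartAt I x x)) (coordVec I x (extChartAt I x x) (chartVec I x u))
      (coordVec I x (extChartAt I x x) (chartVec I x v))
      (coordVec I x (extChartAt I x x) (chartVec I x w)) = β x u v w := by
  refine (form3_apply_congr β (extChartAt_to_inv (I := I) x) _ _ _).trans ?_
  have h1 := coordVec_chartVec x u
  have h2 := coordVec_chartVec x v
  have h3 := coordVec_chartVec x w
  exact congr (congr (congrArg (β x) h1) h2) h3

/-- A quotient of smooth 3-forms is smooth where the denominator does not vanish. -/
theorem contMDiff_of_smul_eq {f : N → ℂ} {β γ : Form3 I N} (hβ : SmoothForm3 β)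
    (hγ : SmoothForm3 γ) (h : γ = f • β) (h0 : ∀ x, ∃ u v w, β x u v w ≠ 0) :
    ContMDiff I 𝓘(ℝ, ℂ) ∞ f := by
  refine contMDiff_of_contDiffAt fun x => ?_
  obtain ⟨u, v, w, hx⟩ := h0 x
  rw [← form3_apply_coordVec β] at hx
  have hb := hβ x (chartVec I x u) (chartVec I x v) (chartVec I x w)
  have hc := hγ x (chartVec I x u) (chartVec I x v) (chartVec I x w)
  -- The three vectors with `β ≠ 0` at `x` are extended with constant coordinates. Near `x` the
  -- denominator stays nonzero and `f` is a quotient of two smooth coordinate functions.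
  obtain ⟨B, hB⟩ : ∃ B : E → ℂ, B = fun y => β ((extChartAt I x).symm y)
    (coordVec I x y (chartVec I x u)) (coordVec I x y (chartVec I x v))
    (coordVec I x y (chartVec I x w)) := ⟨_, rfl⟩
  have hB0 : B (extChartAt I x x) ≠ 0 := by rw [hB]; exact hx
  rw [← hB] at hb
  refine (hc.mul (hb.inv hB0)).congr_of_eventuallyEq ?_
  filter_upwards [hb.continuousAt.eventually_ne hB0] with y hy
  rw [h, Pi.inv_apply, ← div_eq_mul_inv, eq_div_iff hy, hB]
  rfl

end Calculus

/-! ### Components of forms in a coframe. -/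

section Coframe

variable {M : Type*} [TopologicalSpace M] [ChartedSpace (EuclideanSpace ℝ (Fin 3)) M]

/-- The standard basis of the model space, as tangent vectors at `x`. -/
noncomputable def stdVec (x : M) (i : Fin 3) : TangentSpace (𝓡 3) x :=
  (EuclideanSpace.basisFun (Fin 3) ℝ i : EuclideanSpace ℝ (Fin 3))

/-- The 1-forms `α`, `β`, `γ` are linearly independent at every point. -/
def IsCoframe (α β γ : Form1 (𝓡 3) M) : Prop :=
  ∀ x, wedge12 α (wedge β γ) x (stdVec x 0) (stdVec x 1) (stdVec x 2) ≠ 0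

/-- A real linear map on a tangent space is determined by its values on the standard basis. -/
theorem tangent_ext {x : M} {W : Type*} [AddCommGroup W] [Module ℝ W]
    {f g : TangentSpace (𝓡 3) x →ₗ[ℝ] W} (h : ∀ i, f (stdVec x i) = g (stdVec x i)) : f = g :=
  (EuclideanSpace.basisFun (Fin 3) ℝ).toBasis.ext (R₁ := ℝ) (M₁ := W)
    (M := EuclideanSpace ℝ (Fin 3))
    (f₁ := f) (f₂ := g) (fun i => by
      rw [OrthonormalBasis.coe_toBasis]; exact h i)

/-- The 2-form `β` is given by alternating bilinear forms. -/
def IsAlternating (β : Form2 (𝓡 3) M) : Prop :=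
  ∀ x, ∃ B : TangentSpace (𝓡 3) x →ₗ[ℝ] TangentSpace (𝓡 3) x →ₗ[ℝ] ℂ,
    ∀ u v, β x u v = B u v - B v u

theorem isAlternating_extD (α : Form1 (𝓡 3) M) : IsAlternating (extD α) := by
  intro x
  let D : EuclideanSpace ℝ (Fin 3) →L[ℝ] EuclideanSpace ℝ (Fin 3) →L[ℝ] ℂ :=
    fderiv ℝ (localRep α x) (extChartAt (𝓡 3) x x)
  let T : TangentSpace (𝓡 3) x →L[ℝ] EuclideanSpace ℝ (Fin 3) :=
    mfderiv (𝓡 3) 𝓘(ℝ, EuclideanSpace ℝ (Fin 3)) (extChartAt (𝓡 3) x) x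
  refine ⟨LinearMap.mk₂ ℝ (fun u v => D (T u) (T v)) ?_ ?_ ?_ ?_, fun u v => rfl⟩ <;> intros <;>
    simp

theorem isAlternating_wedge (α β : Form1 (𝓡 3) M) : IsAlternating (wedge α β) := by
  intro x
  refine ⟨LinearMap.mk₂ ℝ (fun u v => α x u * β x v) ?_ ?_ ?_ ?_, fun u v => ?_⟩
  · intros; simp [add_mul]
  · intros; simp [mul_assoc]
  · intros; simp [mul_add]
  · intros; simp [mul_left_comm]
  · simp [wedge]

theorem IsAlternating.add {α β : Form2 (𝓡 3) M} (hα : IsAlternating α) (hβ : IsAlternating β) :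
    IsAlternating (α + β) := by
  intro x
  obtain ⟨A, hA⟩ := hα x
  obtain ⟨B, hB⟩ := hβ x
  refine ⟨A + B, fun u v => ?_⟩
  simp only [Pi.add_apply, hA, hB, LinearMap.add_apply]
  ring

theorem IsAlternating.sum {ι : Type*} (s : Finset ι) {α : ι → Form2 (𝓡 3) M}
    (h : ∀ i, IsAlternating (α i)) : IsAlternating (∑ i ∈ s, α i) := by
  classical
  induction s using Finset.induction_on with
  | empty => exact fun x => ⟨0, fun u v => by simp⟩
  | insert i s hi ih => rw [Finset.sum_insert hi]; exact (h i).add ih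

variable {θ θ1 θ2 : Form1 (𝓡 3) M} (hc : IsCoframe θ θ1 θ2)

include hc

/-- Cramer's rule: each coefficient is the volume obtained by putting `α` in place of one coframe
element, divided by the volume of the coframe. -/
theorem IsCoframe.exists_coeffs_pointwise (α : Form1 (𝓡 3) M) :
    ∃ f g h : M → ℂ, α = f • θ + g • θ1 + h • θ2 := by
  refine ⟨fun x => wedge12 α (wedge θ1 θ2) x (stdVec x 0) (stdVec x 1) (stdVec x 2) /
      wedge12 θ (wedge θ1 θ2) x (stdVec x 0) (stdVec x 1) (stdVec x 2),
    fun x => wedge12 θ (wedge α θ2) x (stdVec x 0) (stdVec x 1) (stdVec x 2) /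
      wedge12 θ (wedge θ1 θ2) x (stdVec x 0) (stdVec x 1) (stdVec x 2),
    fun x => wedge12 θ (wedge θ1 α) x (stdVec x 0) (stdVec x 1) (stdVec x 2) /
      wedge12 θ (wedge θ1 θ2) x (stdVec x 0) (stdVec x 1) (stdVec x 2), ?_⟩
  funext x
  have h0 := hc x
  apply ContinuousLinearMap.coe_injective
  apply tangent_ext
  intro i
  simp only [Pi.add_apply, Pi.smul_apply', ContinuousLinearMap.coe_coe, add_apply, smul_apply,
    smul_eq_mul]
  field_simp
  fin_cases i <;> simp only [wedge12, wedge, Fin.zero_eta, Fin.mk_one, Fin.reduceFinMk] <;> ring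

/-- Each coefficient is isolated by wedging `β` with the 1-form complementary to the corresponding
pair. The minus sign in `q` comes from reordering `θ¹ ∧ θ ∧ θ²`. -/
theorem IsCoframe.exists_coeffs2_pointwise {β : Form2 (𝓡 3) M} (hβ : IsAlternating β) :
    ∃ p q r : M → ℂ, β = p • wedge θ θ1 + q • wedge θ θ2 + r • wedge θ1 θ2 := by
  refine ⟨fun x => wedge12 θ2 β x (stdVec x 0) (stdVec x 1) (stdVec x 2) /
      wedge12 θ (wedge θ1 θ2) x (stdVec x 0) (stdVec x 1) (stdVec x 2),
    fun x => -wedge12 θ1 β x (stdVec x 0) (stdVec x 1) (stdVec x 2) /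
      wedge12 θ (wedge θ1 θ2) x (stdVec x 0) (stdVec x 1) (stdVec x 2),
    fun x => wedge12 θ β x (stdVec x 0) (stdVec x 1) (stdVec x 2) /
      wedge12 θ (wedge θ1 θ2) x (stdVec x 0) (stdVec x 1) (stdVec x 2), ?_⟩
  funext x u v
  have h0 := hc x
  obtain ⟨B, hB⟩ := hβ x
  obtain ⟨C, hC⟩ := ((isAlternating_wedge θ θ1) x)
  obtain ⟨C', hC'⟩ := ((isAlternating_wedge θ θ2) x)
  obtain ⟨C'', hC''⟩ := ((isAlternating_wedge θ1 θ2) x)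
  simp only [Pi.add_apply, Pi.smul_apply', Pi.smul_apply, smul_eq_mul]
  generalize hp : wedge12 θ2 β x (stdVec x 0) (stdVec x 1) (stdVec x 2) /
      wedge12 θ (wedge θ1 θ2) x (stdVec x 0) (stdVec x 1) (stdVec x 2) = p
  generalize hq : -wedge12 θ1 β x (stdVec x 0) (stdVec x 1) (stdVec x 2) /
      wedge12 θ (wedge θ1 θ2) x (stdVec x 0) (stdVec x 1) (stdVec x 2) = q
  generalize hr : wedge12 θ β x (stdVec x 0) (stdVec x 1) (stdVec x 2) /
      wedge12 θ (wedge θ1 θ2) x (stdVec x 0) (stdVec x 1) (stdVec x 2) = r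
  -- With both sides written as bilinear maps, equality needs to be checked only on pairs of basis
  -- vectors.
  have key : B - B.flip = p • (C - C.flip) + q • (C' - C'.flip) + r • (C'' - C''.flip) := by
    apply tangent_ext
    intro i
    apply tangent_ext
    intro j
    simp only [LinearMap.sub_apply, LinearMap.flip_apply, LinearMap.add_apply,
      LinearMap.smul_apply, smul_eq_mul, ← hC, ← hC', ← hC'', ← hB]
    rw [← hp, ← hq, ← hr]
    have hanti : ∀ u v, β x u v = -β x v u := fun u v => by rw [hB, hB]; ring
    have hself : ∀ u, β x u u = 0 := fun u => by rw [hB]; ring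
    field_simp
    fin_cases i <;> fin_cases j <;>
      simp only [wedge12, wedge, Fin.zero_eta, Fin.mk_one, Fin.reduceFinMk, hself,
        hanti (stdVec x 1) (stdVec x 0), hanti (stdVec x 2) (stdVec x 0),
        hanti (stdVec x 2) (stdVec x 1)] <;> ring
  have key2 := LinearMap.congr_fun (LinearMap.congr_fun key u) v
  simp only [LinearMap.sub_apply, LinearMap.flip_apply, LinearMap.add_apply,
      LinearMap.smul_apply, smul_eq_mul, ← hC, ← hC', ← hC'', ← hB] at key2
  exact key2

/-- The 2-forms `θ ∧ θ¹`, `θ ∧ θ²`, `θ¹ ∧ θ²` are independent. -/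
theorem IsCoframe.coeffs2_eq_zero {p q r : M → ℂ}
    (h : p • wedge θ θ1 + q • wedge θ θ2 + r • wedge θ1 θ2 = 0) : p = 0 ∧ q = 0 ∧ r = 0 := by
  have hx : ∀ x u v, p x * wedge θ θ1 x u v + q x * wedge θ θ2 x u v + r x * wedge θ1 θ2 x u v
      = 0 := fun x u v => congrFun (congrFun (congrFun h x) u) v
  refine ⟨funext fun x => ?_, funext fun x => ?_, funext fun x => ?_⟩
  all_goals
    refine (mul_eq_zero.1 ?_).resolve_right (hc x)
    have h1 := hx x (stdVec x 0) (stdVec x 1)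
    have h2 := hx x (stdVec x 0) (stdVec x 2)
    have h3 := hx x (stdVec x 1) (stdVec x 2)
    simp only [wedge12, wedge] at h1 h2 h3 ⊢
  -- Each coefficient is isolated by wedging the relation with the complementary 1-form.
  · linear_combination θ2 x (stdVec x 0) * h3 - θ2 x (stdVec x 1) * h2 + θ2 x (stdVec x 2) * h1
  · linear_combination -(θ1 x (stdVec x 0) * h3 - θ1 x (stdVec x 1) * h2 + θ1 x (stdVec x 2) * h1)
  · linear_combination θ x (stdVec x 0) * h3 - θ x (stdVec x 1) * h2 + θ x (stdVec x 2) * h1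

theorem IsCoframe.coeff3_eq_zero {p : M → ℂ}
    (h : p • wedge12 θ (wedge θ1 θ2) = 0) : p = 0 := by
  funext x
  exact (mul_eq_zero.1 (congrFun (congrFun (congrFun (congrFun h x) (stdVec x 0)) (stdVec x 1))
    (stdVec x 2))).resolve_right (hc x)

variable [IsManifold (𝓡 3) ∞ M] (sθ : SmoothForm θ) (sθ1 : SmoothForm θ1) (sθ2 : SmoothForm θ2)
include sθ sθ1 sθ2

/-- Makes the coefficients of Cramer's rule smooth: each is the ratio of a smooth 3-form to the
nowhere vanishing volume form. -/
theorem IsCoframe.contMDiff_coeff {f : M → ℂ} {γ : Form3 (𝓡 3) M}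
    (hγ : SmoothForm3 γ) (h : γ = f • wedge12 θ (wedge θ1 θ2)) : ContMDiff (𝓡 3) 𝓘(ℝ, ℂ) ∞ f :=
  contMDiff_of_smul_eq (sθ.wedge12 (sθ1.wedge sθ2)) hγ h fun x => ⟨_, _, _, hc x⟩

/-- A smooth 1-form has smooth components in a smooth coframe. -/
theorem IsCoframe.exists_coeffs {α : Form1 (𝓡 3) M} (hα : SmoothForm α) :
    ∃ f g h : M → ℂ, α = f • θ + g • θ1 + h • θ2 ∧ ContMDiff (𝓡 3) 𝓘(ℝ, ℂ) ∞ f ∧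
      ContMDiff (𝓡 3) 𝓘(ℝ, ℂ) ∞ g ∧ ContMDiff (𝓡 3) 𝓘(ℝ, ℂ) ∞ h := by
  obtain ⟨f, g, h, e⟩ := hc.exists_coeffs_pointwise α
  refine ⟨f, g, h, e, hc.contMDiff_coeff sθ sθ1 sθ2 (hα.wedge12 (sθ1.wedge sθ2)) ?_,
    hc.contMDiff_coeff sθ sθ1 sθ2 (sθ.wedge12 (hα.wedge sθ2)) ?_,
    hc.contMDiff_coeff sθ sθ1 sθ2 (sθ.wedge12 (sθ1.wedge hα)) ?_⟩ <;>
  · funext x u v w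
    simp only [e, wedge12, wedge, Pi.add_apply, Pi.smul_apply', add_apply, smul_apply,
      Pi.smul_apply, smul_eq_mul]
    ring

/-- The differential of a smooth 1-form has smooth components in a smooth coframe. -/
theorem IsCoframe.exists_coeffs_extD {α : Form1 (𝓡 3) M} (hα : SmoothForm α) :
    ∃ p q r : M → ℂ, extD α = p • wedge θ θ1 + q • wedge θ θ2 + r • wedge θ1 θ2 ∧
      ContMDiff (𝓡 3) 𝓘(ℝ, ℂ) ∞ p ∧ ContMDiff (𝓡 3) 𝓘(ℝ, ℂ) ∞ q ∧
      ContMDiff (𝓡 3) 𝓘(ℝ, ℂ) ∞ r := by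
  obtain ⟨p, q, r, e⟩ := hc.exists_coeffs2_pointwise (isAlternating_extD α)
  refine ⟨p, q, r, e, hc.contMDiff_coeff sθ sθ1 sθ2 (sθ2.wedge12 hα.extD) ?_,
    hc.contMDiff_coeff sθ sθ1 sθ2 (γ := wedge12 (-θ1) (extD α)) (sθ1.neg.wedge12 hα.extD) ?_,
    hc.contMDiff_coeff sθ sθ1 sθ2 (sθ.wedge12 hα.extD) ?_⟩ <;>
  · funext x u v w
    simp only [e, wedge12, wedge, Pi.add_apply, Pi.neg_apply, neg_apply, Pi.smul_apply',
      Pi.smul_apply, smul_eq_mul]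
    ring

end Coframe

/-! ### Adapted coframes are coframes. -/

section AdaptedCoframe

variable {M : Type*} [TopologicalSpace M] [ChartedSpace (EuclideanSpace ℝ (Fin 3)) M]

theorem complexify_add_smul {x : M} (w₀ w₁ w₂ : ℂ) (α β γ : TangentSpace (𝓡 3) x →L[ℝ] ℂ)
    (l : ℂ ⊗[ℝ] TangentSpace (𝓡 3) x) :
    complexify (w₀ • α + w₁ • β + w₂ • γ) l =
      w₀ * complexify α l + w₁ * complexify β l + w₂ * complexify γ l := by
  induction l using TensorProduct.induction_on with
  | zero => simp
  | tmul z v => simp [complexify]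
  | add a b ha hb => rw [map_add, map_add, map_add, map_add, ha, hb]; ring

/-- In a linear relation between the three covectors, evaluation on `T¹` removes the coefficient of
`Z¹` and evaluation on `T²` that of `Z²`. The relation would then force `θ = 0` at the point,
although its complex kernel `T¹ ⊔ T²` has dimension at most 2 in a space of dimension 3. -/
theorem AdaptedCoframe.isCoframe {F : FlagStructure M} (c : AdaptedCoframe F) :
    IsCoframe c.θ c.Z1 c.Z2 := by
  intro x h0
  obtain ⟨w, hw, hP⟩ := Matrix.exists_vecMul_eq_zero_iff (M := !![c.θ x (stdVec x 0),
    c.θ x (stdVec x 1), c.θ x (stdVec x 2); c.Z1 x (stdVec x 0), c.Z1 x (stdVec x 1),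
    c.Z1 x (stdVec x 2); c.Z2 x (stdVec x 0), c.Z2 x (stdVec x 1), c.Z2 x (stdVec x 2)]).2 (by
      rw [Matrix.det_fin_three]
      simp only [Matrix.of_apply, Matrix.cons_val', Matrix.cons_val_zero, Matrix.cons_val_one,
        Matrix.cons_val]
      simp only [wedge12, wedge] at h0
      linear_combination h0)
  have hz : w 0 • c.θ x + w 1 • c.Z1 x + w 2 • c.Z2 x = 0 := by
    apply ContinuousLinearMap.coe_injective
    apply tangent_ext
    intro i
    have := congrFun hP i
    simp only [ContinuousLinearMap.coe_coe, add_apply, smul_apply, smul_eq_mul]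
    simp only [Matrix.vecMul, dotProduct, Fin.sum_univ_three, Matrix.of_apply, Matrix.cons_val',
      Pi.zero_apply] at this
    fin_cases i <;> simpa using this
  have hl : ∀ l, w 0 * complexify (c.θ x) l + w 1 * complexify (c.Z1 x) l +
      w 2 * complexify (c.Z2 x) l = 0 := by
    intro l
    rw [← complexify_add_smul, hz]
    induction l using TensorProduct.induction_on with
    | zero => simp
    | tmul z v => simp [complexify]
    | add a b ha hb => rw [map_add, ha, hb, add_zero]
  obtain ⟨l1, h1, h1'⟩ := SetLike.not_le_iff_exists.1 (c.Z1_ne x)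
  obtain ⟨l2, h2, h2'⟩ := SetLike.not_le_iff_exists.1 (c.Z2_ne x)
  have hw1 : w 1 = 0 := by
    have e := hl l1
    have a1 : complexify (c.θ x) l1 = 0 := by
      have : l1 ∈ cker (c.θ x) := by rw [c.ker_θ]; exact Submodule.mem_sup_left h1
      exact this
    have a2 : complexify (c.Z2 x) l1 = 0 := c.ker_Z2 x h1
    rw [a1, a2] at e
    simp only [mul_zero, zero_add, add_zero, mul_eq_zero] at e
    exact e.resolve_right h1'
  have hw2 : w 2 = 0 := by
    have e := hl l2
    have a1 : complexify (c.θ x) l2 = 0 := by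
      have : l2 ∈ cker (c.θ x) := by rw [c.ker_θ]; exact Submodule.mem_sup_right h2
      exact this
    have a2 : complexify (c.Z1 x) l2 = 0 := c.ker_Z1 x h2
    rw [a1, a2] at e
    simp only [mul_zero, zero_add, mul_eq_zero] at e
    exact e.resolve_right h2'
  have hw0 : w 0 ≠ 0 := by
    intro h
    apply hw
    funext i
    fin_cases i
    exacts [h, hw1, hw2]
  have htop : cker (c.θ x) = ⊤ := by
    rw [eq_top_iff]
    intro l _
    have e := hl l
    rw [hw1, hw2] at e
    simp only [zero_mul, add_zero, mul_eq_zero] at e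
    exact e.resolve_left hw0
  have hdim : Module.finrank ℂ (ℂ ⊗[ℝ] TangentSpace (𝓡 3) x) = 3 := by
    rw [Module.finrank_baseChange]
    exact finrank_euclideanSpace_fin
  have hfin : Module.finrank ℂ (cker (c.θ x)) ≤ 2 := by
    rw [c.ker_θ]
    have hfd : FiniteDimensional ℂ (ℂ ⊗[ℝ] TangentSpace (𝓡 3) x) :=
      FiniteDimensional.of_finrank_pos (by rw [hdim]; norm_num)
    refine (Submodule.finrank_add_le_finrank_add_finrank _ _).trans ?_
    rw [F.line1.finrank_eq, F.line2.finrank_eq]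
  rw [htop, finrank_top, hdim] at hfin
  norm_num at hfin

end AdaptedCoframe

/-! ### Differentials of functions and the Bianchi identity. -/

section Functions

variable {E : Type*} [NormedAddCommGroup E] [NormedSpace ℝ E] {H : Type*} [TopologicalSpace H]
  {I : ModelWithCorners ℝ E H} {N : Type*} [TopologicalSpace N] [ChartedSpace H N]

theorem contMDiff_fun_mul {f g : N → ℂ} (hf : ContMDiff I 𝓘(ℝ, ℂ) ∞ f)
    (hg : ContMDiff I 𝓘(ℝ, ℂ) ∞ g) : ContMDiff I 𝓘(ℝ, ℂ) ∞ (fun x => f x * g x) :=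
  contDiff_mul.contMDiff.comp (hf.prodMk_space hg)

theorem contMDiff_fun_const_mul (k : ℂ) {f : N → ℂ} (hf : ContMDiff I 𝓘(ℝ, ℂ) ∞ f) :
    ContMDiff I 𝓘(ℝ, ℂ) ∞ (fun x => k * f x) := contMDiff_fun_mul contMDiff_const hf

variable [I.Boundaryless] [IsManifold I ∞ N]

theorem dFun_add_apply {f g : N → ℂ} (hf : ContMDiff I 𝓘(ℝ, ℂ) ∞ f)
    (hg : ContMDiff I 𝓘(ℝ, ℂ) ∞ g) (x : N) (u : TangentSpace I x) :
    dFun I (fun z => f z + g z) x u = dFun I f x u + dFun I g x u := by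
  rw [dFun_apply_eq_fderiv hf, dFun_apply_eq_fderiv hg,
    dFun_apply_eq_fderiv (f := fun z => f z + g z) (hf.add hg),
    fderiv_fun_add ((contDiffAt_comp_symm hf x).differentiableAt (by simp))
      ((contDiffAt_comp_symm hg x).differentiableAt (by simp))]
  rfl

theorem dFun_mul_apply {f g : N → ℂ} (hf : ContMDiff I 𝓘(ℝ, ℂ) ∞ f)
    (hg : ContMDiff I 𝓘(ℝ, ℂ) ∞ g) (x : N) (u : TangentSpace I x) :
    dFun I (fun z => f z * g z) x u = f x * dFun I g x u + g x * dFun I f x u := by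
  rw [dFun_apply_eq_fderiv hf, dFun_apply_eq_fderiv hg,
    dFun_apply_eq_fderiv (contMDiff_fun_mul hf hg),
    fderiv_fun_mul ((contDiffAt_comp_symm hf x).differentiableAt (by simp))
      ((contDiffAt_comp_symm hg x).differentiableAt (by simp))]
  simp only [extChartAt_to_inv]
  rfl

theorem dFun_const_apply (k : ℂ) (x : N) (u : TangentSpace I x) :
    dFun I (fun _ : N => k) x u = 0 := by
  rw [dFun, mfderiv_const]
  rfl

theorem dFun_const_mul_apply (k : ℂ) {f : N → ℂ} (hf : ContMDiff I 𝓘(ℝ, ℂ) ∞ f) (x : N)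
    (u : TangentSpace I x) : dFun I (fun z => k * f z) x u = k * dFun I f x u := by
  rw [dFun_mul_apply contMDiff_const hf, dFun_const_apply, mul_zero, add_zero]

/-- The Bianchi identity in an entry where the curvature vanishes. -/
theorem bianchi {π : Matrix (Fin 3) (Fin 3) (Form1 I N)} (hπ : ∀ i j, SmoothForm (π i j))
    {i j : Fin 3} (h : curvature π i j = 0) :
    ∑ k, (wedge12 (π k j) (curvature π i k) - wedge12 (π i k) (curvature π k j)) = 0 := by
  -- Where the curvature entry vanishes, `dπᵢⱼ` is a sum of products of 1-forms, so `d² = 0` applies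
  -- without differentiating a 2-form. Replacing `dπ` by curvature minus `π ∧ π` then cancels the
  -- cubic terms.
  have h1 : extD (π i j) = ∑ k, wedge (-π i k) (π k j) := by
    have h2 : extD (π i j) = -∑ k, wedge (π i k) (π k j) := eq_neg_of_add_eq_zero_left h
    rw [h2, ← Finset.sum_neg_distrib]
    refine Finset.sum_congr rfl fun k _ => ?_
    funext x u v
    simp only [wedge, Pi.neg_apply, neg_apply]
    ring
  have h3 := sum_extD_wedge (hπ i j) (fun k => (hπ i k).neg) (fun k => hπ k j) h1
  rw [← neg_eq_zero, ← h3]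
  simp only [extD_neg, curvature]
  funext x u v w
  simp only [Finset.sum_apply, Pi.sub_apply, Pi.add_apply, wedge12, wedge, Pi.neg_apply,
    neg_apply, Fin.sum_univ_three]
  ring

end Functions

/-! ### Curvature entries of a connection matrix with `φ = 0`. -/

section Local

variable {E : Type*} [NormedAddCommGroup E] [NormedSpace ℝ E] {H : Type*} [TopologicalSpace H]
  {I : ModelWithCorners ℝ E H} {N : Type*} [TopologicalSpace N] [ChartedSpace H N]

/-- The `𝔰𝔩(3, ℂ)`-valued form with components `ω, ω¹, ω², φ, ω₁¹, φ¹, φ², ψ`. -/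
noncomputable def formMatrix (θ θ1 θ2 φ α φ1 φ2 ψ : Form1 I N) :
    Matrix (Fin 3) (Fin 3) (Form1 I N) :=
  !![-((1 / 2 : ℂ) • φ) - (1 / 3 : ℂ) • α, -φ2, -((1 / 4 : ℂ) • ψ);
     θ1, (2 / 3 : ℂ) • α, (1 / 2 : ℂ) • φ1;
     (2 : ℂ) • θ, (2 : ℂ) • θ2, (1 / 2 : ℂ) • φ - (1 / 3 : ℂ) • α]

/-- The normalization of the curvature of the canonical connection. -/
def IsNormalCurvature (θ θ1 θ2 : Form1 I N) (K : Matrix (Fin 3) (Fin 3) (Form2 I N)) : Prop :=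
  ∃ Q1 Q2 U1 U2 : N → ℂ,
    K = !![0, -(Q2 • wedge θ θ1), -((1 / 4 : ℂ) • wedge (U1 • θ1 + U2 • θ2) θ);
         0, 0, (1 / 2 : ℂ) • (Q1 • wedge θ θ2);
         0, 0, 0]

variable {θ θ1 θ2 α φ1 φ2 ψ : Form1 I N}

theorem smoothForm_formMatrix {φ : Form1 I N} (sθ : SmoothForm θ) (sθ1 : SmoothForm θ1)
    (sθ2 : SmoothForm θ2) (sφ : SmoothForm φ) (sα : SmoothForm α) (sφ1 : SmoothForm φ1)
    (sφ2 : SmoothForm φ2) (sψ : SmoothForm ψ) (i j : Fin 3) :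
    SmoothForm (formMatrix θ θ1 θ2 φ α φ1 φ2 ψ i j) := by
  fin_cases i <;> fin_cases j
  exacts [(sφ.const_smul _).neg.sub (sα.const_smul _), sφ2.neg, (sψ.const_smul _).neg, sθ1,
    sα.const_smul _, sφ1.const_smul _, sθ.const_smul _, sθ2.const_smul _,
    (sφ.const_smul _).sub (sα.const_smul _)]

section Entries

theorem smul_zero_form (k : ℂ) : k • (0 : Form1 I N) = 0 := by
  funext x; ext v; simp

theorem curvature_formMatrix_10 (θ θ1 θ2 α φ1 φ2 ψ : Form1 I N) :
    curvature (formMatrix θ θ1 θ2 0 α φ1 φ2 ψ) 1 0 =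
      extD θ1 - wedge θ1 α - wedge θ φ1 := by
  funext x u v
  simp only [curvature, formMatrix, Fin.sum_univ_three, Matrix.of_apply, Matrix.cons_val',
    Matrix.cons_val_zero, Matrix.cons_val_one, Matrix.cons_val, smul_zero_form, neg_zero, zero_sub,
    Pi.add_apply, Pi.sub_apply, wedge, Pi.neg_apply, Pi.smul_apply, neg_apply, smul_apply,
    smul_eq_mul]
  ring

theorem curvature_formMatrix_20 (sθ : SmoothForm θ) :
    curvature (formMatrix θ θ1 θ2 0 α φ1 φ2 ψ) 2 0 = (2 : ℂ) • (extD θ - wedge θ1 θ2) := by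
  funext x u v
  simp only [curvature, formMatrix, Fin.sum_univ_three, Matrix.of_apply, Matrix.cons_val',
    Matrix.cons_val_zero, Matrix.cons_val_one, Matrix.cons_val, smul_zero_form, neg_zero, zero_sub,
    Pi.add_apply, Pi.sub_apply, wedge, Pi.neg_apply, Pi.smul_apply, neg_apply, smul_apply,
    smul_eq_mul, extD_const_smul _ sθ]
  ring

theorem curvature_formMatrix_21 (sθ2 : SmoothForm θ2) :
    curvature (formMatrix θ θ1 θ2 0 α φ1 φ2 ψ) 2 1 =
      (2 : ℂ) • (extD θ2 - wedge θ φ2 + wedge θ2 α) := by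
  funext x u v
  simp only [curvature, formMatrix, Fin.sum_univ_three, Matrix.of_apply, Matrix.cons_val',
    Matrix.cons_val_zero, Matrix.cons_val_one, Matrix.cons_val, smul_zero_form, neg_zero, zero_sub,
    Pi.add_apply, Pi.sub_apply, wedge, Pi.neg_apply, Pi.smul_apply, neg_apply, smul_apply,
    smul_eq_mul, extD_const_smul _ sθ2]
  ring

theorem curvature_formMatrix_00 (sα : SmoothForm α) :
    curvature (formMatrix θ θ1 θ2 0 α φ1 φ2 ψ) 0 0 =
      -((1 / 3 : ℂ) • extD α) - wedge φ2 θ1 - (1 / 2 : ℂ) • wedge ψ θ := by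
  funext x u v
  simp only [curvature, formMatrix, Fin.sum_univ_three, Matrix.of_apply, Matrix.cons_val',
    Matrix.cons_val_zero, Matrix.cons_val_one, Matrix.cons_val, smul_zero_form, neg_zero, zero_sub,
    Pi.add_apply, Pi.sub_apply, wedge, Pi.neg_apply, Pi.smul_apply, neg_apply, smul_apply,
    smul_eq_mul, extD_neg, extD_const_smul _ sα]
  ring

theorem curvature_formMatrix_11 (sα : SmoothForm α) :
    curvature (formMatrix θ θ1 θ2 0 α φ1 φ2 ψ) 1 1 =
      (2 / 3 : ℂ) • extD α - wedge θ1 φ2 + wedge φ1 θ2 := by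
  funext x u v
  simp only [curvature, formMatrix, Fin.sum_univ_three, Matrix.of_apply, Matrix.cons_val',
    Matrix.cons_val_zero, Matrix.cons_val_one, Matrix.cons_val, smul_zero_form, neg_zero, zero_sub,
    Pi.add_apply, Pi.sub_apply, wedge, Pi.neg_apply, Pi.smul_apply, neg_apply, smul_apply,
    smul_eq_mul, extD_const_smul _ sα]
  ring

theorem curvature_formMatrix_22 (sα : SmoothForm α) :
    curvature (formMatrix θ θ1 θ2 0 α φ1 φ2 ψ) 2 2 =
      -((1 / 3 : ℂ) • extD α) - (1 / 2 : ℂ) • wedge θ ψ + wedge θ2 φ1 := by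
  funext x u v
  simp only [curvature, formMatrix, Fin.sum_univ_three, Matrix.of_apply, Matrix.cons_val',
    Matrix.cons_val_zero, Matrix.cons_val_one, Matrix.cons_val, smul_zero_form, neg_zero, zero_sub,
    Pi.add_apply, Pi.sub_apply, wedge, Pi.neg_apply, Pi.smul_apply, neg_apply, smul_apply,
    smul_eq_mul, extD_neg, extD_const_smul _ sα]
  ring

theorem curvature_formMatrix_01 (θ θ1 θ2 α φ1 φ2 ψ : Form1 I N) :
    curvature (formMatrix θ θ1 θ2 0 α φ1 φ2 ψ) 0 1 =
      -extD φ2 + wedge α φ2 - (1 / 2 : ℂ) • wedge ψ θ2 := by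
  funext x u v
  simp only [curvature, formMatrix, Fin.sum_univ_three, Matrix.of_apply, Matrix.cons_val',
    Matrix.cons_val_zero, Matrix.cons_val_one, Matrix.cons_val, smul_zero_form, neg_zero, zero_sub,
    Pi.add_apply, Pi.sub_apply, wedge, Pi.neg_apply, Pi.smul_apply, neg_apply, smul_apply,
    smul_eq_mul, extD_neg]
  ring

theorem curvature_formMatrix_12 (sφ1 : SmoothForm φ1) :
    curvature (formMatrix θ θ1 θ2 0 α φ1 φ2 ψ) 1 2 =
      (1 / 2 : ℂ) • (extD φ1 - (1 / 2 : ℂ) • wedge θ1 ψ + wedge α φ1) := by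
  funext x u v
  simp only [curvature, formMatrix, Fin.sum_univ_three, Matrix.of_apply, Matrix.cons_val',
    Matrix.cons_val_zero, Matrix.cons_val_one, Matrix.cons_val, smul_zero_form, neg_zero, zero_sub,
    Pi.add_apply, Pi.sub_apply, wedge, Pi.neg_apply, Pi.smul_apply, neg_apply, smul_apply,
    smul_eq_mul, extD_const_smul _ sφ1]
  ring

end Entries
end Local

/-! ### The explicit connection built from the local data. -/

section LocalNormal

variable {M : Type*} [TopologicalSpace M] [ChartedSpace (EuclideanSpace ℝ (Fin 3)) M]

/-- The structure equations of a pseudo-flag structure on `M`. -/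
structure BaseForms.IsPseudo (B : BaseForms M) : Prop where
  coframe : IsCoframe B.θ B.θ1 B.θ2
  smooth_θ : SmoothForm B.θ
  smooth_θ1 : SmoothForm B.θ1
  smooth_θ2 : SmoothForm B.θ2
  smooth_θ11 : SmoothForm B.θ11
  smooth_τ1 : SmoothForm B.τ1
  smooth_τ2 : SmoothForm B.τ2
  d_θ : extD B.θ = wedge B.θ1 B.θ2
  d_θ1 : extD B.θ1 = wedge B.θ1 B.θ11 + wedge B.θ B.τ1
  d_θ2 : extD B.θ2 = -wedge B.θ2 B.θ11 + wedge B.θ B.τ2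
  τ1_θ2 : wedge B.τ1 B.θ2 = 0
  τ2_θ1 : wedge B.τ2 B.θ1 = 0

/-- The candidates for the components of the canonical connection along a section of `X`. -/
noncomputable def LocalData.ω11 (D : LocalData M) (B : BaseForms M) : Form1 (𝓡 3) M :=
  B.θ11 - (1 / 4 : ℂ) • D.R • B.θ

noncomputable def LocalData.φ1 (D : LocalData M) (B : BaseForms M) : Form1 (𝓡 3) M :=
  -((1 / 4 : ℂ) • D.R • B.θ1) + D.E1 • B.θ + B.τ1

noncomputable def LocalData.φ2 (D : LocalData M) (B : BaseForms M) : Form1 (𝓡 3) M :=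
  (1 / 4 : ℂ) • D.R • B.θ2 + D.E2 • B.θ + B.τ2

/-- The first two coefficients are forced by the diagonal curvature entries. These contain `ψ` only
through `ψ ∧ θ`, so they leave `G` free; `G` is fixed by entry (1,2). -/
noncomputable def LocalData.ψ (D : LocalData M) (B : BaseForms M) : Form1 (𝓡 3) M :=
  D.E2 • B.θ1 - D.E1 • B.θ2 + D.G • B.θ

/-- The functions entering the connection forms are smooth. -/
structure LocalData.IsSmooth (D : LocalData M) : Prop where
  R : ContMDiff (𝓡 3) 𝓘(ℝ, ℂ) ∞ D.R
  R2 : ContMDiff (𝓡 3) 𝓘(ℝ, ℂ) ∞ D.R2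
  W2 : ContMDiff (𝓡 3) 𝓘(ℝ, ℂ) ∞ D.W2
  τ1_2 : ContMDiff (𝓡 3) 𝓘(ℝ, ℂ) ∞ D.τ1_2
  E1 : ContMDiff (𝓡 3) 𝓘(ℝ, ℂ) ∞ D.E1
  E2 : ContMDiff (𝓡 3) 𝓘(ℝ, ℂ) ∞ D.E2
  G : ContMDiff (𝓡 3) 𝓘(ℝ, ℂ) ∞ D.G

/-- The matrix of connection forms built from local data. -/
noncomputable def LocalData.matrix (D : LocalData M) (B : BaseForms M) :
    Matrix (Fin 3) (Fin 3) (Form1 (𝓡 3) M) :=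
  formMatrix B.θ B.θ1 B.θ2 0 (D.ω11 B) (D.φ1 B) (D.φ2 B) (D.ψ B)

variable [IsManifold (𝓡 3) ∞ M] {B : BaseForms M}

/-- The torsion conditions leave a single component in `τ¹` and in `τ²`. All other functions are
components in the coframe, except `E¹`, `E²`, `G`, which are solved for; smoothness passes along the
chain of components. -/
theorem BaseForms.IsPseudo.exists_data (h : B.IsPseudo) :
    ∃ D : LocalData M, D.IsDataOf B ∧ D.IsSmooth := by
  obtain ⟨hc, s0, s1, s2, s11, st1, st2, d0, d1, d2, t1, t2⟩ := h
  obtain ⟨f1, g1, τ1_2, eτ1, -, -, sτ1⟩ := hc.exists_coeffs s0 s1 s2 st1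
  obtain ⟨f2, τ2_1, h2, eτ2, -, sτ2, -⟩ := hc.exists_coeffs s0 s1 s2 st2
  have hτ1 : B.τ1 = τ1_2 • B.θ2 := by
    have := hc.coeffs2_eq_zero (p := 0) (q := f1) (r := g1) (by
      rw [← t1]
      funext x u v
      simp only [eτ1, wedge, Pi.add_apply, Pi.smul_apply', Pi.smul_apply, Pi.zero_apply, add_apply,
        smul_apply, smul_eq_mul]
      ring)
    obtain ⟨-, hf, hg⟩ := this
    rw [eτ1, hf, hg]
    funext x; ext v
    simp
  have hτ2 : B.τ2 = τ2_1 • B.θ1 := by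
    have := hc.coeffs2_eq_zero (p := f2) (q := 0) (r := -h2) (by
      rw [← t2]
      funext x u v
      simp only [eτ2, wedge, Pi.add_apply, Pi.smul_apply', Pi.smul_apply, Pi.zero_apply, add_apply,
        smul_apply, smul_eq_mul, Pi.neg_apply]
      ring)
    obtain ⟨hf, -, hg⟩ := this
    rw [eτ2, hf, neg_eq_zero.1 hg]
    funext x; ext v
    simp
  obtain ⟨p, q, R, eR, sp, sq, sR⟩ := hc.exists_coeffs_extD s0 s1 s2 s11
  have sW1 := contMDiff_fun_const_mul (-1) sp
  have sW2 := contMDiff_fun_const_mul (-1) sq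
  obtain ⟨R0, R1, R2, edR, sR0, sR1, sR2⟩ := hc.exists_coeffs s0 s1 s2 (SmoothForm.dFun sR)
  obtain ⟨R02, R12, R22, edR2, sR02, sR12, sR22⟩ := hc.exists_coeffs s0 s1 s2
    ((((SmoothForm.dFun sR2).add (SmoothForm.smul sR2 s11)).add
      (SmoothForm.smul (contMDiff_fun_mul sR1 sτ1) s0)).add
      ((SmoothForm.smul sR0 s1).const_smul (1 / 2)))
  obtain ⟨W20, W21, W22, edW2, sW20, sW21, sW22⟩ := hc.exists_coeffs s0 s1 s2
    ((SmoothForm.dFun sW2).add (SmoothForm.smul sW2 s11))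
  -- `W¹` and `W²` change sign because they multiply `θ¹ ∧ θ` and `θ² ∧ θ`, whereas `p` and `q`
  -- multiply `θ ∧ θ¹` and `θ ∧ θ²`. The last function is the solution `G` of its linear equation.
  refine ⟨⟨τ1_2, τ2_1, R, fun x => -1 * p x, fun x => -1 * q x, R0, R1, R2, R02, R12, R22, W20, W21,
    W22, fun x => 2 / 3 * (-1 * q x + (-1 / 4) * R2 x),
    fun x => 2 / 3 * (-1 * p x + (-1 / 4) * R1 x),
    fun x => -2 * (τ1_2 x * τ2_1 x) + (2 / 3 * R0 x + (-1 / 8 * (R x * R x) +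
      (4 / 3 * W21 x + -1 / 3 * R12 x)))⟩, ⟨hτ1, hτ2, ?_, edR, ?_, edW2, ?_, ?_, ?_⟩, ⟨sR, sR2, sW2,
    sτ1, ?_, ?_, ?_⟩⟩
  · rw [eR]
    funext x u v
    simp only [wedge, Pi.add_apply, Pi.smul_apply', Pi.smul_apply, smul_eq_mul]
    ring
  · exact edR2
  · intro x; simp only; ring
  · intro x; simp only; ring
  · intro x; simp only; ring
  · exact contMDiff_fun_const_mul _ (sW2.add (contMDiff_fun_const_mul _ sR2))
  · exact contMDiff_fun_const_mul _ (sW1.add (contMDiff_fun_const_mul _ sR1))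
  · exact (contMDiff_fun_const_mul _ (contMDiff_fun_mul sτ1 sτ2)).add
      ((contMDiff_fun_const_mul _ sR0).add
        ((contMDiff_fun_const_mul _ (contMDiff_fun_mul sR sR)).add
      ((contMDiff_fun_const_mul _ sW21).add (contMDiff_fun_const_mul _ sR12))))

section Smoothness

variable {D : LocalData M} (h : B.IsPseudo) (sD : D.IsSmooth)
include h sD

theorem LocalData.smooth_ω11 : SmoothForm (D.ω11 B) :=
  h.smooth_θ11.sub ((SmoothForm.smul sD.R h.smooth_θ).const_smul _)

theorem LocalData.smooth_φ1 : SmoothForm (D.φ1 B) :=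
  (((SmoothForm.smul sD.R h.smooth_θ1).const_smul _).neg.add
    (SmoothForm.smul sD.E1 h.smooth_θ)).add h.smooth_τ1

theorem LocalData.smooth_φ2 : SmoothForm (D.φ2 B) :=
  (((SmoothForm.smul sD.R h.smooth_θ2).const_smul _).add
    (SmoothForm.smul sD.E2 h.smooth_θ)).add h.smooth_τ2

theorem LocalData.smooth_ψ : SmoothForm (D.ψ B) :=
  ((SmoothForm.smul sD.E2 h.smooth_θ1).sub (SmoothForm.smul sD.E1 h.smooth_θ2)).add
    (SmoothForm.smul sD.G h.smooth_θ)

theorem LocalData.smooth_matrix (i j : Fin 3) : SmoothForm (D.matrix B i j) :=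
  smoothForm_formMatrix h.smooth_θ h.smooth_θ1 h.smooth_θ2 SmoothForm.zero (smooth_ω11 h sD)
    (smooth_φ1 h sD) (smooth_φ2 h sD) (smooth_ψ h sD) i j

variable (hD : D.IsDataOf B)
include hD

/-- The two terms in `R/4`, one from `ω₁¹` and one from `φ¹`, cancel by antisymmetry, which leaves
the structure equation for `dθ¹`. -/
theorem LocalData.curvature_10 : curvature (D.matrix B) 1 0 = 0 := by
  rw [matrix, curvature_formMatrix_10, h.d_θ1]
  funext x u v
  simp only [LocalData.ω11, LocalData.φ1, wedge, Pi.add_apply, Pi.sub_apply, Pi.neg_apply,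
    Pi.smul_apply', Pi.smul_apply, Pi.zero_apply, add_apply, sub_apply, neg_apply, smul_apply,
    smul_eq_mul]
  ring

theorem LocalData.curvature_20 : curvature (D.matrix B) 2 0 = 0 := by
  rw [matrix, curvature_formMatrix_20 h.smooth_θ, h.d_θ, sub_self, smul_zero]

theorem LocalData.curvature_21 : curvature (D.matrix B) 2 1 = 0 := by
  rw [matrix, curvature_formMatrix_21 h.smooth_θ2, h.d_θ2]
  funext x u v
  simp only [LocalData.ω11, LocalData.φ2, wedge, Pi.add_apply, Pi.sub_apply, Pi.neg_apply,
    Pi.smul_apply', Pi.smul_apply, Pi.zero_apply, add_apply, sub_apply, neg_apply, smul_apply,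
    smul_eq_mul]
  ring

theorem LocalData.extD_ω11_apply (x : M) (u v : TangentSpace (𝓡 3) x) :
    extD (D.ω11 B) x u v = 3 / 4 * D.R x * wedge B.θ1 B.θ2 x u v +
      (D.W1 x - 1 / 4 * D.R1 x) * wedge B.θ1 B.θ x u v +
      (D.W2 x - 1 / 4 * D.R2 x) * wedge B.θ2 B.θ x u v := by
  rw [LocalData.ω11, extD_sub h.smooth_θ11 ((SmoothForm.smul sD.R h.smooth_θ).const_smul _),
    extD_const_smul _ (SmoothForm.smul sD.R h.smooth_θ), extD_smul sD.R h.smooth_θ, h.d_θ,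
    hD.d_θ11, hD.d_R]
  simp only [wedge, Pi.add_apply, Pi.sub_apply, Pi.smul_apply', Pi.smul_apply, add_apply,
    smul_apply, smul_eq_mul]
  ring

/-- The `θ¹ ∧ θ²` component vanishes because a third of the `3R/4` in `dω₁¹` equals the `R/4` in
`φ²`. The other two components vanish exactly for the factor `2/3` in `E¹` and `E²`. The torsion
drops out since `τ²` is a multiple of `θ¹`. -/
theorem LocalData.curvature_00 : curvature (D.matrix B) 0 0 = 0 := by
  rw [matrix, curvature_formMatrix_00 (smooth_ω11 h sD)]
  funext x u v
  simp only [Pi.add_apply, Pi.sub_apply, Pi.neg_apply, Pi.smul_apply, extD_ω11_apply h sD hD]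
  simp only [LocalData.ψ, LocalData.φ2, hD.τ2_eq, wedge, Pi.add_apply, Pi.sub_apply, Pi.neg_apply,
    Pi.smul_apply', Pi.smul_apply, Pi.zero_apply, add_apply, sub_apply, neg_apply, smul_apply,
    smul_eq_mul, hD.E1_eq, hD.E2_eq]
  ring

theorem LocalData.curvature_11 : curvature (D.matrix B) 1 1 = 0 := by
  rw [matrix, curvature_formMatrix_11 (smooth_ω11 h sD)]
  funext x u v
  simp only [Pi.add_apply, Pi.sub_apply, Pi.neg_apply, Pi.smul_apply, extD_ω11_apply h sD hD]
  simp only [LocalData.φ1, LocalData.φ2, hD.τ1_eq, hD.τ2_eq, wedge, Pi.add_apply, Pi.sub_apply,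
    Pi.neg_apply, Pi.smul_apply', Pi.smul_apply, Pi.zero_apply, add_apply, sub_apply, neg_apply,
    smul_apply, smul_eq_mul, hD.E1_eq, hD.E2_eq]
  ring

theorem LocalData.curvature_22 : curvature (D.matrix B) 2 2 = 0 := by
  rw [matrix, curvature_formMatrix_22 (smooth_ω11 h sD)]
  funext x u v
  simp only [Pi.add_apply, Pi.sub_apply, Pi.neg_apply, Pi.smul_apply, extD_ω11_apply h sD hD]
  simp only [LocalData.ψ, LocalData.φ1, hD.τ1_eq, wedge, Pi.add_apply, Pi.sub_apply, Pi.neg_apply,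
    Pi.smul_apply', Pi.smul_apply, Pi.zero_apply, add_apply, sub_apply, neg_apply, smul_apply,
    smul_eq_mul, hD.E1_eq, hD.E2_eq]
  ring

theorem LocalData.dFun_E1_apply (x : M) (u : TangentSpace (𝓡 3) x) :
    dFun (𝓡 3) D.E1 x u = 2 / 3 * (dFun (𝓡 3) D.W2 x u - 1 / 4 * dFun (𝓡 3) D.R2 x u) := by
  have e : D.E1 = fun x => 2 / 3 * (D.W2 x + (-1 / 4) * D.R2 x) := by
    funext x; rw [hD.E1_eq]; ring
  rw [e, dFun_const_mul_apply (f := fun x => D.W2 x + (-1 / 4) * D.R2 x) _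
      (sD.W2.add (contMDiff_fun_const_mul _ sD.R2)),
    dFun_add_apply sD.W2 (contMDiff_fun_const_mul _ sD.R2), dFun_const_mul_apply _ sD.R2]
  ring

/-- Wedging with `θ²` extracts the `θ ∧ θ¹` component, whose vanishing is the equation that defines
`G`. It also removes the term `dτ¹₂ ∧ θ²`, about which nothing is known. -/
theorem LocalData.wedge_curvature_12 : wedge12 B.θ2 (curvature (D.matrix B) 1 2) = 0 := by
  have eφ : extD (D.φ1 B) = -((1 / 4 : ℂ) • (wedge (dFun (𝓡 3) D.R) B.θ1 + D.R • extD B.θ1)) +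
      (wedge (dFun (𝓡 3) D.E1) B.θ + D.E1 • extD B.θ) +
      (wedge (dFun (𝓡 3) D.τ1_2) B.θ2 + D.τ1_2 • extD B.θ2) := by
    rw [LocalData.φ1, hD.τ1_eq, extD_add (((SmoothForm.smul sD.R h.smooth_θ1).const_smul _).neg.add
      (SmoothForm.smul sD.E1 h.smooth_θ)) (SmoothForm.smul sD.τ1_2 h.smooth_θ2),
      extD_add ((SmoothForm.smul sD.R h.smooth_θ1).const_smul _).neg
        (SmoothForm.smul sD.E1 h.smooth_θ), extD_neg,
      extD_const_smul _ (SmoothForm.smul sD.R h.smooth_θ1), extD_smul sD.R h.smooth_θ1,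
      extD_smul sD.E1 h.smooth_θ, extD_smul sD.τ1_2 h.smooth_θ2]
  -- The covariant derivatives of `W²` and `R₂` are solved for the ordinary differentials that occur
  -- in `dE¹`; the resulting `θ₁¹` terms cancel against `ω₁¹ ∧ φ¹`.
  have hW2 : ∀ x u, dFun (𝓡 3) D.W2 x u = D.W2_0 x * B.θ x u + D.W2_1 x * B.θ1 x u +
      D.W2_2 x * B.θ2 x u - D.W2 x * B.θ11 x u := fun x u => by
    have := congrArg (fun α : Form1 (𝓡 3) M => α x u) hD.d_W2
    simp only [Pi.add_apply, Pi.smul_apply', Pi.smul_apply, add_apply, smul_apply,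
      smul_eq_mul] at this
    linear_combination this
  have hR2 : ∀ x u, dFun (𝓡 3) D.R2 x u = D.R02 x * B.θ x u + D.R12 x * B.θ1 x u +
      D.R22 x * B.θ2 x u - D.R2 x * B.θ11 x u - D.R1 x * D.τ1_2 x * B.θ x u -
      1 / 2 * D.R0 x * B.θ1 x u := fun x u => by
    have := congrArg (fun α : Form1 (𝓡 3) M => α x u) hD.d_R2
    simp only [Pi.add_apply, Pi.smul_apply', Pi.smul_apply, Pi.mul_apply, add_apply, smul_apply,
      smul_eq_mul] at this
    linear_combination this
  rw [matrix, curvature_formMatrix_12 (smooth_φ1 h sD), eφ, h.d_θ1, h.d_θ2, h.d_θ, hD.d_R]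
  funext x u v w
  have hG : D.G x = 2 * (-(D.τ1_2 x * D.τ2_1 x) + 1 / 3 * D.R0 x - 1 / 16 * D.R x ^ 2 +
      2 / 3 * D.W2_1 x - 1 / 6 * D.R12 x) := by linear_combination 2 * hD.G_eq x
  simp only [wedge12, LocalData.ω11, LocalData.φ1, LocalData.ψ, hD.τ1_eq, hD.τ2_eq, wedge,
    Pi.add_apply, Pi.sub_apply, Pi.neg_apply, Pi.smul_apply', Pi.smul_apply, Pi.zero_apply,
    add_apply, sub_apply, neg_apply, smul_apply, smul_eq_mul, dFun_E1_apply h sD hD, hW2, hR2, hG,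
    hD.E1_eq, hD.E2_eq]
  ring

end Smoothness

end LocalNormal

/-! ### Normality of the explicit connection, and uniqueness. -/

section NormalCurvature

variable {M : Type*} [TopologicalSpace M] [ChartedSpace (EuclideanSpace ℝ (Fin 3)) M]

theorem isAlternating_curvature (π : Matrix (Fin 3) (Fin 3) (Form1 (𝓡 3) M)) (i j : Fin 3) :
    IsAlternating (curvature π i j) :=
  (isAlternating_extD _).add (IsAlternating.sum _ fun _ => isAlternating_wedge _ _)

variable [IsManifold (𝓡 3) ∞ M] {B : BaseForms M}

/-- The curvature of the matrix built from the local data is normal. -/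
theorem LocalData.isNormalCurvature {D : LocalData M} (h : B.IsPseudo) (sD : D.IsSmooth)
    (hD : D.IsDataOf B) : IsNormalCurvature B.θ B.θ1 B.θ2 (curvature (D.matrix B)) := by
  have k00 := curvature_00 h sD hD
  have k10 := curvature_10 h sD hD
  have k11 := curvature_11 h sD hD
  have k20 := curvature_20 h sD hD
  have k21 := curvature_21 h sD hD
  have k22 := curvature_22 h sD hD
  have sm := smooth_matrix h sD
  obtain ⟨P, Q, C, e12⟩ := h.coframe.exists_coeffs2_pointwise
    (isAlternating_curvature (D.matrix B) 1 2)
  obtain ⟨P', Q', C', e01⟩ := h.coframe.exists_coeffs2_pointwise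
    (isAlternating_curvature (D.matrix B) 0 1)
  obtain ⟨p, q, r, e02⟩ := h.coframe.exists_coeffs2_pointwise
    (isAlternating_curvature (D.matrix B) 0 2)
  have hP : P = 0 := by
    refine h.coframe.coeff3_eq_zero ?_
    rw [← wedge_curvature_12 h sD hD, e12]
    funext x u v w
    simp only [wedge12, wedge, Pi.add_apply, Pi.smul_apply', Pi.smul_apply, smul_eq_mul]
    ring
  have hC : C = 0 := by
    refine h.coframe.coeff3_eq_zero ?_
    -- Only `2θ ∧ Π₁₂ = 0` survives in this identity, and it isolates the `θ¹ ∧ θ²` component.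
    have b := bianchi sm k10
    rw [Fin.sum_univ_three, k00, k10, k11, k20, e12] at b
    funext x u v w
    have b' := congrFun (congrFun (congrFun (congrFun b x) u) v) w
    simp only [LocalData.matrix, formMatrix, Matrix.of_apply, Matrix.cons_val',
      Matrix.cons_val_zero,
      Matrix.cons_val_one, Matrix.cons_val, wedge12, wedge, Pi.add_apply, Pi.sub_apply,
      Pi.smul_apply', Pi.smul_apply, smul_apply, smul_eq_mul, Pi.zero_apply, mul_zero] at b' ⊢
    linear_combination (1 / 2) * b'
  have hC' : C' = 0 := by
    refine h.coframe.coeff3_eq_zero ?_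
    -- Here the identity reduces to `2θ ∧ Π₀₁ = 0`.
    have b := bianchi sm k21
    rw [Fin.sum_univ_three, k20, k21, k22, k11, e01] at b
    funext x u v w
    have b' := congrFun (congrFun (congrFun (congrFun b x) u) v) w
    simp only [LocalData.matrix, formMatrix, Matrix.of_apply, Matrix.cons_val',
      Matrix.cons_val_zero,
      Matrix.cons_val_one, Matrix.cons_val, wedge12, wedge, Pi.add_apply, Pi.sub_apply,
      Pi.smul_apply', Pi.smul_apply, smul_apply, smul_eq_mul, Pi.zero_apply, mul_zero] at b' ⊢
    linear_combination (-1 / 2) * b'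
  have hQ' : Q' = 0 := by
    refine h.coframe.coeff3_eq_zero ?_
    -- The identity reads `2θ² ∧ Π₁₂ = θ¹ ∧ Π₀₁`, so `P = 0` in entry (1,2) gives `Q' = 0` in entry
    -- (0,1).
    have b := bianchi sm k11
    rw [Fin.sum_univ_three, k10, k11, k21, e12, e01, hP] at b
    funext x u v w
    have b' := congrFun (congrFun (congrFun (congrFun b x) u) v) w
    simp only [LocalData.matrix, formMatrix, Matrix.of_apply, Matrix.cons_val',
      Matrix.cons_val_zero,
      Matrix.cons_val_one, Matrix.cons_val, wedge12, wedge, Pi.add_apply, Pi.sub_apply,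
      Pi.smul_apply', Pi.smul_apply, smul_apply, smul_eq_mul, Pi.zero_apply, mul_zero] at b' ⊢
    linear_combination b'
  have hr : r = 0 := by
    refine h.coframe.coeff3_eq_zero ?_
    -- The identity reads `θ¹ ∧ Π₀₁ + 2θ ∧ Π₀₂ = 0`; its first term vanishes since `Π₀₁` is already
    -- a multiple of `θ ∧ θ¹`.
    have b := bianchi sm k00
    rw [Fin.sum_univ_three, k00, k10, k20, e01, e02, hQ', hC'] at b
    funext x u v w
    have b' := congrFun (congrFun (congrFun (congrFun b x) u) v) w
    simp only [LocalData.matrix, formMatrix, Matrix.of_apply, Matrix.cons_val',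
      Matrix.cons_val_zero,
      Matrix.cons_val_one, Matrix.cons_val, wedge12, wedge, Pi.add_apply, Pi.sub_apply,
      Pi.smul_apply', Pi.smul_apply, smul_apply, smul_eq_mul, Pi.zero_apply, mul_zero] at b' ⊢
    linear_combination (1 / 2) * b'
  -- The factors `2`, `-1`, `4` undo the normalizations `1/2`, `-1`, `1/4` in the prescribed
  -- curvature matrix.
  refine ⟨fun x => 2 * Q x, fun x => -P' x, fun x => 4 * p x, fun x => 4 * q x, ?_⟩
  refine Matrix.ext fun i j => ?_
  fin_cases i <;> fin_cases j
  · exact k00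
  · refine e01.trans ?_
    rw [hQ', hC']
    funext x u v
    simp only [Matrix.of_apply, Matrix.cons_val', Matrix.cons_val_zero, Matrix.cons_val_one,
      Matrix.cons_val, Fin.zero_eta, Fin.mk_one, Fin.reduceFinMk, wedge, Pi.add_apply,
      Pi.neg_apply, Pi.smul_apply', Pi.smul_apply, smul_eq_mul, Pi.zero_apply]
    ring
  · refine e02.trans ?_
    rw [hr]
    funext x u v
    simp only [Matrix.of_apply, Matrix.cons_val', Matrix.cons_val_zero, Matrix.cons_val_one,
      Matrix.cons_val, Fin.zero_eta, Fin.mk_one, Fin.reduceFinMk, wedge, Pi.add_apply,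
      Pi.neg_apply, Pi.smul_apply', Pi.smul_apply, add_apply, smul_apply, smul_eq_mul,
      Pi.zero_apply]
    ring
  · exact k10
  · exact k11
  · refine e12.trans ?_
    rw [hP, hC]
    funext x u v
    simp only [Matrix.of_apply, Matrix.cons_val', Matrix.cons_val_zero, Matrix.cons_val_one,
      Matrix.cons_val, Fin.zero_eta, Fin.mk_one, Fin.reduceFinMk, wedge, Pi.add_apply,
      Pi.neg_apply, Pi.smul_apply', Pi.smul_apply, smul_eq_mul, Pi.zero_apply]
    ring
  · exact k20
  · exact k21
  · exact k22

theorem IsNormalCurvature.entries {θ θ1 θ2 : Form1 (𝓡 3) M}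
    {K : Matrix (Fin 3) (Fin 3) (Form2 (𝓡 3) M)} (h : IsNormalCurvature θ θ1 θ2 K) :
    K 0 0 = 0 ∧ K 1 0 = 0 ∧ K 1 1 = 0 ∧ K 2 0 = 0 ∧ K 2 1 = 0 ∧ K 2 2 = 0 ∧
      ∃ Q : M → ℂ, K 0 1 = -(Q • wedge θ θ1) := by
  obtain ⟨Q1, Q2, U1, U2, rfl⟩ := h
  exact ⟨rfl, rfl, rfl, rfl, rfl, rfl, Q2, rfl⟩

/-- A normal connection with vanishing `φ` is determined by its tautological forms. -/
theorem formMatrix_unique {θ θ1 θ2 α φ1 φ2 ψ α' φ1' φ2' ψ' : Form1 (𝓡 3) M}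
    (hc : IsCoframe θ θ1 θ2) (sθ : SmoothForm θ) (sθ1 : SmoothForm θ1) (sθ2 : SmoothForm θ2)
    (d_θ : extD θ = wedge θ1 θ2)
    (sα : SmoothForm α) (sα' : SmoothForm α')
    (hK : IsNormalCurvature θ θ1 θ2 (curvature (formMatrix θ θ1 θ2 0 α φ1 φ2 ψ)))
    (hK' : IsNormalCurvature θ θ1 θ2 (curvature (formMatrix θ θ1 θ2 0 α' φ1' φ2' ψ'))) :
    α = α' ∧ φ1 = φ1' ∧ φ2 = φ2' ∧ ψ = ψ' := by
  -- The four differences are expanded in the coframe. Smoothness is needed only for `x0`, the one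
  -- component that gets differentiated.
  obtain ⟨x0, x1, x2, eα, sx0, -, -⟩ := hc.exists_coeffs sθ sθ1 sθ2 (sα.sub sα')
  obtain ⟨b0, b1, b2, eφ1⟩ := hc.exists_coeffs_pointwise (φ1 - φ1')
  obtain ⟨c0, c1, c2, eφ2⟩ := hc.exists_coeffs_pointwise (φ2 - φ2')
  obtain ⟨h0, h1, h2, eψ⟩ := hc.exists_coeffs_pointwise (ψ - ψ')
  obtain rfl : α = α' + (x0 • θ + x1 • θ1 + x2 • θ2) := by rw [← eα]; abel
  obtain rfl : φ1 = φ1' + (b0 • θ + b1 • θ1 + b2 • θ2) := by rw [← eφ1]; abel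
  obtain rfl : φ2 = φ2' + (c0 • θ + c1 • θ1 + c2 • θ2) := by rw [← eφ2]; abel
  obtain rfl : ψ = ψ' + (h0 • θ + h1 • θ1 + h2 • θ2) := by rw [← eψ]; abel
  obtain ⟨K00, K10, K11, -, K21, K22, Q, K01⟩ := hK.entries
  obtain ⟨K00', K10', K11', -, K21', K22', Q', K01'⟩ := hK'.entries
  clear hK hK'
  rw [curvature_formMatrix_10] at K10 K10'
  rw [curvature_formMatrix_21 sθ2] at K21 K21'
  rw [curvature_formMatrix_00 sα] at K00
  rw [curvature_formMatrix_00 sα'] at K00'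
  rw [curvature_formMatrix_11 sα] at K11
  rw [curvature_formMatrix_11 sα'] at K11'
  rw [curvature_formMatrix_22 sα] at K22
  rw [curvature_formMatrix_22 sα'] at K22'
  rw [curvature_formMatrix_01] at K01 K01'
  -- Entries (1,0) and (2,1) involve the differences algebraically. They leave `x0 θ` in `ω₁¹`, `b0
  -- θ + x0 θ¹` in `φ¹` and `c0 θ - x0 θ²` in `φ²`.
  obtain ⟨e1, e2, e3⟩ := hc.coeffs2_eq_zero (p := x0 - b1) (q := -b2) (r := -x2) (by
    funext x u v
    have i1 := congrFun (congrFun (congrFun K10 x) u) v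
    have i2 := congrFun (congrFun (congrFun K10' x) u) v
    simp only [wedge, Pi.add_apply, Pi.sub_apply, Pi.neg_apply, Pi.smul_apply',
      Pi.smul_apply, add_apply, smul_apply, smul_eq_mul, Pi.zero_apply] at i1 i2 ⊢
    linear_combination i1 - i2)
  obtain ⟨e4, e5, e6⟩ := hc.coeffs2_eq_zero (p := -c1) (q := -c2 - x0) (r := -x1) (by
    funext x u v
    have i1 := congrFun (congrFun (congrFun K21 x) u) v
    have i2 := congrFun (congrFun (congrFun K21' x) u) v
    simp only [wedge, Pi.add_apply, Pi.sub_apply, Pi.neg_apply, Pi.smul_apply',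
      Pi.smul_apply, add_apply, smul_apply, smul_eq_mul, Pi.zero_apply] at i1 i2 ⊢
    linear_combination (i1 - i2) / 2)
  have hx1 : x1 = 0 := neg_eq_zero.1 e6
  have hx2 : x2 = 0 := neg_eq_zero.1 e3
  have hb2 : b2 = 0 := neg_eq_zero.1 e2
  have hc1 : c1 = 0 := neg_eq_zero.1 e4
  have hb1 : x0 = b1 := sub_eq_zero.1 e1
  have hc2 : c2 = -x0 := by
    funext x
    have := congrFun e5 x
    simp only [Pi.sub_apply, Pi.neg_apply, Pi.zero_apply] at this ⊢
    linear_combination -this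
  subst hx1 hx2 hb2 hc1 hb1 hc2
  have eα' : x0 • θ + (0 : M → ℂ) • θ1 + (0 : M → ℂ) • θ2 = x0 • θ := by
    funext x; ext v; simp
  have dα : extD (α' + (x0 • θ + (0 : M → ℂ) • θ1 + (0 : M → ℂ) • θ2)) =
      extD α' + (wedge (dFun (𝓡 3) x0) θ + x0 • wedge θ1 θ2) := by
    rw [eα', extD_add sα' (SmoothForm.smul sx0 sθ), extD_smul sx0 sθ, d_θ]
  obtain ⟨y0, y1, y2, ey⟩ := hc.exists_coeffs_pointwise (dFun (𝓡 3) x0)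
  rw [dα, ey] at K11
  -- The `θ¹ ∧ θ²` component of entry (1,1) collects `2/3` from `d(x0 θ)` and `1` from each of `φ¹`
  -- and `φ²`, which gives `8/3 x0`.
  obtain ⟨-, -, e7⟩ := hc.coeffs2_eq_zero (p := c0 - fun x => 2 / 3 * y1 x)
    (q := b0 - fun x => 2 / 3 * y2 x) (r := fun x => 8 / 3 * x0 x) (by
    funext x u v
    have i1 := congrFun (congrFun (congrFun K11 x) u) v
    have i2 := congrFun (congrFun (congrFun K11' x) u) v
    simp only [wedge, Pi.add_apply, Pi.sub_apply, Pi.neg_apply, Pi.smul_apply',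
      Pi.smul_apply, add_apply, smul_apply, smul_eq_mul, Pi.zero_apply] at i1 i2 ⊢
    linear_combination i1 - i2)
  have hx0 : x0 = 0 := by
    funext x
    have := congrFun e7 x
    simpa using this
  subst hx0
  have hz : (0 : M → ℂ) • θ + (0 : M → ℂ) • θ1 + (0 : M → ℂ) • θ2 = 0 := by
    funext x; ext v; simp
  -- Now `x0 = 0`. Going back through `dα` removes the components of its differential, after which
  -- entry (1,1) gives `b0 = c0 = 0`.
  have hy : extD α' + (wedge (y0 • θ + y1 • θ1 + y2 • θ2) θ + (0 : M → ℂ) • wedge θ1 θ2) =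
      extD α' := by rw [← ey, ← dα, hz, add_zero]
  rw [hy] at K11
  obtain ⟨hc0, hb0, -⟩ := hc.coeffs2_eq_zero (p := c0) (q := b0) (r := 0) (by
    funext x u v
    have i1 := congrFun (congrFun (congrFun K11 x) u) v
    have i2 := congrFun (congrFun (congrFun K11' x) u) v
    simp only [wedge, Pi.add_apply, Pi.sub_apply, Pi.neg_apply, Pi.smul_apply',
      Pi.smul_apply, add_apply, smul_apply, smul_eq_mul, Pi.zero_apply] at i1 i2 ⊢
    linear_combination i1 - i2)
  subst hc0 hb0
  simp only [neg_zero, hz, add_zero] at K00 K22 K01 ⊢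
  obtain ⟨h1', h2', -⟩ := hc.coeffs2_eq_zero (p := -h1) (q := -h2) (r := 0) (by
    funext x u v
    have i1 := congrFun (congrFun (congrFun K22 x) u) v
    have i2 := congrFun (congrFun (congrFun K22' x) u) v
    have i3 := congrFun (congrFun (congrFun K00 x) u) v
    have i4 := congrFun (congrFun (congrFun K00' x) u) v
    simp only [wedge, Pi.add_apply, Pi.sub_apply, Pi.neg_apply, Pi.smul_apply',
      Pi.smul_apply, add_apply, smul_apply, smul_eq_mul, Pi.zero_apply] at i1 i2 i3 i4 ⊢
    linear_combination i1 - i2 - i3 + i4)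
  -- Entry (0,1) is prescribed only up to the unknown function in front of `θ ∧ θ¹`; the `θ ∧ θ²`
  -- component is free of it and determines `h0`.
  obtain ⟨-, h0', -⟩ := hc.coeffs2_eq_zero (p := fun x => Q x - Q' x)
    (q := fun x => -1 / 2 * h0 x) (r := fun x => -1 / 2 * h1 x) (by
    funext x u v
    have i1 := congrFun (congrFun (congrFun K01 x) u) v
    have i2 := congrFun (congrFun (congrFun K01' x) u) v
    simp only [wedge, Pi.add_apply, Pi.sub_apply, Pi.neg_apply, Pi.smul_apply',
      Pi.smul_apply, add_apply, smul_apply, smul_eq_mul, Pi.zero_apply] at i1 i2 ⊢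
    linear_combination i1 - i2)
  have hh1 : h1 = 0 := neg_eq_zero.1 h1'
  have hh2 : h2 = 0 := neg_eq_zero.1 h2'
  have hh0 : h0 = 0 := by
    funext x
    have := congrFun h0' x
    simpa using this
  subst hh0 hh1 hh2
  simp only [hz, add_zero, and_self]

end NormalCurvature

/-! ### The secondary form of a normal connection. -/

section SecondaryForm

variable {M : Type*} [TopologicalSpace M] [ChartedSpace (EuclideanSpace ℝ (Fin 3)) M]
  [IsManifold (𝓡 3) ∞ M] {B : BaseForms M}

/-- A value of the matrix of connection forms with vanishing `φ`. -/
noncomputable def connectionValue (a a1 a2 b c1 c2 d : ℂ) : Matrix (Fin 3) (Fin 3) ℂ :=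
  !![-(1 / 3 * b), -c2, -(1 / 4 * d); a1, 2 / 3 * b, 1 / 2 * c1; 2 * a, 2 * a2, -(1 / 3 * b)]

/-- The cubic trace evaluated on three vectors. Each group of seven scalars holds the values of `θ,
θ¹, θ², ω₁¹, φ¹, φ², ψ` on one vector, so the claim is a polynomial identity. -/
theorem trace_cube (a a1 a2 b c1 c2 d a' a1' a2' b' c1' c2' d' e e1 e2 f g1 g2 h : ℂ) :
    (1 / 3 : ℂ) • ∑ i, ∑ j, ∑ k,
      (connectionValue a a1 a2 b c1 c2 d i j *
        (connectionValue a' a1' a2' b' c1' c2' d' j k * connectionValue e e1 e2 f g1 g2 h k i -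
          connectionValue e e1 e2 f g1 g2 h j k * connectionValue a' a1' a2' b' c1' c2' d' k i) -
      connectionValue a' a1' a2' b' c1' c2' d' i j *
        (connectionValue a a1 a2 b c1 c2 d j k * connectionValue e e1 e2 f g1 g2 h k i -
          connectionValue e e1 e2 f g1 g2 h j k * connectionValue a a1 a2 b c1 c2 d k i) +
      connectionValue e e1 e2 f g1 g2 h i j *
        (connectionValue a a1 a2 b c1 c2 d j k * connectionValue a' a1' a2' b' c1' c2' d' k i -
          connectionValue a' a1' a2' b' c1' c2' d' j k * connectionValue a a1 a2 b c1 c2 d k i)) =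
    b * (c2' * e1 - g2 * a1' + (c1' * e2 - g1 * a2')) -
      b' * (c2 * e1 - g2 * a1 + (c1 * e2 - g1 * a2)) +
      f * (c2 * a1' - c2' * a1 + (c1 * a2' - c1' * a2)) -
    (c2 * (c1' * e - g1 * a') - c2' * (c1 * e - g1 * a) + g2 * (c1 * a' - c1' * a)) -
    (1 / 2 : ℂ) • (d * (a2' * e1 - e2 * a1') - d' * (a2 * e1 - e2 * a1) +
      h * (a2 * a1' - a2' * a1)) := by
  have e00 : ∀ a a1 a2 b c1 c2 d, connectionValue a a1 a2 b c1 c2 d 0 0 = -(1 / 3 * b) :=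
    fun _ _ _ _ _ _ _ => rfl
  have e01 : ∀ a a1 a2 b c1 c2 d, connectionValue a a1 a2 b c1 c2 d 0 1 = -c2 :=
    fun _ _ _ _ _ _ _ => rfl
  have e02 : ∀ a a1 a2 b c1 c2 d, connectionValue a a1 a2 b c1 c2 d 0 2 = -(1 / 4 * d) :=
    fun _ _ _ _ _ _ _ => rfl
  have e10 : ∀ a a1 a2 b c1 c2 d, connectionValue a a1 a2 b c1 c2 d 1 0 = a1 :=
    fun _ _ _ _ _ _ _ => rfl
  have e11 : ∀ a a1 a2 b c1 c2 d, connectionValue a a1 a2 b c1 c2 d 1 1 = 2 / 3 * b :=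
    fun _ _ _ _ _ _ _ => rfl
  have e12 : ∀ a a1 a2 b c1 c2 d, connectionValue a a1 a2 b c1 c2 d 1 2 = 1 / 2 * c1 :=
    fun _ _ _ _ _ _ _ => rfl
  have e20 : ∀ a a1 a2 b c1 c2 d, connectionValue a a1 a2 b c1 c2 d 2 0 = 2 * a :=
    fun _ _ _ _ _ _ _ => rfl
  have e21 : ∀ a a1 a2 b c1 c2 d, connectionValue a a1 a2 b c1 c2 d 2 1 = 2 * a2 :=
    fun _ _ _ _ _ _ _ => rfl
  have e22 : ∀ a a1 a2 b c1 c2 d, connectionValue a a1 a2 b c1 c2 d 2 2 = -(1 / 3 * b) :=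
    fun _ _ _ _ _ _ _ => rfl
  simp only [Fin.sum_univ_three, e00, e01, e02, e10, e11, e12, e20, e21, e22, smul_eq_mul]
  ring

/-- The secondary form of a normal connection with vanishing `φ`. -/
theorem TC2_formMatrix {θ θ1 θ2 α φ1 φ2 ψ : Form1 (𝓡 3) M}
    (hK : IsNormalCurvature θ θ1 θ2 (curvature (formMatrix θ θ1 θ2 0 α φ1 φ2 ψ))) :
    TC2 (formMatrix θ θ1 θ2 0 α φ1 φ2 ψ) = (1 / (8 * (Real.pi : ℂ) ^ 2)) •
      (wedge12 α (wedge φ2 θ1 + wedge φ1 θ2) - wedge12 φ2 (wedge φ1 θ) -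
        (1 / 2 : ℂ) • wedge12 ψ (wedge θ2 θ1)) := by
  -- The curvature is strictly upper triangular, so it only meets `θ¹`, `2θ`, `2θ²`; each of these
  -- already divides the curvature entry it is paired with.
  have e1 : ∑ i, ∑ j, wedge12 (formMatrix θ θ1 θ2 0 α φ1 φ2 ψ i j)
      (curvature (formMatrix θ θ1 θ2 0 α φ1 φ2 ψ) j i) = 0 := by
    obtain ⟨Q1, Q2, U1, U2, K⟩ := hK
    rw [K]
    funext x u v w
    simp only [formMatrix, Fin.sum_univ_three, Matrix.of_apply, Matrix.cons_val',
      Matrix.cons_val_zero, Matrix.cons_val_one, Matrix.cons_val, wedge12, wedge, Pi.add_apply,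
      Pi.neg_apply, Pi.smul_apply', Pi.smul_apply, add_apply, smul_apply, smul_eq_mul,
      Pi.zero_apply, mul_zero, sub_zero, add_zero, zero_add]
    ring
  unfold TC2
  rw [e1, zero_add]
  congr 1
  funext x u v w
  have hval : ∀ t i j, formMatrix θ θ1 θ2 0 α φ1 φ2 ψ i j x t =
      connectionValue (θ x t) (θ1 x t) (θ2 x t) (α x t) (φ1 x t) (φ2 x t) (ψ x t) i j := by
    intro t i j
    fin_cases i <;> fin_cases j
    · change (-((1 / 2 : ℂ) • (0 : Form1 (𝓡 3) M)) - (1 / 3 : ℂ) • α) x t = -(1 / 3 * α x t)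
      rw [smul_zero_form, neg_zero, zero_sub]
      rfl
    all_goals first | rfl | skip
    change ((1 / 2 : ℂ) • (0 : Form1 (𝓡 3) M) - (1 / 3 : ℂ) • α) x t = -(1 / 3 * α x t)
    rw [smul_zero_form, zero_sub]
    rfl
  simp only [Pi.smul_apply, Finset.sum_apply, wedge12, wedge, hval, Pi.add_apply, Pi.sub_apply]
  exact trace_cube ..

/-- The coefficient of `R²` is `1/8 - 1/16`: the first part comes from the term `-(R/4)θ` in `ω₁¹`,
the second from `φ² ∧ φ¹ ∧ θ`. -/
theorem LocalData.TC2_matrix {D : LocalData M} (h : B.IsPseudo) (sD : D.IsSmooth)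
    (hD : D.IsDataOf B) : TC2 (D.matrix B) = (1 / (8 * (Real.pi : ℂ) ^ 2)) •
      ((fun x => 1 / 2 * D.G x + 1 / 16 * D.R x ^ 2 - D.τ1_2 x * D.τ2_1 x) •
          wedge12 B.θ (wedge B.θ1 B.θ2) +
        wedge12 B.θ11 (D.E2 • wedge B.θ B.θ1 + D.E1 • wedge B.θ B.θ2 -
            (1 / 2 : ℂ) • D.R • wedge B.θ1 B.θ2)) := by
  rw [LocalData.matrix, TC2_formMatrix (isNormalCurvature h sD hD)]
  congr 1
  funext x u v w
  simp only [LocalData.ω11, LocalData.φ1, LocalData.φ2, LocalData.ψ, hD.τ1_eq, hD.τ2_eq, wedge12,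
    wedge, Pi.add_apply, Pi.sub_apply, Pi.neg_apply, Pi.smul_apply', Pi.smul_apply, add_apply,
    neg_apply, sub_apply, smul_apply, smul_eq_mul]
  ring

end SecondaryForm

/-! ### Functoriality of pullbacks. -/

section Pullback

variable {E : Type*} [NormedAddCommGroup E] [NormedSpace ℝ E] {H : Type*} [TopologicalSpace H]
  {I : ModelWithCorners ℝ E H} {N : Type*} [TopologicalSpace N] [ChartedSpace H N]
  {E' : Type*} [NormedAddCommGroup E'] [NormedSpace ℝ E'] {H' : Type*}
  [TopologicalSpace H'] {I' : ModelWithCorners ℝ E' H'} {N' : Type*} [TopologicalSpace N']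
  [ChartedSpace H' N']
  {E'' : Type*} [NormedAddCommGroup E''] [NormedSpace ℝ E''] {H'' : Type*}
  [TopologicalSpace H''] {I'' : ModelWithCorners ℝ E'' H''} {N'' : Type*} [TopologicalSpace N'']
  [ChartedSpace H'' N'']

theorem pull1_pull1 {f : N → N'} {g : N' → N''} (hf : ContMDiff I I' ∞ f)
    (hg : ContMDiff I' I'' ∞ g) (α : Form1 I'' N'') :
    pull1 (I := I) f (pull1 (I := I') g α) = pull1 (g ∘ f) α := by
  funext x
  ext u
  have h := mfderiv_comp x (hg.mdifferentiable (by simp) (f x)) (hf.mdifferentiable (by simp) x)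
  exact congrArg (α (g (f x))) (DFunLike.congr_fun h u).symm

theorem pull1_id (α : Form1 I N) : pull1 (I := I) id α = α := by
  funext x
  ext u
  have h := DFunLike.congr_fun (mfderiv_id (I := I) (x := x)) u
  exact congrArg (α x) h

theorem pull1_dFun {f : N → N'} (hf : ContMDiff I I' ∞ f) {g : N' → ℂ}
    (hg : ContMDiff I' 𝓘(ℝ, ℂ) ∞ g) : pull1 (I := I) f (dFun I' g) = dFun I (g ∘ f) :=
  pull1_pull1 hf hg idForm

end Pullback

/-! ### The pseudo-flag structure on `X` and along a section. -/

section PseudoForms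

variable {M : Type*} [TopologicalSpace M] [ChartedSpace (EuclideanSpace ℝ (Fin 3)) M]
  [IsManifold (𝓡 3) ∞ M] {F : FlagStructure M} (c : AdaptedCoframe F)

/-- The connection form and the torsion of the pseudo-flag structure exist along the section of `X`
given by the adapted coframe itself. -/
theorem AdaptedCoframe.exists_isPseudo : ∃ (μ : Form1 (𝓡 3) M) (t1 t2 : M → ℂ),
    BaseForms.IsPseudo ⟨c.θ, c.Z1, c.Z2, μ, t1 • c.Z2, t2 • c.Z1⟩ := by
  have hc := c.isCoframe
  obtain ⟨p, q, r, e1, sp, sq, sr⟩ := hc.exists_coeffs_extD c.smooth_θ c.smooth_Z1 c.smooth_Z2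
    c.smooth_Z1
  obtain ⟨q', p', r', e2, sq', sp', sr'⟩ := hc.exists_coeffs_extD c.smooth_θ c.smooth_Z1
    c.smooth_Z2 c.smooth_Z2
  -- `d(Z¹ ∧ Z²) = d(dθ) = 0` is the compatibility that lets one connection form serve both
  -- structure equations.
  have hp : p' = -p := by
    have h := sum_extD_wedge (ι := Unit) (α := c.θ) (β := fun _ => c.Z1) (γ := fun _ => c.Z2)
      c.smooth_θ (fun _ => c.smooth_Z1) (fun _ => c.smooth_Z2) (by simpa using c.d_θ)
    have h2 := hc.coeff3_eq_zero (p := p + p') (by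
      rw [← h]
      funext x u v w
      simp only [Finset.univ_unique, Finset.sum_singleton, e1, e2, wedge12, wedge, Pi.add_apply,
        Pi.sub_apply, Pi.smul_apply', Pi.smul_apply, smul_eq_mul]
      ring)
    exact eq_neg_of_add_eq_zero_right h2
  subst hp
  -- In `dZ¹ = Z¹ ∧ μ + θ ∧ τ¹` the `Z¹` component of `μ` is invisible, and in the equation for
  -- `dZ²` the `Z²` component is. Each equation therefore supplies the component that the other
  -- cannot see.
  refine ⟨-(p • c.θ) + r' • c.Z1 + r • c.Z2, q, q', hc, c.smooth_θ, c.smooth_Z1, c.smooth_Z2,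
    ((SmoothForm.smul sp c.smooth_θ).neg.add (SmoothForm.smul sr' c.smooth_Z1)).add
      (SmoothForm.smul sr c.smooth_Z2), SmoothForm.smul sq c.smooth_Z2,
    SmoothForm.smul sq' c.smooth_Z1, c.d_θ, ?_, ?_, ?_, ?_⟩
  · simp only
    rw [e1]
    funext x u v
    simp only [wedge, Pi.add_apply, Pi.neg_apply, Pi.smul_apply', Pi.smul_apply, add_apply,
      neg_apply, smul_apply, smul_eq_mul]
    ring
  · simp only
    rw [e2]
    funext x u v
    simp only [wedge, Pi.add_apply, Pi.neg_apply, Pi.smul_apply', Pi.smul_apply, add_apply,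
      neg_apply, smul_apply, smul_eq_mul]
    ring
  · funext x u v
    simp only [wedge, Pi.smul_apply', smul_apply, smul_eq_mul, Pi.zero_apply]
    ring
  · funext x u v
    simp only [wedge, Pi.smul_apply', smul_apply, smul_eq_mul, Pi.zero_apply]
    ring

theorem XBundle.contMDiff_proj : ContMDiff IX (𝓡 3) ∞ (XBundle.proj (M := M)) := contMDiff_fst

theorem XBundle.contMDiff_a : ContMDiff IX 𝓘(ℝ, ℂ) ∞ (XBundle.a (M := M)) :=
  Units.contMDiff_val.comp contMDiff_snd

theorem XBundle.a_ne_zero (p : XBundle M) : XBundle.a p ≠ 0 := p.2.ne_zero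

theorem XBundle.contMDiff_a_inv : ContMDiff IX 𝓘(ℝ, ℂ) ∞
    (fun p : XBundle M => (XBundle.a p)⁻¹) := by
  have h : ContMDiff IX 𝓘(ℝ, ℂ) ∞ (fun p : XBundle M => ((p.2⁻¹ : ℂˣ) : ℂ)) :=
    Units.contMDiff_val.comp contMDiff_snd.inv
  simpa [XBundle.a] using h

theorem smoothForm_liftX {α : Form1 (𝓡 3) M} (hα : SmoothForm α) : SmoothForm (liftX α) :=
  hα.pull1 XBundle.contMDiff_proj

theorem extD_liftX {α : Form1 (𝓡 3) M} (hα : SmoothForm α) (p : XBundle M)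
    (u v : TangentSpace IX p) : extD (liftX α) p u v = extD α (XBundle.proj p)
      (mfderiv IX (𝓡 3) XBundle.proj p u) (mfderiv IX (𝓡 3) XBundle.proj p v) :=
  extD_pull1 (XBundle.contMDiff_proj p) (hα _) u v

theorem dFun_inv_apply {E : Type*} [NormedAddCommGroup E] [NormedSpace ℝ E] {H : Type*}
    [TopologicalSpace H] {I : ModelWithCorners ℝ E H} {N : Type*} [TopologicalSpace N]
    [ChartedSpace H N] [I.Boundaryless] [IsManifold I ∞ N] {f g : N → ℂ}
    (hf : ContMDiff I 𝓘(ℝ, ℂ) ∞ f) (hg : ContMDiff I 𝓘(ℝ, ℂ) ∞ g) (h : ∀ x, f x * g x = 1) (x : N)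
    (u : TangentSpace I x) : dFun I g x u = -(g x ^ 2 * dFun I f x u) := by
  have h1 : (fun x => f x * g x) = fun _ => 1 := funext h
  have h2 := dFun_mul_apply hf hg x u
  rw [h1, dFun_const_apply] at h2
  linear_combination -(g x) * h2 - dFun I g x u * h x

variable {c} in
-- The term `da ∧ Z¹` is absorbed into the connection form as `-da/a`, while the torsion is scaled
-- by `a`.
theorem AdaptedCoframe.extD_Xθ1 {μ τ : Form1 (𝓡 3) M}
    (h : extD c.Z1 = wedge c.Z1 μ + wedge c.θ τ) : extD c.Xθ1 =
      wedge c.Xθ1 (liftX μ - (fun p : XBundle M => (XBundle.a p)⁻¹) • dFun IX XBundle.a :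
        Form1 IX (XBundle M)) +
        wedge c.Xθ (XBundle.a (M := M) • liftX τ) := by
  refine (extD_smul XBundle.contMDiff_a (smoothForm_liftX c.smooth_Z1)).trans ?_
  funext p u v
  have hab := mul_inv_cancel₀ (XBundle.a_ne_zero p)
  have e : extD (liftX c.Z1) p u v = wedge (liftX c.Z1) (liftX μ) p u v +
      wedge (liftX c.θ) (liftX τ) p u v := by
    rw [extD_liftX c.smooth_Z1, h]; rfl
  have e1 : ∀ u, c.Xθ1 p u = XBundle.a p * liftX c.Z1 p u := fun _ => rfl
  have e0 : ∀ u, c.Xθ p u = liftX c.θ p u := fun _ => rfl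
  simp only [Pi.add_apply, Pi.smul_apply', Pi.smul_apply, e, wedge, Pi.sub_apply, sub_apply,
    smul_apply, smul_eq_mul, e1, e0]
  linear_combination (dFun IX XBundle.a p v * liftX c.Z1 p u -
    dFun IX XBundle.a p u * liftX c.Z1 p v) * hab

variable {c} in
-- The factor `a⁻¹` and the opposite sign of the connection term compensate, so the same form `μ -
-- da/a` appears as for `θ¹`.
theorem AdaptedCoframe.extD_Xθ2 {μ τ : Form1 (𝓡 3) M}
    (h : extD c.Z2 = -wedge c.Z2 μ + wedge c.θ τ) : extD c.Xθ2 =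
      -wedge c.Xθ2 (liftX μ - (fun p : XBundle M => (XBundle.a p)⁻¹) • dFun IX XBundle.a :
        Form1 IX (XBundle M)) +
        wedge c.Xθ ((fun p : XBundle M => (XBundle.a p)⁻¹) • liftX τ) := by
  refine (extD_smul XBundle.contMDiff_a_inv (smoothForm_liftX c.smooth_Z2)).trans ?_
  funext p u v
  have e : extD (liftX c.Z2) p u v = -wedge (liftX c.Z2) (liftX μ) p u v +
      wedge (liftX c.θ) (liftX τ) p u v := by
    rw [extD_liftX c.smooth_Z2, h]; rfl
  have e1 : ∀ u, c.Xθ2 p u = (XBundle.a p)⁻¹ * liftX c.Z2 p u := fun _ => rfl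
  have e0 : ∀ u, c.Xθ p u = liftX c.θ p u := fun _ => rfl
  have e2 : ∀ u, dFun IX (fun p => (XBundle.a p)⁻¹) p u =
      -((XBundle.a p)⁻¹ ^ 2 * dFun IX XBundle.a p u) := dFun_inv_apply XBundle.contMDiff_a
    XBundle.contMDiff_a_inv (fun q => mul_inv_cancel₀ (XBundle.a_ne_zero q)) p
  simp only [Pi.add_apply, Pi.neg_apply, Pi.smul_apply', Pi.smul_apply, e, wedge, Pi.sub_apply,
    sub_apply, smul_apply, smul_eq_mul, e1, e0, e2]
  ring

/-- A solution is the lift of the connection of `(θ, Z¹, Z²)`, corrected by `-da/a`. Uniqueness is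
not needed: later arguments use only the structure equations. -/
theorem AdaptedCoframe.isPseudoCanonical : c.IsPseudoCanonical c.pseudoForms := by
  refine Classical.epsilon_spec (p := c.IsPseudoCanonical) ?_
  obtain ⟨μ, t1, t2, -, s0, s1, s2, sμ, st1, st2, d0, d1, d2, -, -⟩ := c.exists_isPseudo
  refine ⟨⟨liftX μ - (fun p => (XBundle.a p)⁻¹) • dFun IX XBundle.a, XBundle.a • liftX (t1 • c.Z2),
    (fun p => (XBundle.a p)⁻¹) • liftX (t2 • c.Z1)⟩, (smoothForm_liftX sμ).sub
    (SmoothForm.smul XBundle.contMDiff_a_inv (SmoothForm.dFun XBundle.contMDiff_a)),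
    SmoothForm.smul XBundle.contMDiff_a (smoothForm_liftX st1),
    SmoothForm.smul XBundle.contMDiff_a_inv (smoothForm_liftX st2), extD_Xθ1 d1, extD_Xθ2 d2, ?_,
    ?_⟩
  · funext p u v
    simp only [AdaptedCoframe.Xθ2, liftX, pull1, wedge, Pi.smul_apply', smul_apply, smul_eq_mul,
      ContinuousLinearMap.comp_apply, Pi.zero_apply]
    ring
  · funext p u v
    simp only [AdaptedCoframe.Xθ1, liftX, pull1, wedge, Pi.smul_apply', smul_apply, smul_eq_mul,
      ContinuousLinearMap.comp_apply, Pi.zero_apply]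
    ring

variable {σ : M → XBundle M} (hσ : XBundle.IsSection σ)
include hσ

theorem XBundle.IsSection.pull1_liftX (α : Form1 (𝓡 3) M) : pull1 σ (liftX α) = α := by
  rw [liftX, pull1_pull1 hσ.smooth XBundle.contMDiff_proj,
    show XBundle.proj ∘ σ = id from funext hσ.proj_eq, pull1_id]

theorem AdaptedCoframe.baseForms_θ : (c.baseForms σ).θ = c.θ := hσ.pull1_liftX c.θ

theorem AdaptedCoframe.baseForms_θ1 :
    (c.baseForms σ).θ1 = (fun x => XBundle.a (σ x)) • c.Z1 := by
  have h := hσ.pull1_liftX c.Z1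
  funext x
  have h' := congrFun h x
  ext u
  have h'' := DFunLike.congr_fun h' u
  exact congrArg (XBundle.a (σ x) * ·) h''

theorem AdaptedCoframe.baseForms_θ2 :
    (c.baseForms σ).θ2 = (fun x => (XBundle.a (σ x))⁻¹) • c.Z2 := by
  have h := hσ.pull1_liftX c.Z2
  funext x
  have h' := congrFun h x
  ext u
  have h'' := DFunLike.congr_fun h' u
  exact congrArg ((XBundle.a (σ x))⁻¹ * ·) h''

theorem AdaptedCoframe.baseForms_isPseudo : (c.baseForms σ).IsPseudo := by
  obtain ⟨k1, k2, k3, k4, k5, k6, k7⟩ := c.isPseudoCanonical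
  have sθ1 : SmoothForm c.Xθ1 := SmoothForm.smul XBundle.contMDiff_a (smoothForm_liftX c.smooth_Z1)
  have sθ2 : SmoothForm c.Xθ2 :=
    SmoothForm.smul XBundle.contMDiff_a_inv (smoothForm_liftX c.smooth_Z2)
  refine ⟨?_, SmoothForm.pull1 hσ.smooth (smoothForm_liftX c.smooth_θ), sθ1.pull1 hσ.smooth,
    sθ2.pull1 hσ.smooth, k1.pull1 hσ.smooth, k2.pull1 hσ.smooth, k3.pull1 hσ.smooth, ?_, ?_, ?_, ?_,
    ?_⟩
  · rw [c.baseForms_θ hσ, c.baseForms_θ1 hσ, c.baseForms_θ2 hσ]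
    intro x
    convert c.isCoframe x using 1
    simp only [wedge12, wedge, Pi.smul_apply', smul_apply, smul_eq_mul]
    field_simp [XBundle.a_ne_zero (σ x)]
  · rw [c.baseForms_θ hσ, c.baseForms_θ1 hσ, c.baseForms_θ2 hσ, c.d_θ]
    funext x u v
    simp only [wedge, Pi.smul_apply', smul_apply, smul_eq_mul]
    field_simp [XBundle.a_ne_zero (σ x)]
  · funext x u v
    exact (extD_pull1 (hσ.smooth x) (sθ1 _) u v).trans (congrFun (congrFun (congrFun k4 _) _) _)
  · funext x u v
    exact (extD_pull1 (hσ.smooth x) (sθ2 _) u v).trans (congrFun (congrFun (congrFun k5 _) _) _)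
  · funext x u v
    exact congrFun (congrFun (congrFun k6 _) _) _
  · funext x u v
    exact congrFun (congrFun (congrFun k7 _) _) _

end PseudoForms

/-! ### Gauge transformations of connection matrices. -/

section Gauge

/-- The pointwise algebra of `d + A ↦ h⁻¹(d + A)h`: `A, A'` are the values of the connection on two
vectors, `P, P'` those of `dh`, `Q, Q'` those of `dh⁻¹`, and `F` is the value of `dA`. The scalar
terms are central and drop out of the commutator. -/
theorem gauge_identity {A A' F K H P P' : Matrix (Fin 3) (Fin 3) ℂ}
    {Q Q' : Matrix (Fin 3) (Fin 3) ℂ}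
    (s s' : ℂ) (hHK : H * K = 1) (hQ : Q = -(K * P * K)) (hQ' : Q' = -(K * P' * K)) :
    (Q * A' * H + K * A' * P) - (Q' * A * H + K * A * P') + K * F * H + (Q * P' - Q' * P) +
      ((K * A * H + K * P - s • 1) * (K * A' * H + K * P' - s' • 1) -
        (K * A' * H + K * P' - s' • 1) * (K * A * H + K * P - s • 1)) =
    K * (F + (A * A' - A' * A)) * H := by
  have h1 : ∀ X : Matrix (Fin 3) (Fin 3) ℂ, H * (K * X) = X := fun X => by
    rw [← mul_assoc, hHK, one_mul]
  subst hQ hQ'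
  simp only [sub_mul, mul_sub, add_mul, mul_add, mul_assoc, h1, smul_mul_assoc, mul_smul_comm,
    one_mul, mul_one, neg_mul]
  module

variable {E : Type*} [NormedAddCommGroup E] [NormedSpace ℝ E] {H : Type*} [TopologicalSpace H]
  {I : ModelWithCorners ℝ E H} {N : Type*} [TopologicalSpace N] [ChartedSpace H N]

/-- The matrix of values of a matrix of 1-forms on a tangent vector. -/
noncomputable def formValue (A : Matrix (Fin 3) (Fin 3) (Form1 I N)) (x : N)
    (u : TangentSpace I x) :
    Matrix (Fin 3) (Fin 3) ℂ := Matrix.of fun i j => A i j x u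

variable (I) in
/-- The differential of a matrix valued function. -/
noncomputable def dMatrix (h : Fin 3 → Fin 3 → N → ℂ) (x : N) (u : TangentSpace I x) :
    Matrix (Fin 3) (Fin 3) ℂ := Matrix.of fun i j => dFun I (h i j) x u

/-- The gauge transformation `k A h + k dh - c`. -/
noncomputable def gaugeTransform (A : Matrix (Fin 3) (Fin 3) (Form1 I N))
    (k h : Fin 3 → Fin 3 → N → ℂ) (c : Form1 I N) : Matrix (Fin 3) (Fin 3) (Form1 I N) :=
  Matrix.of fun i j => ∑ m, ∑ l, (fun x => k i l x * h m j x) • A l m +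
    ∑ l, k i l • dFun I (h l j) - (if i = j then (1 : ℂ) else 0) • c

theorem formValue_gaugeTransform (A : Matrix (Fin 3) (Fin 3) (Form1 I N))
    (k h : Fin 3 → Fin 3 → N → ℂ) (c : Form1 I N) (x : N) (u : TangentSpace I x) :
    formValue (gaugeTransform A k h c) x u =
      (Matrix.of fun i j => k i j x) * formValue A x u * (Matrix.of fun i j => h i j x) +
        (Matrix.of fun i j => k i j x) * dMatrix I h x u - c x u • 1 := by
  ext i j
  simp only [formValue, gaugeTransform, dMatrix, Matrix.of_apply, Matrix.add_apply,
    Matrix.sub_apply, Matrix.smul_apply, Matrix.mul_apply, Matrix.one_apply, Pi.sub_apply,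
    Pi.add_apply, Finset.sum_apply, Pi.smul_apply', Pi.smul_apply, sub_apply, add_apply, sum_apply,
    smul_apply, smul_eq_mul, Finset.sum_mul]
  congr 1
  · congr 1
    refine Finset.sum_congr rfl fun m _ => Finset.sum_congr rfl fun l _ => ?_
    ring
  · ring

theorem curvature_formValue (A : Matrix (Fin 3) (Fin 3) (Form1 I N)) (x : N)
    (u v : TangentSpace I x) : (Matrix.of fun i j => curvature A i j x u v) =
      (Matrix.of fun i j => extD (A i j) x u v) +
        (formValue A x u * formValue A x v - formValue A x v * formValue A x u) := by
  ext i j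
  simp only [curvature, wedge, formValue, Matrix.of_apply, Matrix.add_apply, Matrix.sub_apply,
    Matrix.mul_apply, Pi.add_apply, Finset.sum_apply, ← Finset.sum_sub_distrib]

variable [I.Boundaryless] [IsManifold I ∞ N]

/-- Differentiate `k h = 1` entrywise and multiply by `k` on the right. -/
theorem dMatrix_inverse {k h : Fin 3 → Fin 3 → N → ℂ}
    (sk : ∀ i j, ContMDiff I 𝓘(ℝ, ℂ) ∞ (k i j)) (sh : ∀ i j, ContMDiff I 𝓘(ℝ, ℂ) ∞ (h i j))
    (hkh : ∀ x, (Matrix.of fun i j => k i j x) * (Matrix.of fun i j => h i j x) = 1) (x : N)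
    (u : TangentSpace I x) : dMatrix I k x u =
      -((Matrix.of fun i j => k i j x) * dMatrix I h x u * (Matrix.of fun i j => k i j x)) := by
  have key : dMatrix I k x u * (Matrix.of fun i j => h i j x) +
      (Matrix.of fun i j => k i j x) * dMatrix I h x u = 0 := by
    ext i j
    have e : (fun x => k i 0 x * h 0 j x + k i 1 x * h 1 j x + k i 2 x * h 2 j x) =
        fun _ => (1 : Matrix (Fin 3) (Fin 3) ℂ) i j := by
      funext z
      rw [← hkh z]
      simp [Matrix.mul_apply, Fin.sum_univ_three]
    have s0 := contMDiff_fun_mul (sk i 0) (sh 0 j)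
    have s1 := contMDiff_fun_mul (sk i 1) (sh 1 j)
    have s2 := contMDiff_fun_mul (sk i 2) (sh 2 j)
    have d := dFun_add_apply (f := fun x => k i 0 x * h 0 j x + k i 1 x * h 1 j x)
      (s0.add s1) s2 x u
    rw [e, dFun_const_apply, dFun_add_apply s0 s1, dFun_mul_apply (sk i 0) (sh 0 j),
      dFun_mul_apply (sk i 1) (sh 1 j), dFun_mul_apply (sk i 2) (sh 2 j)] at d
    simp only [dMatrix, Matrix.add_apply, Matrix.mul_apply, Fin.sum_univ_three, Matrix.of_apply,
      Matrix.zero_apply]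
    linear_combination -d
  have hhk := mul_eq_one_comm.1 (hkh x)
  have h2 := congrArg (· * (Matrix.of fun i j => k i j x)) key
  simp only [add_mul, zero_mul] at h2
  rw [mul_assoc, hhk, mul_one] at h2
  exact eq_neg_of_add_eq_zero_left h2

theorem extD_gaugeTransform {A : Matrix (Fin 3) (Fin 3) (Form1 I N)}
    (sA : ∀ i j, SmoothForm (A i j)) {k h : Fin 3 → Fin 3 → N → ℂ}
    (sk : ∀ i j, ContMDiff I 𝓘(ℝ, ℂ) ∞ (k i j)) (sh : ∀ i j, ContMDiff I 𝓘(ℝ, ℂ) ∞ (h i j))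
    {c : Form1 I N} (sc : SmoothForm c) (dc : extD c = 0) (i j : Fin 3) :
    extD (gaugeTransform A k h c i j) =
      ∑ m, ∑ l, (wedge (dFun I (fun x => k i l x * h m j x)) (A l m) +
        (fun x => k i l x * h m j x) • extD (A l m)) +
      ∑ l, wedge (dFun I (k i l)) (dFun I (h l j)) := by
  have s1 : ∀ l m, SmoothForm ((fun x => k i l x * h m j x) • A l m) := fun l m =>
    SmoothForm.smul (contMDiff_fun_mul (sk i l) (sh m j)) (sA l m)
  have s2 : ∀ l, SmoothForm (k i l • dFun I (h l j)) := fun l =>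
    SmoothForm.smul (sk i l) (SmoothForm.dFun (sh l j))
  have s3 : ∀ m, SmoothForm (∑ l, (fun x => k i l x * h m j x) • A l m) := fun m =>
    SmoothForm.sum _ fun l => s1 l m
  simp only [gaugeTransform, Matrix.of_apply]
  rw [extD_sub ((SmoothForm.sum _ s3).add (SmoothForm.sum _ s2)) (sc.const_smul _),
    extD_const_smul _ sc, dc, smul_zero, sub_zero,
    extD_add (SmoothForm.sum _ s3) (SmoothForm.sum _ s2), extD_sum _ s3, extD_sum _ s2]
  congr 1
  · refine Finset.sum_congr rfl fun m _ => ?_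
    rw [extD_sum _ fun l => s1 l m]
    refine Finset.sum_congr rfl fun l _ => ?_
    rw [extD_smul (contMDiff_fun_mul (sk i l) (sh m j)) (sA l m)]
  · refine Finset.sum_congr rfl fun l _ => ?_
    rw [extD_smul (sk i l) (SmoothForm.dFun (sh l j)), extD_dFun (sh l j), smul_zero, add_zero]

/-- The curvature of a gauge transform is the conjugate of the curvature. -/
theorem curvature_gaugeTransform {A : Matrix (Fin 3) (Fin 3) (Form1 I N)}
    (sA : ∀ i j, SmoothForm (A i j)) {k h : Fin 3 → Fin 3 → N → ℂ}
    (sk : ∀ i j, ContMDiff I 𝓘(ℝ, ℂ) ∞ (k i j)) (sh : ∀ i j, ContMDiff I 𝓘(ℝ, ℂ) ∞ (h i j))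
    (hkh : ∀ x, (Matrix.of fun i j => k i j x) * (Matrix.of fun i j => h i j x) = 1)
    {c : Form1 I N} (sc : SmoothForm c) (dc : extD c = 0) (x : N) (u v : TangentSpace I x) :
    (Matrix.of fun i j => curvature (gaugeTransform A k h c) i j x u v) =
      (Matrix.of fun i j => k i j x) * (Matrix.of fun i j => curvature A i j x u v) *
        (Matrix.of fun i j => h i j x) := by
  rw [curvature_formValue, curvature_formValue A, formValue_gaugeTransform,
    formValue_gaugeTransform, ← gauge_identity (c x u) (c x v) (mul_eq_one_comm.1 (hkh x))
      (dMatrix_inverse sk sh hkh x u) (dMatrix_inverse sk sh hkh x v)]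
  congr 1
  ext i j
  simp only [Matrix.of_apply, extD_gaugeTransform sA sk sh sc dc, Matrix.add_apply,
    Matrix.sub_apply, Matrix.mul_apply, dMatrix, formValue, Fin.sum_univ_three, Pi.add_apply, wedge,
    Pi.smul_apply', Pi.smul_apply, smul_eq_mul, dFun_mul_apply (sk _ _) (sh _ _)]
  ring

end Gauge

/-! ### Naturality of curvature and of the secondary form. -/

section PullbackCurvature

variable {E : Type*} [NormedAddCommGroup E] [NormedSpace ℝ E] {H : Type*} [TopologicalSpace H]
  {I : ModelWithCorners ℝ E H} {N : Type*} [TopologicalSpace N] [ChartedSpace H N]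
  {E' : Type*} [NormedAddCommGroup E'] [NormedSpace ℝ E'] {H' : Type*}
  [TopologicalSpace H'] {I' : ModelWithCorners ℝ E' H'} {N' : Type*} [TopologicalSpace N']
  [ChartedSpace H' N'] [I.Boundaryless] [IsManifold I ∞ N] [I'.Boundaryless] [IsManifold I' ∞ N']

/-- The curvature commutes with pullbacks. -/
theorem curvature_pull1 {f : N → N'} (hf : ContMDiff I I' ∞ f)
    {π : Matrix (Fin 3) (Fin 3) (Form1 I' N')} (hπ : ∀ i j, SmoothForm (π i j)) (i j : Fin 3)
    (x : N) (u v : TangentSpace I x) :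
    curvature (Matrix.of fun i j => pull1 (I := I) f (π i j)) i j x u v =
      curvature π i j (f x) (mfderiv I I' f x u) (mfderiv I I' f x v) := by
  simp only [curvature, Pi.add_apply, Finset.sum_apply, Matrix.of_apply]
  rw [extD_pull1 (hf x) (hπ i j _)]
  rfl

/-- The secondary form commutes with pullbacks. -/
theorem TC2_pull1 {f : N → N'} (hf : ContMDiff I I' ∞ f)
    {π : Matrix (Fin 3) (Fin 3) (Form1 I' N')} (hπ : ∀ i j, SmoothForm (π i j)) :
    TC2 (Matrix.of fun i j => pull1 (I := I) f (π i j)) = pull3 f (TC2 π) := by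
  funext x u v w
  simp only [TC2, pull3, Pi.smul_apply, Pi.add_apply, Finset.sum_apply, wedge12,
    curvature_pull1 hf hπ]
  rfl

/-- Logarithmic derivatives are closed. -/
theorem extD_logDeriv {f g : N → ℂ} (hf : ContMDiff I 𝓘(ℝ, ℂ) ∞ f)
    (hg : ContMDiff I 𝓘(ℝ, ℂ) ∞ g) (h : ∀ x, f x * g x = 1) : extD (g • dFun I f) = 0 := by
  rw [extD_smul hg (SmoothForm.dFun hf), extD_dFun hf]
  funext x u v
  simp only [wedge, Pi.add_apply, Pi.smul_apply', Pi.zero_apply, dFun_inv_apply hf hg h, smul_zero]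
  ring

end PullbackCurvature

/-! ### Coordinates on `Y` and the gauge function. -/

section CoframeBundle

variable {M : Type*} [TopologicalSpace M] [ChartedSpace (EuclideanSpace ℝ (Fin 3)) M]
  [IsManifold (𝓡 3) ∞ M] {F : FlagStructure M} (c : AdaptedCoframe F)

namespace YBundle

theorem contMDiff_proj : ContMDiff IY (𝓡 3) ∞ (proj (M := M)) := contMDiff_fst

theorem contMDiff_a1 : ContMDiff IY 𝓘(ℝ, ℂ) ∞ (a1 (M := M)) :=
  Units.contMDiff_val.comp (contMDiff_fst.comp contMDiff_snd)

theorem contMDiff_a2 : ContMDiff IY 𝓘(ℝ, ℂ) ∞ (a2 (M := M)) :=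
  Units.contMDiff_val.comp (contMDiff_fst.comp (contMDiff_snd.comp contMDiff_snd))

/-- The function `1 / a¹` on `Y`. -/
noncomputable def b1 (y : YBundle M) : ℂ := ((y.2.1⁻¹ : ℂˣ) : ℂ)

/-- The function `1 / a²` on `Y`. -/
noncomputable def b2 (y : YBundle M) : ℂ := ((y.2.2.1⁻¹ : ℂˣ) : ℂ)

theorem contMDiff_b1 : ContMDiff IY 𝓘(ℝ, ℂ) ∞ (b1 (M := M)) :=
  Units.contMDiff_val.comp (contMDiff_fst.comp contMDiff_snd).inv

theorem contMDiff_b2 : ContMDiff IY 𝓘(ℝ, ℂ) ∞ (b2 (M := M)) :=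
  Units.contMDiff_val.comp (contMDiff_fst.comp (contMDiff_snd.comp contMDiff_snd)).inv

theorem a1_mul_b1 (y : YBundle M) : a1 y * b1 y = 1 := y.2.1.mul_inv

theorem a2_mul_b2 (y : YBundle M) : a2 y * b2 y = 1 := y.2.2.1.mul_inv

theorem contMDiff_v1 : ContMDiff IY 𝓘(ℝ, ℂ) ∞ (v1 (M := M)) :=
  contMDiff_fst.comp (contMDiff_snd.comp (contMDiff_snd.comp contMDiff_snd))

theorem contMDiff_v2 : ContMDiff IY 𝓘(ℝ, ℂ) ∞ (v2 (M := M)) :=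
  contMDiff_fst.comp (contMDiff_snd.comp (contMDiff_snd.comp (contMDiff_snd.comp contMDiff_snd)))

theorem contMDiff_t : ContMDiff IY 𝓘(ℝ, ℂ) ∞ (t (M := M)) :=
  contMDiff_snd.comp (contMDiff_snd.comp (contMDiff_snd.comp (contMDiff_snd.comp contMDiff_snd)))

theorem contMDiff_lam : ContMDiff IY 𝓘(ℝ, ℂ) ∞ (lam (M := M)) :=
  contMDiff_fun_mul contMDiff_a1 contMDiff_a2

theorem inv_lam (y : YBundle M) : (lam y)⁻¹ = b1 y * b2 y := by
  refine inv_eq_of_mul_eq_one_right ?_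
  unfold lam
  linear_combination (b2 y * a2 y) * a1_mul_b1 y + a2_mul_b2 y

theorem contMDiff_inv_lam : ContMDiff IY 𝓘(ℝ, ℂ) ∞ (fun y : YBundle M => (lam y)⁻¹) := by
  simp only [inv_lam]
  exact contMDiff_fun_mul contMDiff_b1 contMDiff_b2

end YBundle

open YBundle

theorem smoothForm_liftY {α : Form1 (𝓡 3) M} (hα : SmoothForm α) : SmoothForm (liftY α) :=
  hα.pull1 YBundle.contMDiff_proj

namespace AdaptedCoframe

theorem smooth_ω : SmoothForm c.ω := SmoothForm.smul contMDiff_lam (smoothForm_liftY c.smooth_θ)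

theorem smooth_ω1 : SmoothForm c.ω1 :=
  (SmoothForm.smul contMDiff_a1 (smoothForm_liftY c.smooth_Z1)).add
    (SmoothForm.smul (contMDiff_fun_mul contMDiff_v1 contMDiff_lam) (smoothForm_liftY c.smooth_θ))

theorem smooth_ω2 : SmoothForm c.ω2 :=
  (SmoothForm.smul contMDiff_a2 (smoothForm_liftY c.smooth_Z2)).add
    (SmoothForm.smul (contMDiff_fun_mul contMDiff_v2 contMDiff_lam) (smoothForm_liftY c.smooth_θ))

theorem smooth_φ : SmoothForm c.φ :=
  (((SmoothForm.smul contMDiff_inv_lam (SmoothForm.dFun contMDiff_lam)).neg.add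
    (SmoothForm.smul (contMDiff_fun_mul contMDiff_a1 contMDiff_v2)
      (smoothForm_liftY c.smooth_Z1))).sub
    (SmoothForm.smul (contMDiff_fun_mul contMDiff_a2 contMDiff_v1)
      (smoothForm_liftY c.smooth_Z2))).add
    (SmoothForm.smul contMDiff_t (smoothForm_liftY c.smooth_θ))

end AdaptedCoframe

/-- The structure group valued function on `Y` whose gauge transformation gives the canonical
connection. -/
noncomputable def frameFun (i j : Fin 3) (y : YBundle M) : ℂ :=
  (!![a1 y, a1 y * v2 y, a1 y * (1 / 4 * (t y * (b1 y * b2 y)) + -1 / 4 * (v1 y * v2 y));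
     0, 1, -1 / 2 * v1 y; 0, 0, b2 y] : Matrix (Fin 3) (Fin 3) ℂ) i j

/-- The inverse of `frameFun`. -/
noncomputable def frameInv (i j : Fin 3) (y : YBundle M) : ℂ :=
  (!![b1 y, -1 * v2 y, (-1 / 4 * (t y * (b1 y * b2 y)) + -1 / 4 * (v1 y * v2 y)) * a2 y;
     0, 1, 1 / 2 * (v1 y * a2 y); 0, 0, a2 y] : Matrix (Fin 3) (Fin 3) ℂ) i j

theorem contMDiff_frameFun (i j : Fin 3) : ContMDiff IY 𝓘(ℝ, ℂ) ∞ (frameFun (M := M) i j) := by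
  have h := contMDiff_fun_mul (contMDiff_t (M := M)) (contMDiff_fun_mul contMDiff_b1 contMDiff_b2)
  have h' := contMDiff_fun_mul (contMDiff_v1 (M := M)) contMDiff_v2
  fin_cases i <;> fin_cases j
  exacts [contMDiff_a1, contMDiff_fun_mul contMDiff_a1 contMDiff_v2, contMDiff_fun_mul contMDiff_a1
    ((contMDiff_fun_const_mul _ h).add (contMDiff_fun_const_mul _ h')), contMDiff_const,
    contMDiff_const, contMDiff_fun_const_mul _ contMDiff_v1, contMDiff_const, contMDiff_const,
    contMDiff_b2]

theorem contMDiff_frameInv (i j : Fin 3) : ContMDiff IY 𝓘(ℝ, ℂ) ∞ (frameInv (M := M) i j) := by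
  have h := contMDiff_fun_mul (contMDiff_t (M := M)) (contMDiff_fun_mul contMDiff_b1 contMDiff_b2)
  have h' := contMDiff_fun_mul (contMDiff_v1 (M := M)) contMDiff_v2
  fin_cases i <;> fin_cases j
  exacts [contMDiff_b1, contMDiff_fun_const_mul _ contMDiff_v2, contMDiff_fun_mul
    ((contMDiff_fun_const_mul _ h).add (contMDiff_fun_const_mul _ h')) contMDiff_a2,
    contMDiff_const, contMDiff_const,
    contMDiff_fun_const_mul _ (contMDiff_fun_mul contMDiff_v1 contMDiff_a2), contMDiff_const,
    contMDiff_const, contMDiff_a2]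

theorem frameFun_apply (y : YBundle M) :
    frameFun 0 0 y = a1 y ∧
    frameFun 0 1 y = a1 y * v2 y ∧
    frameFun 0 2 y = a1 y * (1 / 4 * (t y * (b1 y * b2 y)) + -1 / 4 * (v1 y * v2 y)) ∧
    frameFun 1 0 y = 0 ∧
    frameFun 1 1 y = 1 ∧
    frameFun 1 2 y = -1 / 2 * v1 y ∧
    frameFun 2 0 y = 0 ∧
    frameFun 2 1 y = 0 ∧
    frameFun 2 2 y = b2 y :=
  ⟨rfl, rfl, rfl, rfl, rfl, rfl, rfl, rfl, rfl⟩

theorem frameInv_apply (y : YBundle M) :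
    frameInv 0 0 y = b1 y ∧
    frameInv 0 1 y = -1 * v2 y ∧
    frameInv 0 2 y = (-1 / 4 * (t y * (b1 y * b2 y)) + -1 / 4 * (v1 y * v2 y)) * a2 y ∧
    frameInv 1 0 y = 0 ∧
    frameInv 1 1 y = 1 ∧
    frameInv 1 2 y = 1 / 2 * (v1 y * a2 y) ∧
    frameInv 2 0 y = 0 ∧
    frameInv 2 1 y = 0 ∧
    frameInv 2 2 y = a2 y :=
  ⟨rfl, rfl, rfl, rfl, rfl, rfl, rfl, rfl, rfl⟩

theorem frameInv_mul_frameFun (y : YBundle M) : (Matrix.of fun i j => frameInv i j y) *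
    (Matrix.of fun i j => frameFun i j y) = 1 := by
  have h1 := a1_mul_b1 y
  have h2 := a2_mul_b2 y
  obtain ⟨h00, h01, h02, h10, h11, h12, h20, h21, h22⟩ := frameFun_apply y
  obtain ⟨k00, k01, k02, k10, k11, k12, k20, k21, k22⟩ := frameInv_apply y
  refine Matrix.ext fun i j => ?_
  rw [Matrix.mul_apply, Fin.sum_univ_three, Matrix.one_apply]
  simp only [Matrix.of_apply]
  fin_cases i <;> fin_cases j <;> simp only [Fin.zero_eta, Fin.mk_one, Fin.reduceFinMk,
    Fin.reduceEq, if_true, if_false, h00, h01, h02, h10, h11, h12, h20, h21, h22, k00, k01, k02,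
    k10, k11, k12, k20, k21, k22]
  · linear_combination h1
  · linear_combination v2 y * h1
  · linear_combination (1 / 4 * (t y * (b1 y * b2 y)) + -1 / 4 * (v1 y * v2 y)) * h1 +
      (-1 / 4 * (t y * (b1 y * b2 y)) + -1 / 4 * (v1 y * v2 y)) * h2
  · ring
  · ring
  · linear_combination 1 / 2 * v1 y * h2
  · ring
  · ring
  · linear_combination h2

end CoframeBundle

/-! ### Existence of the canonical connection on `Y`. -/

section CanonicalConnection

open YBundle

variable {M : Type*} [TopologicalSpace M] [ChartedSpace (EuclideanSpace ℝ (Fin 3)) M]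
  [IsManifold (𝓡 3) ∞ M]

/-- One third of the logarithmic derivative of `a¹ / a²`. -/
noncomputable def traceForm : Form1 IY (YBundle M) :=
  (1 / 3 : ℂ) • (b1 (M := M) • dFun IY (a1 (M := M)) - b2 (M := M) • dFun IY (a2 (M := M)))

theorem smooth_traceForm : SmoothForm (traceForm (M := M)) :=
  ((SmoothForm.smul contMDiff_b1 (SmoothForm.dFun contMDiff_a1)).sub
    (SmoothForm.smul contMDiff_b2 (SmoothForm.dFun contMDiff_a2))).const_smul _

theorem extD_traceForm : extD (traceForm (M := M)) = 0 := by
  have s1 := SmoothForm.smul (contMDiff_b1 (M := M)) (SmoothForm.dFun contMDiff_a1)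
  have s2 := SmoothForm.smul (contMDiff_b2 (M := M)) (SmoothForm.dFun contMDiff_a2)
  rw [traceForm, extD_const_smul _ (s1.sub s2), extD_sub s1 s2,
    extD_logDeriv contMDiff_a1 contMDiff_b1 a1_mul_b1,
    extD_logDeriv contMDiff_a2 contMDiff_b2 a2_mul_b2, sub_zero, smul_zero]

/-- The connection matrix on `Y` obtained from a matrix of forms on `M`. -/
noncomputable def liftedConnection (A : Matrix (Fin 3) (Fin 3) (Form1 (𝓡 3) M)) :
    Matrix (Fin 3) (Fin 3) (Form1 IY (YBundle M)) :=
  gaugeTransform (Matrix.of fun i j => liftY (A i j)) frameInv frameFun traceForm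

theorem liftedConnection_apply (A : Matrix (Fin 3) (Fin 3) (Form1 (𝓡 3) M)) (i j : Fin 3)
    (y : YBundle M) (u : TangentSpace IY y) : liftedConnection A i j y u =
      ∑ m, (∑ l, frameInv i l y * liftY (A l m) y u) * frameFun m j y +
        ∑ l, frameInv i l y * dFun IY (frameFun l j) y u -
        traceForm y u * (1 : Matrix (Fin 3) (Fin 3) ℂ) i j := by
  have h := congrFun (congrFun (formValue_gaugeTransform
    (Matrix.of fun i j => liftY (A i j)) frameInv frameFun traceForm y u) i) j
  simpa only [liftedConnection, Matrix.sub_apply, Matrix.add_apply, Matrix.mul_apply,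
    Matrix.smul_apply,
    Matrix.of_apply, formValue, dMatrix, smul_eq_mul] using h

theorem smooth_liftedConnection {A : Matrix (Fin 3) (Fin 3) (Form1 (𝓡 3) M)}
    (sA : ∀ i j, SmoothForm (A i j)) (i j : Fin 3) : SmoothForm (liftedConnection A i j) :=
  ((SmoothForm.sum _ fun m => SmoothForm.sum _ fun l =>
    SmoothForm.smul (contMDiff_fun_mul (contMDiff_frameInv i l) (contMDiff_frameFun m j))
      (smoothForm_liftY (sA l m))).add (SmoothForm.sum _ fun l =>
    SmoothForm.smul (contMDiff_frameInv i l) (SmoothForm.dFun (contMDiff_frameFun l j)))).sub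
    (smooth_traceForm.const_smul _)

theorem curvature_liftedConnection {A : Matrix (Fin 3) (Fin 3) (Form1 (𝓡 3) M)}
    (sA : ∀ i j, SmoothForm (A i j)) (i j : Fin 3) (y : YBundle M) (u v : TangentSpace IY y) :
    curvature (liftedConnection A) i j y u v = ∑ m, (∑ l, frameInv i l y *
      curvature A l m (proj y) (mfderiv IY (𝓡 3) proj y u) (mfderiv IY (𝓡 3) proj y v)) *
        frameFun m j y := by
  have h := congrFun (congrFun (curvature_gaugeTransform
    (A := Matrix.of fun i j => liftY (A i j)) (fun i j => smoothForm_liftY (sA i j))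
    contMDiff_frameInv contMDiff_frameFun frameInv_mul_frameFun smooth_traceForm extD_traceForm
    y u v) i) j
  simpa only [liftedConnection, Matrix.mul_apply, Matrix.of_apply, liftY, curvature_pull1
    contMDiff_proj sA] using h

variable {F : FlagStructure M} (c : AdaptedCoframe F)

/-- The connection forms read off from a connection matrix. -/
noncomputable def formsOfMatrix (A : Matrix (Fin 3) (Fin 3) (Form1 IY (YBundle M))) :
    ConnectionForms M :=
  ⟨(3 / 2 : ℂ) • A 1 1, (2 : ℂ) • A 1 2, -A 0 1, (-4 : ℂ) • A 0 2⟩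

section Entries

variable (α φ1 φ2 ψ : Form1 (𝓡 3) M) (y : YBundle M) (u : TangentSpace IY y)

/-- The gauge function is chosen so that the entries below the diagonal become the tautological
forms; its last column produces the `t` and `v` terms of `φ`. Its determinant is `a¹/a²`, and
subtracting `traceForm` restores trace zero, so the diagonal is determined by `φ` and the middle
entry. -/
theorem liftedConnection_entries :
    liftedConnection (formMatrix c.θ c.Z1 c.Z2 0 α φ1 φ2 ψ) 1 0 y u = c.ω1 y u ∧
    liftedConnection (formMatrix c.θ c.Z1 c.Z2 0 α φ1 φ2 ψ) 2 0 y u = 2 * c.ω y u ∧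
    liftedConnection (formMatrix c.θ c.Z1 c.Z2 0 α φ1 φ2 ψ) 2 1 y u = 2 * c.ω2 y u ∧
    liftedConnection (formMatrix c.θ c.Z1 c.Z2 0 α φ1 φ2 ψ) 0 0 y u = -(1 / 2 * c.φ y u) -
      1 / 2 * liftedConnection (formMatrix c.θ c.Z1 c.Z2 0 α φ1 φ2 ψ) 1 1 y u ∧
    liftedConnection (formMatrix c.θ c.Z1 c.Z2 0 α φ1 φ2 ψ) 2 2 y u = 1 / 2 * c.φ y u -
      1 / 2 * liftedConnection (formMatrix c.θ c.Z1 c.Z2 0 α φ1 φ2 ψ) 1 1 y u := by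
  have g1 := a1_mul_b1 y
  have g2 := a2_mul_b2 y
  obtain ⟨h00, h01, h02, h10, h11, h12, h20, h21, h22⟩ := frameFun_apply y
  obtain ⟨k00, k01, k02, k10, k11, k12, k20, k21, k22⟩ := frameInv_apply y
  have A00 : liftY (formMatrix c.θ c.Z1 c.Z2 0 α φ1 φ2 ψ 0 0) y u = -(1 / 3) * liftY α y u := by
    change liftY (-((1 / 2 : ℂ) • (0 : Form1 (𝓡 3) M)) - (1 / 3 : ℂ) • α) y u = _
    rw [smul_zero_form, neg_zero, zero_sub, neg_mul]; rfl
  have A22 : liftY (formMatrix c.θ c.Z1 c.Z2 0 α φ1 φ2 ψ 2 2) y u = -(1 / 3) * liftY α y u := by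
    change liftY ((1 / 2 : ℂ) • (0 : Form1 (𝓡 3) M) - (1 / 3 : ℂ) • α) y u = _
    rw [smul_zero_form, zero_sub, neg_mul]; rfl
  have A11 : liftY (formMatrix c.θ c.Z1 c.Z2 0 α φ1 φ2 ψ 1 1) y u = 2 / 3 * liftY α y u := rfl
  have A10 : liftY (formMatrix c.θ c.Z1 c.Z2 0 α φ1 φ2 ψ 1 0) y u = liftY c.Z1 y u := rfl
  have A20 : liftY (formMatrix c.θ c.Z1 c.Z2 0 α φ1 φ2 ψ 2 0) y u = 2 * liftY c.θ y u := rfl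
  have A21 : liftY (formMatrix c.θ c.Z1 c.Z2 0 α φ1 φ2 ψ 2 1) y u = 2 * liftY c.Z2 y u := rfl
  have d00 : dFun IY (frameFun 0 0) y u = dFun IY a1 y u := rfl
  have d10 : dFun IY (frameFun 1 0) y u = 0 := dFun_const_apply (I := IY) 0 y u
  have d20 : dFun IY (frameFun 2 0) y u = 0 := dFun_const_apply (I := IY) 0 y u
  have d11 : dFun IY (frameFun 1 1) y u = 0 := dFun_const_apply (I := IY) 1 y u
  have d21 : dFun IY (frameFun 2 1) y u = 0 := dFun_const_apply (I := IY) 0 y u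
  have d22 : dFun IY (frameFun 2 2) y u = -(b2 y ^ 2 * dFun IY a2 y u) :=
    dFun_inv_apply contMDiff_a2 contMDiff_b2 a2_mul_b2 y u
  have e0 : c.ω y u = a1 y * a2 y * liftY c.θ y u := rfl
  have e1 : c.ω1 y u = a1 y * liftY c.Z1 y u + v1 y * (a1 y * a2 y) * liftY c.θ y u := rfl
  have e2 : c.ω2 y u = a2 y * liftY c.Z2 y u + v2 y * (a1 y * a2 y) * liftY c.θ y u := rfl
  have e3 : c.φ y u = -((lam y)⁻¹ * dFun IY lam y u) + a1 y * v2 y * liftY c.Z1 y u -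
      a2 y * v1 y * liftY c.Z2 y u + t y * liftY c.θ y u := rfl
  have e4 : dFun IY lam y u = a1 y * dFun IY a2 y u + a2 y * dFun IY a1 y u :=
    dFun_mul_apply contMDiff_a1 contMDiff_a2 y u
  have e5 : traceForm y u = 1 / 3 * (b1 y * dFun IY a1 y u - b2 y * dFun IY a2 y u) := rfl
  have o00 : (1 : Matrix (Fin 3) (Fin 3) ℂ) 0 0 = 1 := rfl
  have o10 : (1 : Matrix (Fin 3) (Fin 3) ℂ) 1 0 = 0 := rfl
  have o20 : (1 : Matrix (Fin 3) (Fin 3) ℂ) 2 0 = 0 := rfl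
  have o21 : (1 : Matrix (Fin 3) (Fin 3) ℂ) 2 1 = 0 := rfl
  have o11 : (1 : Matrix (Fin 3) (Fin 3) ℂ) 1 1 = 1 := rfl
  have o22 : (1 : Matrix (Fin 3) (Fin 3) ℂ) 2 2 = 1 := rfl
  rw [e4, inv_lam] at e3
  simp only [liftedConnection_apply, Fin.sum_univ_three, A00, A22, A11, A10, A20, A21, d00, d10,
    d20, d11, d21, d22, h00, h01, h02, h10, h11, h12, h20, h21, h22, k00, k01, k02, k10, k11, k12,
    k20, k21, k22, e0, e1, e2, e3, e5, o00, o10, o20, o21, o11, o22]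
  generalize liftY (formMatrix c.θ c.Z1 c.Z2 0 α φ1 φ2 ψ 0 1) y u = X01
  generalize liftY (formMatrix c.θ c.Z1 c.Z2 0 α φ1 φ2 ψ 1 2) y u = X12
  generalize liftY (formMatrix c.θ c.Z1 c.Z2 0 α φ1 φ2 ψ 0 2) y u = X02
  generalize liftY c.θ y u = θ at *
  generalize liftY c.Z1 y u = Z1 at *
  generalize liftY c.Z2 y u = Z2 at *
  generalize liftY α y u = α at *
  generalize dFun IY a1 y u = da1 at *
  generalize dFun IY a2 y u = da2 at *
  generalize a1 y = p1 at *
  generalize a2 y = p2 at *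
  generalize b1 y = q1 at *
  generalize b2 y = q2 at *
  generalize v1 y = w1 at *
  generalize v2 y = w2 at *
  generalize t y = t at *
  clear h00 h01 h02 h10 h11 h12 h20 h21 h22 k00 k01 k02 k10 k11 k12 k20 k21 k22 A00 A22 A11 A10
    A20 A21 d00 d10 d20 d11 d21 d22 e0 e1 e2 e3 e4 e5 o00 o10 o20 o21 o11 o22
  obtain rfl : q1 = p1⁻¹ := eq_inv_of_mul_eq_one_right g1
  obtain rfl : q2 = p2⁻¹ := eq_inv_of_mul_eq_one_right g2
  have n1 : p1 ≠ 0 := left_ne_zero_of_mul_eq_one g1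
  have n2 : p2 ≠ 0 := left_ne_zero_of_mul_eq_one g2
  refine ⟨?_, ?_, ?_, ?_, ?_⟩
  · ring
  · ring
  · ring
  · field_simp
    ring
  · field_simp
    ring

end Entries

theorem connectionMatrix_formsOfMatrix (α φ1 φ2 ψ : Form1 (𝓡 3) M) :
    c.connectionMatrix (formsOfMatrix
      (liftedConnection (formMatrix c.θ c.Z1 c.Z2 0 α φ1 φ2 ψ))) =
      liftedConnection (formMatrix c.θ c.Z1 c.Z2 0 α φ1 φ2 ψ) := by
  have h := fun y u => liftedConnection_entries c α φ1 φ2 ψ y u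
  generalize liftedConnection (formMatrix c.θ c.Z1 c.Z2 0 α φ1 φ2 ψ) = A at *
  refine Matrix.ext fun i j => ?_
  funext y
  ext u
  obtain ⟨h1, h2, h3, h4, h5⟩ := h y u
  fin_cases i <;> fin_cases j
  · refine Eq.trans ?_ h4.symm
    change -((1 / 2 : ℂ) * c.φ y u) - (1 / 3 : ℂ) * ((3 / 2 : ℂ) * A 1 1 y u) = _
    ring
  · change - -A 0 1 y u = A 0 1 y u
    ring
  · change -((1 / 4 : ℂ) * ((-4 : ℂ) * A 0 2 y u)) = A 0 2 y u
    ring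
  · exact h1.symm
  · change (2 / 3 : ℂ) * ((3 / 2 : ℂ) * A 1 1 y u) = A 1 1 y u
    ring
  · change (1 / 2 : ℂ) * ((2 : ℂ) * A 1 2 y u) = A 1 2 y u
    ring
  · exact h2.symm
  · exact h3.symm
  · refine Eq.trans ?_ h5.symm
    change (1 / 2 : ℂ) * c.φ y u - (1 / 3 : ℂ) * ((3 / 2 : ℂ) * A 1 1 y u) = _
    ring

/-- Conjugation by an upper triangular matrix keeps the curvature strictly upper triangular, and `ω
∧ ω¹`, `ω ∧ ω²` are multiples of the lifts of `θ ∧ Z¹`, `θ ∧ Z²`. -/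
theorem isNormalCurvature_liftedConnection {A : Matrix (Fin 3) (Fin 3) (Form1 (𝓡 3) M)}
    (sA : ∀ i j, SmoothForm (A i j)) (hK : IsNormalCurvature c.θ c.Z1 c.Z2 (curvature A)) :
    IsNormalCurvature c.ω c.ω1 c.ω2 (curvature (liftedConnection A)) := by
  obtain ⟨Q1, Q2, U1, U2, K⟩ := hK
  -- Here `b¹, b²` are the inverses of `a¹, a²`. The powers compensate `ω ∧ ω¹ = (a¹)²a² θ ∧ Z¹` and
  -- `ω ∧ ω² = a¹(a²)² θ ∧ Z²`; the off-diagonal entries of the gauge function mix `Q¹, Q²` into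
  -- `U₁, U₂`.
  refine ⟨fun y => Q1 (proj y) * b2 y ^ 2 * (b1 y * b2 y),
    fun y => Q2 (proj y) * b1 y ^ 2 * (b1 y * b2 y),
    fun y => (2 * b1 y * Q2 (proj y) * v1 y + b1 y * b2 y * U1 (proj y)) * (b1 y * b2 y) * b1 y,
    fun y => (b1 y * b2 y * U2 (proj y) - 2 * v2 y * b2 y * Q1 (proj y)) * (b1 y * b2 y) * b2 y, ?_⟩
  refine Matrix.ext fun i j => ?_
  funext y u v
  have g1 := a1_mul_b1 y
  have g2 := a2_mul_b2 y
  obtain ⟨h00, h01, h02, h10, h11, h12, h20, h21, h22⟩ := frameFun_apply y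
  obtain ⟨k00, k01, k02, k10, k11, k12, k20, k21, k22⟩ := frameInv_apply y
  have w01 : wedge c.ω c.ω1 y u v = a1 y ^ 2 * a2 y * wedge (liftY c.θ) (liftY c.Z1) y u v := by
    change (a1 y * a2 y * liftY c.θ y u) * (a1 y * liftY c.Z1 y v +
      v1 y * (a1 y * a2 y) * liftY c.θ y v) - (a1 y * a2 y * liftY c.θ y v) *
      (a1 y * liftY c.Z1 y u + v1 y * (a1 y * a2 y) * liftY c.θ y u) = a1 y ^ 2 * a2 y *
      (liftY c.θ y u * liftY c.Z1 y v - liftY c.θ y v * liftY c.Z1 y u)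
    ring
  have w02 : wedge c.ω c.ω2 y u v = a1 y * a2 y ^ 2 * wedge (liftY c.θ) (liftY c.Z2) y u v := by
    change (a1 y * a2 y * liftY c.θ y u) * (a2 y * liftY c.Z2 y v +
      v2 y * (a1 y * a2 y) * liftY c.θ y v) - (a1 y * a2 y * liftY c.θ y v) *
      (a2 y * liftY c.Z2 y u + v2 y * (a1 y * a2 y) * liftY c.θ y u) = a1 y * a2 y ^ 2 *
      (liftY c.θ y u * liftY c.Z2 y v - liftY c.θ y v * liftY c.Z2 y u)
    ring
  have w03 : ∀ f g : YBundle M → ℂ, wedge (f • c.ω1 + g • c.ω2) c.ω y u v =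
      -(f y * wedge c.ω c.ω1 y u v + g y * wedge c.ω c.ω2 y u v) := by
    intro f g
    simp only [wedge, Pi.add_apply, Pi.smul_apply', add_apply, smul_apply, smul_eq_mul]
    ring
  have F01 : curvature A 0 1 (proj y) (mfderiv IY (𝓡 3) proj y u) (mfderiv IY (𝓡 3) proj y v) =
      -(Q2 (proj y) * wedge (liftY c.θ) (liftY c.Z1) y u v) := by
    rw [K]; rfl
  have F12 : curvature A 1 2 (proj y) (mfderiv IY (𝓡 3) proj y u) (mfderiv IY (𝓡 3) proj y v) =
      1 / 2 * (Q1 (proj y) * wedge (liftY c.θ) (liftY c.Z2) y u v) := by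
    rw [K]; rfl
  have F02 : curvature A 0 2 (proj y) (mfderiv IY (𝓡 3) proj y u) (mfderiv IY (𝓡 3) proj y v) =
      1 / 4 * (U1 (proj y) * wedge (liftY c.θ) (liftY c.Z1) y u v +
        U2 (proj y) * wedge (liftY c.θ) (liftY c.Z2) y u v) := by
    rw [K]
    change -(1 / 4 * ((U1 (proj y) * liftY c.Z1 y u + U2 (proj y) * liftY c.Z2 y u) *
      liftY c.θ y v - (U1 (proj y) * liftY c.Z1 y v + U2 (proj y) * liftY c.Z2 y v) *
      liftY c.θ y u)) = 1 / 4 * (U1 (proj y) * (liftY c.θ y u * liftY c.Z1 y v - liftY c.θ y v *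
      liftY c.Z1 y u) + U2 (proj y) * (liftY c.θ y u * liftY c.Z2 y v - liftY c.θ y v *
      liftY c.Z2 y u))
    ring
  have F00 : curvature A 0 0 (proj y) (mfderiv IY (𝓡 3) proj y u) (mfderiv IY (𝓡 3) proj y v) =
      0 := by rw [K]; rfl
  have F10 : curvature A 1 0 (proj y) (mfderiv IY (𝓡 3) proj y u) (mfderiv IY (𝓡 3) proj y v) =
      0 := by rw [K]; rfl
  have F11 : curvature A 1 1 (proj y) (mfderiv IY (𝓡 3) proj y u) (mfderiv IY (𝓡 3) proj y v) =
      0 := by rw [K]; rfl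
  have F20 : curvature A 2 0 (proj y) (mfderiv IY (𝓡 3) proj y u) (mfderiv IY (𝓡 3) proj y v) =
      0 := by rw [K]; rfl
  have F21 : curvature A 2 1 (proj y) (mfderiv IY (𝓡 3) proj y u) (mfderiv IY (𝓡 3) proj y v) =
      0 := by rw [K]; rfl
  have F22 : curvature A 2 2 (proj y) (mfderiv IY (𝓡 3) proj y u) (mfderiv IY (𝓡 3) proj y v) =
      0 := by rw [K]; rfl
  rw [curvature_liftedConnection sA]
  simp only [Fin.sum_univ_three, F00, F01, F02, F10, F11, F12, F20, F21, F22]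
  generalize wedge (liftY c.θ) (liftY c.Z1) y u v = X1 at *
  generalize wedge (liftY c.θ) (liftY c.Z2) y u v = X2 at *
  have q1 : b1 y = (a1 y)⁻¹ := eq_inv_of_mul_eq_one_right g1
  have q2 : b2 y = (a2 y)⁻¹ := eq_inv_of_mul_eq_one_right g2
  have n1 : a1 y ≠ 0 := left_ne_zero_of_mul_eq_one g1
  have n2 : a2 y ≠ 0 := left_ne_zero_of_mul_eq_one g2
  fin_cases i <;> fin_cases j <;> simp only [Fin.zero_eta, Fin.mk_one, Fin.reduceFinMk, h00, h01,
    h02, h10, h11, h12, h20, h21, h22, k00, k01, k02, k10, k11, k12, k20, k21, k22]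
  · change _ = (0 : ℂ)
    ring
  · change _ = -(Q2 (proj y) * b1 y ^ 2 * (b1 y * b2 y) * wedge c.ω c.ω1 y u v)
    rw [w01, q1, q2]
    field_simp
    ring
  · change _ = -(1 / 4 * wedge (_ • c.ω1 + _ • c.ω2) c.ω y u v)
    rw [w03, w01, w02, q1, q2]
    field_simp
    ring
  · change _ = (0 : ℂ)
    ring
  · change _ = (0 : ℂ)
    ring
  · change _ = 1 / 2 * (Q1 (proj y) * b2 y ^ 2 * (b1 y * b2 y) * wedge c.ω c.ω2 y u v)
    rw [w02, q1, q2]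
    field_simp
    ring
  · change _ = (0 : ℂ)
    ring
  · change _ = (0 : ℂ)
    ring
  · change _ = (0 : ℂ)
    ring

/-- The lift of the explicit normal connection of `(θ, Z¹, Z²)` is a solution, so the forms picked
by `Classical.epsilon` satisfy the conditions. Their uniqueness is needed, and proved, only after
pulling back to `M`. -/
theorem AdaptedCoframe.isCanonical : c.IsCanonical c.canonicalForms := by
  refine Classical.epsilon_spec (p := c.IsCanonical) ?_
  obtain ⟨μ, t1, t2, hB⟩ := c.exists_isPseudo
  obtain ⟨D, hD, sD⟩ := hB.exists_data
  have sm := LocalData.smooth_matrix hB sD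
  have hK := LocalData.isNormalCurvature hB sD hD
  have sl := smooth_liftedConnection sm
  refine ⟨formsOfMatrix (liftedConnection (D.matrix _)), (sl 1 1).const_smul _,
    (sl 1 2).const_smul _, (sl 0 1).neg, (sl 0 2).const_smul _, ?_⟩
  have h := isNormalCurvature_liftedConnection c sm hK
  exact (connectionMatrix_formsOfMatrix c _ _ _ _).symm ▸ h

end CanonicalConnection

/-! ### Pullback preserves normal curvature. -/

section PullbackNormal

variable {E : Type*} [NormedAddCommGroup E] [NormedSpace ℝ E] {H : Type*} [TopologicalSpace H]
  {I : ModelWithCorners ℝ E H} {N : Type*} [TopologicalSpace N] [ChartedSpace H N]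
  {E' : Type*} [NormedAddCommGroup E'] [NormedSpace ℝ E'] {H' : Type*}
  [TopologicalSpace H'] {I' : ModelWithCorners ℝ E' H'} {N' : Type*} [TopologicalSpace N']
  [ChartedSpace H' N']

theorem formMatrix_pull1 (f : N → N') (θ θ1 θ2 φ α φ1 φ2 ψ : Form1 I' N') :
    (Matrix.of fun i j => pull1 (I := I) f (formMatrix θ θ1 θ2 φ α φ1 φ2 ψ i j)) =
      formMatrix (pull1 f θ) (pull1 f θ1) (pull1 f θ2) (pull1 f φ) (pull1 f α) (pull1 f φ1)
        (pull1 f φ2) (pull1 f ψ) := by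
  refine Matrix.ext fun i j => ?_
  funext x
  ext u
  fin_cases i <;> fin_cases j <;> rfl

theorem IsNormalCurvature.pull1 [I.Boundaryless] [IsManifold I ∞ N] [I'.Boundaryless]
    [IsManifold I' ∞ N'] {f : N → N'} (hf : ContMDiff I I' ∞ f) {θ θ1 θ2 : Form1 I' N'}
    {π : Matrix (Fin 3) (Fin 3) (Form1 I' N')} (hπ : ∀ i j, SmoothForm (π i j))
    (h : IsNormalCurvature θ θ1 θ2 (curvature π)) :
    IsNormalCurvature (pull1 f θ) (pull1 f θ1) (pull1 f θ2)
      (curvature (Matrix.of fun i j => FlagGeometry.pull1 (I := I) f (π i j))) := by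
  obtain ⟨Q1, Q2, U1, U2, K⟩ := h
  refine ⟨Q1 ∘ f, Q2 ∘ f, U1 ∘ f, U2 ∘ f, ?_⟩
  refine Matrix.ext fun i j => ?_
  funext x u v
  rw [curvature_pull1 hf hπ, K]
  fin_cases i <;> fin_cases j <;> rfl

end PullbackNormal

/-! ### The canonical connection along a section of `X`. -/

section Section

open YBundle

variable {M : Type*} [TopologicalSpace M] [ChartedSpace (EuclideanSpace ℝ (Fin 3)) M]
  [IsManifold (𝓡 3) ∞ M] {F : FlagStructure M} (c : AdaptedCoframe F)

theorem XBundle.contMDiff_toY : ContMDiff IX IY ∞ (XBundle.toY (M := M)) :=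
  contMDiff_fst.prodMk (contMDiff_snd.prodMk (contMDiff_snd.inv.prodMk
    (contMDiff_const.prodMk (contMDiff_const.prodMk contMDiff_const))))

theorem XBundle.lam_toY (p : XBundle M) : lam (XBundle.toY p) = 1 := p.2.mul_inv

theorem AdaptedCoframe.smooth_connection (i j : Fin 3) : SmoothForm (c.connection i j) :=
  smoothForm_formMatrix c.smooth_ω c.smooth_ω1 c.smooth_ω2 c.smooth_φ c.isCanonical.smooth_ω11
    c.isCanonical.smooth_φ1 c.isCanonical.smooth_φ2 c.isCanonical.smooth_ψ i j

variable {σ : M → XBundle M} (hσ : XBundle.IsSection σ)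
include hσ

theorem XBundle.IsSection.contMDiff_toY : ContMDiff (𝓡 3) IY ∞ (XBundle.toY ∘ σ) :=
  XBundle.contMDiff_toY.comp hσ.smooth

theorem XBundle.IsSection.pull1_liftY (α : Form1 (𝓡 3) M) :
    pull1 (XBundle.toY ∘ σ) (liftY α) = α := by
  rw [liftY, pull1_pull1 hσ.contMDiff_toY YBundle.contMDiff_proj,
    show YBundle.proj ∘ XBundle.toY ∘ σ = id from funext hσ.proj_eq, pull1_id]

theorem AdaptedCoframe.pull1_ω : pull1 (XBundle.toY ∘ σ) c.ω = (c.baseForms σ).θ := by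
  rw [c.baseForms_θ hσ]
  funext x
  ext u
  change lam (XBundle.toY (σ x)) * pull1 (XBundle.toY ∘ σ) (liftY c.θ) x u = _
  rw [hσ.pull1_liftY, XBundle.lam_toY, one_mul]

theorem AdaptedCoframe.pull1_ω1 : pull1 (XBundle.toY ∘ σ) c.ω1 = (c.baseForms σ).θ1 := by
  rw [c.baseForms_θ1 hσ]
  funext x
  ext u
  change XBundle.a (σ x) * pull1 (XBundle.toY ∘ σ) (liftY c.Z1) x u + (0 * _) * _ = _
  rw [hσ.pull1_liftY, zero_mul, zero_mul, add_zero]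
  rfl

theorem AdaptedCoframe.pull1_ω2 : pull1 (XBundle.toY ∘ σ) c.ω2 = (c.baseForms σ).θ2 := by
  rw [c.baseForms_θ2 hσ]
  funext x
  ext u
  change (((σ x).2⁻¹ : ℂˣ) : ℂ) * pull1 (XBundle.toY ∘ σ) (liftY c.Z2) x u + (0 * _) * _ = _
  rw [hσ.pull1_liftY, zero_mul, zero_mul, add_zero, Units.val_inv_eq_inv_val]
  rfl

/-- Along the image of `X` the function `λ` is constantly 1, so `dλ` pulls back to zero; the other
terms carry a factor `v¹`, `v²` or `t`, all zero there. -/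
theorem AdaptedCoframe.pull1_φ : pull1 (XBundle.toY ∘ σ) c.φ = (0 : Form1 (𝓡 3) M) := by
  have h := pull1_dFun hσ.contMDiff_toY (contMDiff_lam (M := M))
  rw [show lam ∘ XBundle.toY ∘ σ = fun _ => (1 : ℂ) from funext fun x => XBundle.lam_toY _] at h
  funext x
  ext u
  change -(_ * pull1 (XBundle.toY ∘ σ) (dFun IY lam) x u) + (_ * 0) * _ - (_ * 0) * _ + 0 * _ =
    (0 : ℂ)
  rw [h, dFun_const_apply]
  ring

/-- The pullback of the canonical connection along a section of the reduced bundle. -/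
theorem AdaptedCoframe.pull1_connection :
    (Matrix.of fun i j => pull1 (XBundle.toY ∘ σ) (c.connection i j)) =
      formMatrix (c.baseForms σ).θ (c.baseForms σ).θ1 (c.baseForms σ).θ2 0
        (pull1 (XBundle.toY ∘ σ) c.canonicalForms.ω11) (pull1 (XBundle.toY ∘ σ) c.canonicalForms.φ1)
        (pull1 (XBundle.toY ∘ σ) c.canonicalForms.φ2)
        (pull1 (XBundle.toY ∘ σ) c.canonicalForms.ψ) := by
  rw [← c.pull1_ω hσ, ← c.pull1_ω1 hσ, ← c.pull1_ω2 hσ, ← c.pull1_φ hσ, ← formMatrix_pull1]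
  rfl

/-- The pulled back connection and the explicit one are both normal, with the same tautological
forms and `φ = 0`, so the uniqueness statement identifies them. -/
theorem AdaptedCoframe.pull1_canonicalForms {D : LocalData M} (hD : D.IsDataOf (c.baseForms σ))
    (sD : D.IsSmooth) :
    pull1 (XBundle.toY ∘ σ) c.canonicalForms.ω11 = D.ω11 (c.baseForms σ) ∧
    pull1 (XBundle.toY ∘ σ) c.canonicalForms.φ1 = D.φ1 (c.baseForms σ) ∧
    pull1 (XBundle.toY ∘ σ) c.canonicalForms.φ2 = D.φ2 (c.baseForms σ) ∧
    pull1 (XBundle.toY ∘ σ) c.canonicalForms.ψ = D.ψ (c.baseForms σ) := by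
  have hB := c.baseForms_isPseudo hσ
  have h := IsNormalCurvature.pull1 hσ.contMDiff_toY c.smooth_connection
    (θ := c.ω) (θ1 := c.ω1) (θ2 := c.ω2) c.isCanonical.structure_eq
  rw [c.pull1_ω hσ, c.pull1_ω1 hσ, c.pull1_ω2 hσ, c.pull1_connection hσ] at h
  exact formMatrix_unique hB.coframe hB.smooth_θ hB.smooth_θ1 hB.smooth_θ2 hB.d_θ
    (c.isCanonical.smooth_ω11.pull1 hσ.contMDiff_toY) (LocalData.smooth_ω11 hB sD) h
    (LocalData.isNormalCurvature hB sD hD)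

end Section

end FlagGeometry

open FlagGeometry in
theorem proposition7p2 {M : Type*} [TopologicalSpace M]
    [ChartedSpace (EuclideanSpace ℝ (Fin 3)) M] [IsManifold (𝓡 3) ((⊤ : ℕ∞) : WithTop ℕ∞) M]
    (F : FlagStructure M) (c : AdaptedCoframe F)
    (σ : M → XBundle M) (hσ : XBundle.IsSection σ)
    (s : M → YBundle M) (hs : s = XBundle.toY ∘ σ) :
    -- the section `s` lies over `σ` and satisfies `s*φ = 0`
    (pull1 s c.ω = (c.baseForms σ).θ ∧ pull1 s c.ω1 = (c.baseForms σ).θ1 ∧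
      pull1 s c.ω2 = (c.baseForms σ).θ2 ∧ pull1 s c.φ = (0 : Form1 (𝓡 3) M)) ∧
    ∃ D : LocalData M, D.IsDataOf (c.baseForms σ) ∧
      -- the functions `E¹, E², G` are the components of the pulled back connection
      pull1 s c.canonicalForms.ω11 =
        (c.baseForms σ).θ11 - (1 / 4 : ℂ) • D.R • (c.baseForms σ).θ ∧
      pull1 s c.canonicalForms.φ1 =
        -((1 / 4 : ℂ) • D.R • (c.baseForms σ).θ1) + D.E1 • (c.baseForms σ).θ
          + (c.baseForms σ).τ1 ∧
      pull1 s c.canonicalForms.φ2 =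
        (1 / 4 : ℂ) • D.R • (c.baseForms σ).θ2 + D.E2 • (c.baseForms σ).θ
          + (c.baseForms σ).τ2 ∧
      pull1 s c.canonicalForms.ψ =
        D.E2 • (c.baseForms σ).θ1 - D.E1 • (c.baseForms σ).θ2 + D.G • (c.baseForms σ).θ ∧
      -- the formula for `s*TC₂(π)`
      pull3 s (TC2 c.connection) =
        (1 / (8 * (Real.pi : ℂ) ^ 2)) •
          ((fun x => 1 / 2 * D.G x + 1 / 16 * D.R x ^ 2 - D.τ1_2 x * D.τ2_1 x) •
              wedge12 (c.baseForms σ).θ (wedge (c.baseForms σ).θ1 (c.baseForms σ).θ2) +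
            wedge12 (c.baseForms σ).θ11
              (D.E2 • wedge (c.baseForms σ).θ (c.baseForms σ).θ1 +
                D.E1 • wedge (c.baseForms σ).θ (c.baseForms σ).θ2 -
                (1 / 2 : ℂ) • D.R • wedge (c.baseForms σ).θ1 (c.baseForms σ).θ2)) := by

  subst hs
  have hB := c.baseForms_isPseudo hσ
  obtain ⟨D, hD, sD⟩ := hB.exists_data
  obtain ⟨h1, h2, h3, h4⟩ := c.pull1_canonicalForms hσ hD sD
  refine ⟨⟨c.pull1_ω hσ, c.pull1_ω1 hσ, c.pull1_ω2 hσ, c.pull1_φ hσ⟩, D, hD, h1, h2, h3, h4, ?_⟩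
  -- By naturality the secondary form may be computed on `M`, from the explicit matrix.
  rw [← TC2_pull1 hσ.contMDiff_toY c.smooth_connection, c.pull1_connection hσ, h1, h2, h3, h4]
  exact LocalData.TC2_matrix hB sD hD
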